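/- For $s\in[0,\frac{\pi}{2})$ let $\mathcal R_s$ be the family of all open (nondegenerate) rectangles in $\mathbb R^2$ having a side that forms the angle $s$ with the abscissa axis. For $f\in L^1(\mathbb R^2)$, say that $\mathcal R_s$ differentiates $\int f$ if $$\lim_{\operatorname{diam}(R)\to 0,\ x\in R\in\mathcal R_s}\frac1{|R|}\int_R f=f(x)\quad\text{for almost every }x\in\mathbb R^2,$$ and put $$\overline D_sf(x)=\limsup_{\operatorname{diam}(R)\to 0,\ x\in R\in\mathcal R_s}\frac1{|R|}\int_R f\in[-\infty,\infty].$$ A set $S\subset[0,\frac{\pi}{2})$ is called a $WR$-set if there exists a real-valued function $f\in L^1(\mathbb R^2)$ such that $\mathcal R_s$ differentiates $\int f$ for every $s\in[0,\frac{\pi}{2})\setminus S$, and for every $s\in S$ the set $\{x\in\mathbb R^2:\overline D_sf(x)=\infty\}$ has positive Lebesgue measure. Theorem. A set $S\subset[0,\frac{\pi}{2})$ is a $WR$-set if and only if it is a $G_{\delta\sigma}$ set, that is, a countable union of $G_\delta$ sets. -/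

import Mathlib

open MeasureTheory Filter Topology

noncomputable section

namespace WeakRSet

/-- The Euclidean plane, with its Lebesgue measure `volume`. -/
abbrev Plane : Type := EuclideanSpace ℝ (Fin 2)

/-- The open rectangle of slope `s` that is the product of the interval `(a, b)` in the direction
`(cos s, sin s)` and of the interval `(c, d)` in the orthogonal direction `(-sin s, cos s)`. -/
def rectangle (s a b c d : ℝ) : Set Plane :=
  {x | x 0 * Real.cos s + x 1 * Real.sin s ∈ Set.Ioo a b ∧
    -(x 0 * Real.sin s) + x 1 * Real.cos s ∈ Set.Ioo c d}

/-- The family of all (nondegenerate) open rectangles having a side that forms the angle `s` with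
the abscissa. -/
def rectangles (s : ℝ) : Set (Set Plane) :=
  {R | ∃ a b c d : ℝ, a < b ∧ c < d ∧ R = rectangle s a b c d}

/-- The filter of the limit `diam R → 0`, `x ∈ R`, `R` an open rectangle of slope `s`. -/
def shrinking (s : ℝ) (x : Plane) : Filter (Set Plane) :=
  comap Metric.diam (𝓝 (0 : ℝ)) ⊓ 𝓟 {R | R ∈ rectangles s ∧ x ∈ R}

/-- The rectangles of slope `s` differentiate the integral of `f`: the averages of `f` over them
converge to `f x` for almost every `x`. -/
def Differentiates (s : ℝ) (f : Plane → ℝ) : Prop :=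
  ∀ᵐ x : Plane, Tendsto (fun R : Set Plane => ⨍ y in R, f y) (shrinking s x) (𝓝 (f x))

/-- The upper derivative of the integral of `f` at `x` along the rectangles of slope `s`, an
extended real number. -/
def upperDerivative (s : ℝ) (f : Plane → ℝ) (x : Plane) : EReal :=
  limsup (fun R : Set Plane => ((⨍ y in R, f y : ℝ) : EReal)) (shrinking s x)

/-- `S` is a weak `R`-set: for some integrable `f`, the rectangles of slope `s` differentiate the
integral of `f` for all `s ∈ [0, π/2)` outside `S`, and for every `s ∈ S` the upper derivative is
`+∞` on a set of positive measure. -/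
def IsWRSet (S : Set ℝ) : Prop :=
  ∃ f : Plane → ℝ, Integrable f ∧
    (∀ s ∈ Set.Ico (0 : ℝ) (Real.pi / 2) \ S, Differentiates s f) ∧
    ∀ s ∈ S, 0 < volume {x : Plane | upperDerivative s f x = ⊤}

/-- A `G_{δσ}` set: a countable union of `G_δ` sets. -/
def IsGδσ {X : Type*} [TopologicalSpace X] (S : Set X) : Prop :=
  ∃ V : ℕ → Set X, (∀ n, IsGδ (V n)) ∧ S = ⋃ n, V n

end WeakRSet

end

noncomputable section

namespace WeakRSet

/-! Necessity is semicontinuity. For a fixed integrable `f`, a rectangle with a large mean keeps a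
large mean when it is slightly rotated, so the pairs `(s, x)` for which `x` lies in a rectangle of
slope `s`, of diameter less than `1/(N+1)` and with mean above `N`, form an open set. The points of
infinite upper derivative are the intersection over `N` of the sections of these sets. Inside a
fixed ball this intersection has measure at least `c > 0` for a `G_δ` set of slopes
(`isGδ_setOf_le_volume_iInter`); countably many choices of `c` and of the ball exhaust `S`.

Sufficiency rests on `exists_block`: a nonnegative function of integral at most `ε` whose means over
rectangles of diameter less than `ε` exceed `Λ` on a set of measure at least 1/2, for every slope in
`[θ, θ + h]`, while for slopes at distance at least `40 h` from `θ` modulo `π/2` its means exceed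
`ε` only on a set of measure at most `ε`. It is built in three stages. (1) `exists_directional_set`
gives a set `E`, boxes placed on a multi-scale digit set, whose projections along the directions
near the abscissa are tiny but whose projections along directions far from the axes have bounded
density. (2) By the first property, long thin rectangles through `E` with large mean cover an area
growing like the number of dyadic lengths allowed (`le_volume_hitSet`). By the second, a sparse
family of translates of `E` is harmless in the other directions (`volume_exceeds_placed_le`). (3)
`exists_placement` puts one translate of `E` in each cell of a grid so that, for all the bad slopes
at once, the areas in (2) cover half of a large square. Rescaling this square to size one gives the
block.

For a `G_δ` set `V`, the intersection of decreasing open sets `G_k`, one sums blocks with `Λ = k`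
over the Whitney intervals of all the `G_k` (`exists_gδ_function`). A slope in `V` meets an interval
of every generation. A slope outside `V` modulo `π/2` is close to only finitely many of the
intervals, and Borel–Cantelli disposes of the other blocks. A countable union of such sets is
handled by using disjoint vertical strips of the plane, one for each set (`isWRSet_of_gδ_family`).
-/

/-! ### Rotated coordinates and rectangles. -/

/-- The coordinate in the direction `(cos s, sin s)`. -/
def cX (s : ℝ) (x : Plane) : ℝ := x 0 * Real.cos s + x 1 * Real.sin s

/-- The coordinate in the direction `(-sin s, cos s)`. -/
def cY (s : ℝ) (x : Plane) : ℝ := -(x 0 * Real.sin s) + x 1 * Real.cos s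

lemma mem_rectangle {s a b c d : ℝ} {x : Plane} :
    x ∈ rectangle s a b c d ↔ cX s x ∈ Set.Ioo a b ∧ cY s x ∈ Set.Ioo c d := Iff.rfl

@[fun_prop]
lemma continuous_cX' : Continuous fun p : ℝ × Plane => cX p.1 p.2 := by
  unfold cX; fun_prop

@[fun_prop]
lemma continuous_cY' : Continuous fun p : ℝ × Plane => cY p.1 p.2 := by
  unfold cY; fun_prop

@[fun_prop]
lemma continuous_cX (s : ℝ) : Continuous (cX s) := by unfold cX; fun_prop

@[fun_prop]
lemma continuous_cY (s : ℝ) : Continuous (cY s) := by unfold cY; fun_prop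

lemma cX_add (s : ℝ) (x y : Plane) : cX s (x + y) = cX s x + cX s y := by
  simp [cX]; ring

lemma cY_add (s : ℝ) (x y : Plane) : cY s (x + y) = cY s x + cY s y := by
  simp [cY]; ring

lemma cX_sub (s : ℝ) (x y : Plane) : cX s (x - y) = cX s x - cX s y := by
  simp [cX]; ring

lemma cY_sub (s : ℝ) (x y : Plane) : cY s (x - y) = cY s x - cY s y := by
  simp [cY]; ring

lemma cX_smul (s r : ℝ) (x : Plane) : cX s (r • x) = r * cX s x := by
  simp [cX]; ring

lemma cY_smul (s r : ℝ) (x : Plane) : cY s (r • x) = r * cY s x := by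
  simp [cY]; ring

lemma norm_sq_coord (x : Plane) : ‖x‖ ^ 2 = x 0 ^ 2 + x 1 ^ 2 := by
  rw [EuclideanSpace.norm_sq_eq]; simp

lemma norm_sq_eq (s : ℝ) (x : Plane) : ‖x‖ ^ 2 = cX s x ^ 2 + cY s x ^ 2 := by
  rw [norm_sq_coord, cX, cY]
  linear_combination -(x 0 ^ 2 + x 1 ^ 2) * (Real.sin_sq_add_cos_sq s)

lemma abs_cX_le (s : ℝ) (x : Plane) : |cX s x| ≤ ‖x‖ :=
  abs_le_of_sq_le_sq (by rw [norm_sq_eq s]; nlinarith [sq_nonneg (cY s x)]) (norm_nonneg _)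

lemma abs_cY_le (s : ℝ) (x : Plane) : |cY s x| ≤ ‖x‖ :=
  abs_le_of_sq_le_sq (by rw [norm_sq_eq s]; nlinarith [sq_nonneg (cX s x)]) (norm_nonneg _)

lemma norm_le_abs_add (s : ℝ) (x : Plane) : ‖x‖ ≤ |cX s x| + |cY s x| := by
  refine le_of_sq_le_sq ?_ (by positivity) |> fun h => h
  rw [norm_sq_eq s, ← sq_abs (cX s x), ← sq_abs (cY s x)]
  nlinarith [abs_nonneg (cX s x), abs_nonneg (cY s x)]

/-- The coordinate change to the frame of slope `s`. -/
def rot (s : ℝ) : Plane ≃ₗᵢ[ℝ] Plane :=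
  LinearIsometry.toLinearIsometryEquiv
    { toFun := fun x => !₂[cX s x, cY s x]
      map_add' := fun x y => by ext i; fin_cases i <;> simp [cX_add, cY_add]
      map_smul' := fun r x => by ext i; fin_cases i <;> simp [cX_smul, cY_smul]
      norm_map' := fun x => by
        rw [← sq_eq_sq₀ (norm_nonneg _) (norm_nonneg _), norm_sq_eq s x, norm_sq_coord]
        simp }
    rfl

@[simp] lemma rot_zero (s : ℝ) (x : Plane) : (rot s x) 0 = cX s x := rfl
@[simp] lemma rot_one (s : ℝ) (x : Plane) : (rot s x) 1 = cY s x := rfl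

lemma cX_rot (s t : ℝ) (x : Plane) : cX s (rot t x) = cX (s + t) x := by
  rw [cX, rot_zero, rot_one, cX, cX, cY, Real.cos_add, Real.sin_add]; ring

lemma cY_rot (s t : ℝ) (x : Plane) : cY s (rot t x) = cY (s + t) x := by
  rw [cY, rot_zero, rot_one, cY, cX, cY, Real.cos_add, Real.sin_add]; ring

lemma cX_add_pi_div_two (s : ℝ) (x : Plane) : cX (s + Real.pi / 2) x = cY s x := by
  simp [cX, cY, Real.cos_add_pi_div_two, Real.sin_add_pi_div_two]

lemma cY_add_pi_div_two (s : ℝ) (x : Plane) : cY (s + Real.pi / 2) x = -cX s x := by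
  simp [cX, cY, Real.cos_add_pi_div_two, Real.sin_add_pi_div_two]; ring

lemma measurePreserving_coord : MeasurePreserving (fun x : Plane => (x 0, x 1)) := by
  have h1 := PiLp.volume_preserving_ofLp (Fin 2)
  have h2 := volume_preserving_finTwoArrow ℝ
  exact h2.comp h1

lemma measurePreserving_coords (s : ℝ) :
    MeasurePreserving (fun x : Plane => (cX s x, cY s x)) :=
  measurePreserving_coord.comp (rot s).measurePreserving

lemma volume_coords {s : ℝ} {S T : Set ℝ} (hS : MeasurableSet S) (hT : MeasurableSet T) :
    volume {x : Plane | cX s x ∈ S ∧ cY s x ∈ T} = volume S * volume T := by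
  have := (measurePreserving_coords s).measure_preimage (s := S ×ˢ T)
    (hS.prod hT).nullMeasurableSet
  rw [Measure.volume_eq_prod, Measure.prod_prod] at this
  exact this

lemma isOpen_rectangle (s a b c d : ℝ) : IsOpen (rectangle s a b c d) :=
  (isOpen_Ioo.preimage (continuous_cX s)).inter (isOpen_Ioo.preimage (continuous_cY s))

lemma volume_rectangle (s : ℝ) {a b : ℝ} (c d : ℝ) (hab : a ≤ b) :
    volume (rectangle s a b c d) = ENNReal.ofReal ((b - a) * (d - c)) := by
  have := volume_coords (s := s) (measurableSet_Ioo (a := a) (b := b))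
    (measurableSet_Ioo (a := c) (b := d))
  rw [Real.volume_Ioo, Real.volume_Ioo, ← ENNReal.ofReal_mul (by linarith)] at this
  exact this

lemma rectangle_average (f : Plane → ℝ) (s : ℝ) {a b c d : ℝ} (hab : a < b) (hcd : c < d) :
    ⨍ y in rectangle s a b c d, f y
      = ((b - a) * (d - c))⁻¹ * ∫ y in rectangle s a b c d, f y := by
  rw [setAverage_eq, measureReal_def, volume_rectangle s c d hab.le, ENNReal.toReal_ofReal,
    smul_eq_mul]
  exact (mul_pos (sub_pos.2 hab) (sub_pos.2 hcd)).le

lemma convex_rectangle (s a b c d : ℝ) : Convex ℝ (rectangle s a b c d) := by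
  have hX : IsLinearMap ℝ (cX s) := ⟨cX_add s, cX_smul s⟩
  have hY : IsLinearMap ℝ (cY s) := ⟨cY_add s, cY_smul s⟩
  exact ((convex_Ioo a b).is_linear_preimage hX).inter ((convex_Ioo c d).is_linear_preimage hY)

lemma dist_le_of_mem_rectangle {s a b c d : ℝ} {x y : Plane} (hx : x ∈ rectangle s a b c d)
    (hy : y ∈ rectangle s a b c d) : dist x y ≤ (b - a) + (d - c) := by
  rw [dist_eq_norm]
  refine (norm_le_abs_add s _).trans ?_
  rw [cX_sub, cY_sub]
  obtain ⟨⟨h1, h2⟩, h3, h4⟩ := mem_rectangle.1 hx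
  obtain ⟨⟨k1, k2⟩, k3, k4⟩ := mem_rectangle.1 hy
  exact add_le_add (abs_le.2 ⟨by linarith, by linarith⟩) (abs_le.2 ⟨by linarith, by linarith⟩)

lemma isBounded_rectangle (s a b c d : ℝ) : Bornology.IsBounded (rectangle s a b c d) :=
  Metric.isBounded_iff.2 ⟨_, fun _ hx _ hy => dist_le_of_mem_rectangle hx hy⟩

lemma diam_rectangle_le {s a b c d : ℝ} (hab : a < b) (hcd : c < d) :
    Metric.diam (rectangle s a b c d) ≤ (b - a) + (d - c) :=
  Metric.diam_le_of_forall_dist_le (by linarith) fun _ hx _ hy => dist_le_of_mem_rectangle hx hy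

lemma volume_frontier_rectangle (s a b c d : ℝ) :
    volume (frontier (rectangle s a b c d)) = 0 :=
  (convex_rectangle s a b c d).addHaar_frontier volume

/-! ### Limits along shrinking rectangles and upper derivatives. -/

lemma exists_rectangle (s : ℝ) (x : Plane) {δ : ℝ} (hδ : 0 < δ) :
    ∃ R ∈ rectangles s, x ∈ R ∧ Metric.diam R < δ := by
  refine ⟨_, ⟨cX s x - δ / 8, cX s x + δ / 8, cY s x - δ / 8, cY s x + δ / 8, by linarith,
    by linarith, rfl⟩, ?_, ?_⟩
  · rw [mem_rectangle]; refine ⟨⟨?_, ?_⟩, ?_, ?_⟩ <;> linarith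
  · exact (diam_rectangle_le (by linarith) (by linarith)).trans_lt (by linarith)

lemma eventually_shrinking {s : ℝ} {x : Plane} {p : Set Plane → Prop} :
    (∀ᶠ R in shrinking s x, p R) ↔
      ∃ δ > 0, ∀ R ∈ rectangles s, x ∈ R → Metric.diam R < δ → p R := by
  have hb : (shrinking s x).HasBasis (fun δ : ℝ => 0 < δ)
      (fun δ => Metric.diam ⁻¹' (Metric.ball 0 δ) ∩ {R | R ∈ rectangles s ∧ x ∈ R}) :=
    (Metric.nhds_basis_ball.comap _).inf_principal _
  rw [hb.eventually_iff]
  refine exists_congr fun δ => and_congr_right fun _ => ?_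
  constructor
  · intro h R hR hx hd
    exact h ⟨by simpa [abs_of_nonneg Metric.diam_nonneg] using hd, hR, hx⟩
  · rintro h R ⟨hd, hR, hx⟩
    exact h R hR hx (by simpa [abs_of_nonneg Metric.diam_nonneg] using hd)

lemma frequently_shrinking {s : ℝ} {x : Plane} {p : Set Plane → Prop} :
    (∃ᶠ R in shrinking s x, p R) ↔
      ∀ δ > 0, ∃ R ∈ rectangles s, x ∈ R ∧ Metric.diam R < δ ∧ p R := by
  rw [Filter.Frequently, eventually_shrinking]
  push Not
  rfl

instance (s : ℝ) (x : Plane) : (shrinking s x).NeBot := by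
  refine ⟨fun h => ?_⟩
  have : ∀ᶠ R in shrinking s x, False := by rw [h]; exact eventually_bot
  obtain ⟨δ, hδ, h⟩ := eventually_shrinking.1 this
  obtain ⟨R, h1, h2, h3⟩ := exists_rectangle s x hδ
  exact h R h1 h2 h3

/-- The points lying in a rectangle of slope `s` and diameter less than `r` over which the average
of `f` is larger than `t`. -/
def exceedsSmall (f : Plane → ℝ) (s r t : ℝ) : Set Plane :=
  {x | ∃ R ∈ rectangles s, x ∈ R ∧ Metric.diam R < r ∧ t < ⨍ y in R, f y}

/-- The points lying in a rectangle of slope `s` over which the average of `f` is larger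
than `t`. -/
def exceeds (f : Plane → ℝ) (s t : ℝ) : Set Plane :=
  {x | ∃ R ∈ rectangles s, x ∈ R ∧ t < ⨍ y in R, f y}

lemma isOpen_of_mem_rectangles {s : ℝ} {R : Set Plane} (hR : R ∈ rectangles s) : IsOpen R := by
  obtain ⟨a, b, c, d, -, -, rfl⟩ := hR
  exact isOpen_rectangle s a b c d

lemma isOpen_exceedsSmall (f : Plane → ℝ) (s r t : ℝ) : IsOpen (exceedsSmall f s r t) := by
  rw [isOpen_iff_forall_mem_open]
  rintro x ⟨R, hR, hx, h⟩
  exact ⟨R, fun y hy => ⟨R, hR, hy, h⟩, isOpen_of_mem_rectangles hR, hx⟩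

lemma upperDerivative_eq_top_iff {s : ℝ} {f : Plane → ℝ} {x : Plane} :
    upperDerivative s f x = ⊤ ↔ ∀ N : ℕ, x ∈ exceedsSmall f s (1 / ((N : ℝ) + 1)) N := by
  constructor
  · intro h N
    have h1 : ∃ᶠ R in shrinking s x, ((N : ℝ) : EReal) < ((⨍ y in R, f y : ℝ) : EReal) := by
      refine Filter.frequently_lt_of_lt_limsup (by isBoundedDefault) ?_
      rw [show limsup _ _ = (⊤ : EReal) from h]
      exact EReal.coe_lt_top _
    obtain ⟨R, hR, hx, hd, hN⟩ := frequently_shrinking.1 h1 (1 / ((N : ℝ) + 1)) (by positivity)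
    exact ⟨R, hR, hx, hd, by exact_mod_cast hN⟩
  · intro h
    rw [EReal.eq_top_iff_forall_lt]
    intro y
    obtain ⟨N, hN⟩ := exists_nat_gt y
    refine lt_of_lt_of_le (b := ((N : ℝ) : EReal)) (by exact_mod_cast hN) ?_
    refine Filter.le_limsup_of_frequently_le ?_ (by isBoundedDefault)
    rw [frequently_shrinking]
    intro δ hδ
    obtain ⟨K, hK⟩ := exists_nat_one_div_lt hδ
    obtain ⟨R, hR, hx, hd, hM⟩ := h (max N K)
    refine ⟨R, hR, hx, hd.trans (lt_of_le_of_lt ?_ hK), ?_⟩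
    · apply one_div_le_one_div_of_le (by positivity)
      have : (K : ℝ) ≤ ((max N K : ℕ) : ℝ) := by exact_mod_cast le_max_right N K
      linarith
    · have : (N : ℝ) ≤ ((max N K : ℕ) : ℝ) := by exact_mod_cast le_max_left N K
      exact_mod_cast (this.trans hM.le)

/-! ### Dependence on the slope; every `WR`-set is a `G_{δσ}` set. -/

lemma volume_cX_eq (s a : ℝ) : volume {x : Plane | cX s x = a} = 0 := by
  have := volume_coords (s := s) (measurableSet_singleton a) MeasurableSet.univ
  simpa using this

lemma volume_cY_eq (s a : ℝ) : volume {x : Plane | cY s x = a} = 0 := by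
  have := volume_coords (s := s) MeasurableSet.univ (measurableSet_singleton a)
  simpa using this

/-- Turning a rectangle with its four bounds fixed is an isometry, so the diameter constraint
survives a change of slope. -/
lemma diam_rectangle_eq (s a b c d : ℝ) :
    Metric.diam (rectangle s a b c d) = Metric.diam (rectangle 0 a b c d) := by
  rw [← (rot s).isometry.diam_image (rectangle s a b c d)]
  congr 1
  ext y
  constructor
  · rintro ⟨x, hx, rfl⟩
    rw [mem_rectangle, cX_rot, cY_rot, zero_add]
    exact hx
  · intro hy
    refine ⟨(rot s).symm y, ?_, by simp⟩
    rw [mem_rectangle]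
    have h1 := cX_rot 0 s ((rot s).symm y)
    have h2 := cY_rot 0 s ((rot s).symm y)
    simp only [LinearIsometryEquiv.apply_symm_apply, zero_add] at h1 h2
    rw [← h1, ← h2]
    exact hy

/-- Off the four lines that carry the sides, a null set, the indicator at a given point is locally
constant in the slope; dominated convergence concludes. -/
lemma continuous_integral_rectangle {f : Plane → ℝ} (hf : Integrable f) (a b c d : ℝ) :
    Continuous fun s => ∫ y in rectangle s a b c d, f y := by
  have hind : ∀ s, ∫ y in rectangle s a b c d, f y
      = ∫ y, (rectangle s a b c d).indicator f y := fun s =>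
    (integral_indicator (isOpen_rectangle s a b c d).measurableSet).symm
  simp_rw [hind]
  rw [continuous_iff_continuousAt]
  intro s
  refine continuousAt_of_dominated (bound := fun y => ‖f y‖) ?_ ?_ hf.norm ?_
  · exact Eventually.of_forall fun t =>
      hf.aestronglyMeasurable.indicator (isOpen_rectangle t a b c d).measurableSet
  · exact Eventually.of_forall fun t => Eventually.of_forall fun y =>
      norm_indicator_le_norm_self f y
  · have n1 : ∀ᵐ y : Plane, cX s y ≠ a := ae_iff.2 (by simpa using volume_cX_eq s a)
    have n2 : ∀ᵐ y : Plane, cX s y ≠ b := ae_iff.2 (by simpa using volume_cX_eq s b)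
    have n3 : ∀ᵐ y : Plane, cY s y ≠ c := ae_iff.2 (by simpa using volume_cY_eq s c)
    have n4 : ∀ᵐ y : Plane, cY s y ≠ d := ae_iff.2 (by simpa using volume_cY_eq s d)
    filter_upwards [n1, n2, n3, n4] with y h1 h2 h3 h4
    have cx : Continuous fun t => cX t y := by unfold cX; fun_prop
    have cy : Continuous fun t => cY t y := by unfold cY; fun_prop
    have hne : ∀ {u : ℝ → ℝ} (_ : Continuous u) {e : ℝ} (_ : u s ≠ e),
        ∀ᶠ t in 𝓝 s, (e < u t ↔ e < u s) ∧ (u t < e ↔ u s < e) := by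
      intro u hu e he
      rcases lt_or_gt_of_ne he with h | h
      · filter_upwards [hu.continuousAt.eventually (gt_mem_nhds h)] with t ht
        exact ⟨iff_of_false (not_lt.2 ht.le) (not_lt.2 h.le), iff_of_true ht h⟩
      · filter_upwards [hu.continuousAt.eventually (lt_mem_nhds h)] with t ht
        exact ⟨iff_of_true ht h, iff_of_false (not_lt.2 ht.le) (not_lt.2 h.le)⟩
    have hev : ∀ᶠ t in 𝓝 s, (rectangle t a b c d).indicator f y
        = (rectangle s a b c d).indicator f y := by
      filter_upwards [hne cx h1, hne cx h2, hne cy h3, hne cy h4] with t k1 k2 k3 k4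
      have : y ∈ rectangle t a b c d ↔ y ∈ rectangle s a b c d := by
        rw [mem_rectangle, mem_rectangle, Set.mem_Ioo, Set.mem_Ioo, Set.mem_Ioo, Set.mem_Ioo,
          k1.1, k2.2, k3.1, k4.2]
      by_cases h : y ∈ rectangle s a b c d
      · rw [Set.indicator_of_mem h, Set.indicator_of_mem (this.2 h)]
      · rw [Set.indicator_of_notMem h, Set.indicator_of_notMem (mt this.1 h)]
    exact tendsto_const_nhds.congr' (hev.mono fun _ h => h.symm)

lemma isOpen_exceedsSmall_graph {f : Plane → ℝ} (hf : Integrable f) (r t : ℝ) :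
    IsOpen {p : ℝ × Plane | p.2 ∈ exceedsSmall f p.1 r t} := by
  rw [isOpen_iff_mem_nhds]
  rintro ⟨s, x⟩ ⟨R, ⟨a, b, c, d, hab, hcd, rfl⟩, hx, hd, ht⟩
  have o1 : ∀ᶠ p : ℝ × Plane in 𝓝 (s, x), p.2 ∈ rectangle p.1 a b c d := by
    have : IsOpen {p : ℝ × Plane | p.2 ∈ rectangle p.1 a b c d} :=
      (isOpen_Ioo.preimage continuous_cX').inter (isOpen_Ioo.preimage continuous_cY')
    exact this.mem_nhds hx
  have o2 : ∀ᶠ p : ℝ × Plane in 𝓝 (s, x), t < ⨍ y in rectangle p.1 a b c d, f y := by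
    simp_rw [rectangle_average f _ hab hcd] at ht ⊢
    have : Continuous fun p : ℝ × Plane =>
        ((b - a) * (d - c))⁻¹ * ∫ y in rectangle p.1 a b c d, f y :=
      continuous_const.mul ((continuous_integral_rectangle hf a b c d).comp continuous_fst)
    exact this.continuousAt.eventually (lt_mem_nhds ht)
  filter_upwards [o1, o2] with p h1 h2
  exact ⟨_, ⟨a, b, c, d, hab, hcd, rfl⟩, h1, by rwa [diam_rectangle_eq, ← diam_rectangle_eq s],
    h2⟩

/-- Inner regularity replaces the section by a compact subset of measure above `c`, which by the
tube lemma stays inside the nearby sections. -/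
lemma isOpen_setOf_lt_volume_section {U : Set (ℝ × Plane)} (hU : IsOpen U) (c : ENNReal) :
    IsOpen {s : ℝ | c < volume {x | (s, x) ∈ U}} := by
  rw [isOpen_iff_mem_nhds]
  intro s hs
  have ho : IsOpen {x | (s, x) ∈ U} := hU.preimage (by fun_prop)
  obtain ⟨K, hKs, hK, hcK⟩ := ho.exists_lt_isCompact hs
  have : ∀ᶠ t in 𝓝 s, ∀ x ∈ K, (t, x) ∈ U := by
    refine hK.eventually_forall_of_forall_eventually fun x hx => ?_
    exact hU.mem_nhds (hKs hx)
  filter_upwards [this] with t ht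
  exact hcK.trans_le (measure_mono ht)

/-- Continuity from above, available because `B` has finite measure, turns the inequality into
conditions on each `U n`. A sequence increasing strictly to `c` makes these conditions strict, hence
open. -/
lemma isGδ_setOf_le_volume_iInter {U : ℕ → Set (ℝ × Plane)} (hU : ∀ n, IsOpen (U n))
    (hanti : Antitone U) {B : Set Plane} (hB : IsOpen B) (hB' : volume B ≠ ⊤)
    {c : ENNReal} (hc : 0 < c) :
    IsGδ {s : ℝ | c ≤ volume ({x | ∀ n, (s, x) ∈ U n} ∩ B)} := by
  obtain ⟨u, -, hu, hlim⟩ := exists_seq_strictMono_tendsto' hc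
  have key : {s : ℝ | c ≤ volume ({x | ∀ n, (s, x) ∈ U n} ∩ B)}
      = ⋂ n, ⋂ k, {s : ℝ | u k < volume {x | (s, x) ∈ U n ∩ Prod.snd ⁻¹' B}} := by
    ext s
    simp only [Set.mem_iInter, Set.mem_ofPred_eq]
    have ho : ∀ n, IsOpen {x | (s, x) ∈ U n ∩ Prod.snd ⁻¹' B} := fun n =>
      ((hU n).inter (hB.preimage continuous_snd)).preimage (by fun_prop)
    constructor
    · intro h n k
      refine (hu k).2.trans_le (h.trans (measure_mono ?_))
      exact fun x hx => ⟨hx.1 n, hx.2⟩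
    · intro h
      have hl : Tendsto (fun n => volume {x | (s, x) ∈ U n ∩ Prod.snd ⁻¹' B}) atTop
          (𝓝 (volume (⋂ n, {x | (s, x) ∈ U n ∩ Prod.snd ⁻¹' B}))) := by
        refine tendsto_measure_iInter_atTop (fun n => (ho n).measurableSet.nullMeasurableSet) ?_ ?_
        · exact fun m n hmn x hx => ⟨hanti hmn hx.1, hx.2⟩
        · exact ⟨0, ne_top_of_le_ne_top hB' (measure_mono fun x hx => hx.2)⟩
      have he : (⋂ n, {x | (s, x) ∈ U n ∩ Prod.snd ⁻¹' B})
          = {x | ∀ n, (s, x) ∈ U n} ∩ B := by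
        ext x
        simp only [Set.mem_iInter, Set.mem_ofPred_eq, Set.mem_inter_iff, Set.mem_preimage]
        exact ⟨fun h => ⟨fun n => (h n).1, (h 0).2⟩, fun h n => ⟨h.1 n, h.2⟩⟩
      rw [he] at hl
      exact ge_of_tendsto' hl fun n => le_of_tendsto' hlim fun k => (h n k).le
  rw [key]
  refine .iInter fun n => .iInter fun k => IsOpen.isGδ ?_
  exact isOpen_setOf_lt_volume_section ((hU n).inter (hB.preimage continuous_snd)) _

lemma isGδσ_of_isWRSet {S : Set ℝ} (hS : S ⊆ Set.Ico (0 : ℝ) (Real.pi / 2)) (h : IsWRSet S) :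
    IsGδσ S := by
  obtain ⟨f, hf, hdiff, hpos⟩ := h
  let U : ℕ → Set (ℝ × Plane) := fun n =>
    ⋂ i ∈ Finset.range (n + 1), {p | p.2 ∈ exceedsSmall f p.1 (1 / ((i : ℝ) + 1)) i}
  have hU : ∀ n, IsOpen (U n) := fun n =>
    isOpen_biInter_finset fun i _ => isOpen_exceedsSmall_graph hf _ _
  have hanti : Antitone U := by
    intro m n hmn p hp
    simp only [U, Set.mem_iInter, Finset.mem_range] at hp ⊢
    exact fun i hi => hp i (by omega)
  have htop : ∀ s x, upperDerivative s f x = ⊤ ↔ ∀ n, (s, x) ∈ U n := by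
    intro s x
    rw [upperDerivative_eq_top_iff]
    simp only [U, Set.mem_iInter, Finset.mem_range]
    exact ⟨fun h n i _ => h i, fun h n => h n n (by omega)⟩
  refine ⟨fun k => Set.Ico 0 (Real.pi / 2) ∩ {s | ((k.unpair.1 : ENNReal) + 1)⁻¹
    ≤ volume ({x | ∀ n, (s, x) ∈ U n} ∩ Metric.ball 0 k.unpair.2)}, fun k => ?_, ?_⟩
  · refine IsGδ.inter ?_ (isGδ_setOf_le_volume_iInter hU hanti Metric.isOpen_ball
      measure_ball_lt_top.ne ?_)
    · rw [← Set.Ici_inter_Iio]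
      exact isClosed_Ici.isGδ.inter isOpen_Iio.isGδ
    · exact ENNReal.inv_pos.2 (ENNReal.add_ne_top.2 ⟨ENNReal.natCast_ne_top _, ENNReal.one_ne_top⟩)
  ext s
  simp only [Set.mem_iUnion, Set.mem_inter_iff, Set.mem_ofPred_eq]
  constructor
  · intro hs
    have h0 := hpos s hs
    simp_rw [htop] at h0
    obtain ⟨M, hM⟩ : ∃ M : ℕ, 0 < volume ({x | ∀ n, (s, x) ∈ U n} ∩ Metric.ball 0 M) := by
      by_contra hcon
      push Not at hcon
      have hz : volume (⋃ M : ℕ, {x | ∀ n, (s, x) ∈ U n} ∩ Metric.ball (0 : Plane) M) = 0 :=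
        measure_iUnion_null fun M => le_antisymm (hcon M) zero_le
      rw [← Set.inter_iUnion, Metric.iUnion_ball_nat, Set.inter_univ] at hz
      exact h0.ne' hz
    obtain ⟨m, hm⟩ := ENNReal.exists_inv_nat_lt hM.ne'
    refine ⟨Nat.pair m M, hS hs, ?_⟩
    simp only [Nat.unpair_pair]
    refine le_trans ?_ hm.le
    exact ENNReal.inv_le_inv.2 le_self_add
  · rintro ⟨k, hs, hk⟩
    by_contra hsS
    have hd := hdiff s ⟨hs, hsS⟩
    -- Where the averages converge, the upper derivative is the real number `f x`, not `⊤`.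
    have hz : volume {x : Plane | ∀ n, (s, x) ∈ U n} = 0 := by
      rw [measure_eq_zero_iff_ae_notMem]
      filter_upwards [hd] with x hx hxU
      have h1 := (htop s x).2 hxU
      have h2 : upperDerivative s f x = (f x : EReal) :=
        ((continuous_coe_real_ereal.tendsto _).comp hx).limsup_eq
      rw [h2] at h1
      exact EReal.coe_ne_top _ h1
    have : volume ({x | ∀ n, (s, x) ∈ U n} ∩ Metric.ball (0 : Plane) k.unpair.2) = 0 :=
      measure_mono_null Set.inter_subset_left hz
    rw [this] at hk
    have h3 : (0 : ENNReal) < ((k.unpair.1 : ENNReal) + 1)⁻¹ :=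
      ENNReal.inv_pos.2 (ENNReal.add_ne_top.2 ⟨ENNReal.natCast_ne_top _, ENNReal.one_ne_top⟩)
    exact absurd hk (not_le.2 h3)

/-! ### Differentiation of series of nonnegative functions. -/

lemma volume_ne_zero_of_mem_rectangles {s : ℝ} {R : Set Plane} (hR : R ∈ rectangles s) :
    volume R ≠ 0 := by
  obtain ⟨a, b, c, d, hab, hcd, rfl⟩ := hR
  rw [volume_rectangle _ _ _ hab.le, Ne, ENNReal.ofReal_eq_zero, not_le]
  exact mul_pos (sub_pos.2 hab) (sub_pos.2 hcd)

lemma volume_ne_top_of_mem_rectangles {s : ℝ} {R : Set Plane} (hR : R ∈ rectangles s) :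
    volume R ≠ ⊤ := by
  obtain ⟨a, b, c, d, hab, hcd, rfl⟩ := hR
  rw [volume_rectangle _ _ _ hab.le]
  exact ENNReal.ofReal_ne_top

lemma isBounded_of_mem_rectangles {s : ℝ} {R : Set Plane} (hR : R ∈ rectangles s) :
    Bornology.IsBounded R := by
  obtain ⟨a, b, c, d, hab, hcd, rfl⟩ := hR
  exact isBounded_rectangle _ _ _ _ _

lemma eventually_shrinking_subset {s : ℝ} {x : Plane} {O : Set Plane} (hO : O ∈ 𝓝 x) :
    ∀ᶠ R in shrinking s x, R ∈ rectangles s ∧ x ∈ R ∧ R ⊆ O := by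
  obtain ⟨δ, hδ, h⟩ := Metric.mem_nhds_iff.1 hO
  refine eventually_shrinking.2 ⟨δ, hδ, fun R hR hx hd => ⟨hR, hx, fun y hy => h ?_⟩⟩
  exact (Metric.dist_le_diam_of_mem (isBounded_of_mem_rectangles hR) hy hx).trans_lt hd

/-- Blocks are almost everywhere continuous, so finite sums of them are differentiated in every
direction. -/
lemma tendsto_average_of_continuousAt {s : ℝ} {x : Plane} {g : Plane → ℝ} (hg : Integrable g)
    (hx : ContinuousAt g x) :
    Tendsto (fun R : Set Plane => ⨍ y in R, g y) (shrinking s x) (𝓝 (g x)) := by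
  rw [Metric.nhds_basis_closedBall.tendsto_right_iff]
  intro ε hε
  have h1 := hx (Metric.closedBall_mem_nhds (g x) hε)
  filter_upwards [eventually_shrinking_subset h1] with R ⟨hR, _, hsub⟩
  refine (convex_closedBall (g x) ε).set_average_mem Metric.isClosed_closedBall
    (volume_ne_zero_of_mem_rectangles hR) (volume_ne_top_of_mem_rectangles hR) ?_ hg.integrableOn
  exact (ae_restrict_iff' (isOpen_of_mem_rectangles hR).measurableSet).2
    (Eventually.of_forall fun y hy => hsub hy)

lemma average_nonneg {g : Plane → ℝ} (hg : ∀ x, 0 ≤ g x) (R : Set Plane) :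
    0 ≤ ⨍ y in R, g y := by
  rw [setAverage_eq, smul_eq_mul]
  exact mul_nonneg (inv_nonneg.2 measureReal_nonneg) (integral_nonneg hg)

section Sum

variable {f : ℕ → Plane → ℝ} {e : ℕ → ℝ}

lemma summable_integral_norm (h0 : ∀ n x, 0 ≤ f n x) (hsum : Summable e)
    (hi : ∀ n, ∫ x, f n x ≤ e n) : Summable fun n => ∫ x, ‖f n x‖ := by
  refine Summable.of_nonneg_of_le (fun n => integral_nonneg fun x => norm_nonneg _) (fun n => ?_)
    hsum
  simp_rw [Real.norm_of_nonneg (h0 n _)]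
  exact hi n

lemma ae_summable_of_integral (h0 : ∀ n x, 0 ≤ f n x) (hint : ∀ n, Integrable (f n))
    (hsum : Summable e) (hi : ∀ n, ∫ x, f n x ≤ e n) : ∀ᵐ x, Summable fun n => f n x := by
  have hs := summable_integral_norm h0 hsum hi
  have h1 : ∫⁻ x, ∑' n, ‖f n x‖ₑ ≠ ⊤ := by
    rw [lintegral_tsum fun n => (hint n).aestronglyMeasurable.enorm]
    have : ∀ n, ∫⁻ x, ‖f n x‖ₑ = ENNReal.ofReal (∫ x, ‖f n x‖) := fun n =>
      (ofReal_integral_norm_eq_lintegral_enorm (hint n)).symm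
    simp_rw [this]
    rw [← ENNReal.ofReal_tsum_of_nonneg (fun n => integral_nonneg fun x => norm_nonneg _) hs]
    exact ENNReal.ofReal_ne_top
  have h2 := ae_lt_top' (AEMeasurable.tsum fun n => (hint n).aestronglyMeasurable.enorm) h1
  filter_upwards [h2] with x hx
  have h3 : Summable fun n => ‖f n x‖₊ := by
    rw [← ENNReal.tsum_coe_ne_top_iff_summable]
    exact hx.ne
  exact Summable.of_norm (NNReal.summable_coe.2 h3)

lemma integrable_tsum_of_integral (h0 : ∀ n x, 0 ≤ f n x) (hint : ∀ n, Integrable (f n))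
    (hsum : Summable e) (hi : ∀ n, ∫ x, f n x ≤ e n) :
    Integrable fun x => ∑' n, f n x := by
  have hs := summable_integral_norm h0 hsum hi
  have h1 : ∫⁻ x, ∑' n, ‖f n x‖ₑ ≠ ⊤ := by
    rw [lintegral_tsum fun n => (hint n).aestronglyMeasurable.enorm]
    have : ∀ n, ∫⁻ x, ‖f n x‖ₑ = ENNReal.ofReal (∫ x, ‖f n x‖) := fun n =>
      (ofReal_integral_norm_eq_lintegral_enorm (hint n)).symm
    simp_rw [this]
    rw [← ENNReal.ofReal_tsum_of_nonneg (fun n => integral_nonneg fun x => norm_nonneg _) hs]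
    exact ENNReal.ofReal_ne_top
  have hsm := ae_summable_of_integral h0 hint hsum hi
  refine ⟨?_, ?_⟩
  · refine aestronglyMeasurable_of_tendsto_ae (u := atTop)
      (f := fun n x => ∑ i ∈ Finset.range n, f i x) (fun n => ?_) ?_
    · exact Finset.aestronglyMeasurable_fun_sum _ fun i _ => (hint i).aestronglyMeasurable
    · filter_upwards [hsm] with x hx using hx.hasSum.tendsto_sum_nat
  · refine lt_of_le_of_lt (lintegral_mono fun x => ?_) h1.lt_top
    exact enorm_tsum_le_tsum_enorm

lemma integral_tsum_le (h0 : ∀ n x, 0 ≤ f n x) (hint : ∀ n, Integrable (f n))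
    (hsum : Summable e) (hi : ∀ n, ∫ x, f n x ≤ e n) :
    ∫ x, ∑' n, f n x ≤ ∑' n, e n := by
  have h := hasSum_integral_of_summable_integral_norm hint (summable_integral_norm h0 hsum hi)
  rw [← h.tsum_eq]
  exact h.summable.tsum_le_tsum hi hsum

lemma hasSum_average (h0 : ∀ n x, 0 ≤ f n x) (hint : ∀ n, Integrable (f n))
    (hsum : Summable e) (hi : ∀ n, ∫ x, f n x ≤ e n) (R : Set Plane) :
    HasSum (fun n => ⨍ x in R, f n x) (⨍ x in R, ∑' n, f n x) := by
  simp_rw [setAverage_eq, smul_eq_mul]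
  refine HasSum.mul_left _ ?_
  refine hasSum_integral_of_summable_integral_norm (fun n => (hint n).integrableOn) ?_
  refine Summable.of_nonneg_of_le (fun n => integral_nonneg fun x => norm_nonneg _) (fun n => ?_)
    (summable_integral_norm h0 hsum hi)
  exact setIntegral_le_integral (hint n).norm (Eventually.of_forall fun x => norm_nonneg _)

/-- By Borel–Cantelli almost every point lies in finitely many of the exceptional sets. There, the
averages of a late tail of the series are bounded by the tail of `∑ e n`, over all rectangles
through the point; the remaining finite sum is treated by continuity. -/
lemma differentiates_tsum (h0 : ∀ n x, 0 ≤ f n x) (hint : ∀ n, Integrable (f n))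
    (hcont : ∀ n, ∀ᵐ x, ContinuousAt (f n) x)
    (hsum : Summable e) (hi : ∀ n, ∫ x, f n x ≤ e n) {s : ℝ} {N : ℕ}
    (hs : ∀ n, N ≤ n → volume (exceeds (f n) s (e n)) ≤ ENNReal.ofReal (e n)) :
    Differentiates s fun x => ∑' n, f n x := by
  have he0 : ∀ n, 0 ≤ e n := fun n => (integral_nonneg (h0 n)).trans (hi n)
  have hbc : ∀ᵐ x, ∀ᶠ n in atTop, x ∉ exceeds (f (n + N)) s (e (n + N)) := by
    refine ae_eventually_notMem ?_
    refine ne_top_of_le_ne_top ?_ (ENNReal.tsum_le_tsum fun n => hs (n + N) (by omega))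
    rw [← ENNReal.ofReal_tsum_of_nonneg (fun n => he0 _) ((summable_nat_add_iff N).2 hsum)]
    exact ENNReal.ofReal_ne_top
  filter_upwards [hbc, ae_all_iff.2 hcont, ae_summable_of_integral h0 hint hsum hi] with x h1 h2 h3
  obtain ⟨n0, hn0⟩ := eventually_atTop.1 h1
  rw [Metric.tendsto_nhds]
  intro ε hε
  have t1 : ∀ᶠ m in atTop, ∑' n, e (n + m) < ε / 3 :=
    (tendsto_sum_nat_add e).eventually (gt_mem_nhds (by positivity))
  have t2 : ∀ᶠ m in atTop, ∑' n, f (n + m) x < ε / 3 :=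
    (tendsto_sum_nat_add fun n => f n x).eventually (gt_mem_nhds (by positivity))
  obtain ⟨m, hm1, hm2, hm3⟩ := (t1.and (t2.and (eventually_ge_atTop (n0 + N)))).exists
  have t3 : Tendsto (fun R : Set Plane => ∑ n ∈ Finset.range m, ⨍ y in R, f n y) (shrinking s x)
      (𝓝 (∑ n ∈ Finset.range m, f n x)) :=
    tendsto_finsetSum _ fun n _ => tendsto_average_of_continuousAt (hint n) (h2 n)
  filter_upwards [Metric.tendsto_nhds.1 t3 (ε / 3) (by positivity),
    eventually_shrinking_subset (s := s) (x := x) univ_mem] with R hR1 ⟨hR2, hR3, _⟩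
  have ha := hasSum_average h0 hint hsum hi R
  have e1 := ha.summable.sum_add_tsum_nat_add m
  have e2 := h3.sum_add_tsum_nat_add m
  rw [ha.tsum_eq] at e1
  have hle : ∑' n, ⨍ y in R, f (n + m) y ≤ ∑' n, e (n + m) := by
    refine ((summable_nat_add_iff m).2 ha.summable).tsum_le_tsum (fun n => ?_)
      ((summable_nat_add_iff m).2 hsum)
    by_contra hlt
    refine hn0 (n + m - N) (by omega) ?_
    rw [show n + m - N + N = n + m by omega]
    exact ⟨R, hR2, hR3, not_le.1 hlt⟩
  have p1 : 0 ≤ ∑' n, ⨍ y in R, f (n + m) y := tsum_nonneg fun n => average_nonneg (h0 _) R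
  have p2 : 0 ≤ ∑' n, f (n + m) x := tsum_nonneg fun n => h0 _ x
  rw [Real.dist_eq, abs_lt] at hR1 ⊢
  rw [← e1, ← e2]
  constructor <;> linarith [hR1.1, hR1.2]

/-- Since all terms are nonnegative, a large mean of one term is a large mean of the sum. The sets
`E K` decrease, lie in a ball and have measure at least 1/2, so their intersection has too. -/
lemma volume_upperDerivative_tsum_pos (h0 : ∀ n x, 0 ≤ f n x) (hint : ∀ n, Integrable (f n))
    (hsum : Summable e) (hi : ∀ n, ∫ x, f n x ≤ e n) {s : ℝ} {v : Plane} {r : ℝ}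
    (hs : ∀ K : ℕ, ∃ n, ∃ Λ : ℝ, (K : ℝ) ≤ Λ ∧ e n ≤ 1 / ((K : ℝ) + 1) ∧
      1 / 2 ≤ volume (exceedsSmall (f n) s (e n) Λ ∩ Metric.ball v r)) :
    0 < volume ({x | upperDerivative s (fun x => ∑' n, f n x) x = ⊤} ∩ Metric.ball v r) := by
  set F : Plane → ℝ := fun x => ∑' n, f n x with hF
  let E : ℕ → Set Plane := fun K => exceedsSmall F s (1 / ((K : ℝ) + 1)) K ∩ Metric.ball v r
  have hE : ∀ K, 1 / 2 ≤ volume (E K) := by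
    intro K
    obtain ⟨n, Λ, h1, h2, h3⟩ := hs K
    refine h3.trans (measure_mono (Set.inter_subset_inter_left _ ?_))
    rintro x ⟨R, hR, hx, hd, ht⟩
    refine ⟨R, hR, hx, hd.trans_le h2, lt_of_le_of_lt h1 (ht.trans_le ?_)⟩
    have ha := hasSum_average h0 hint hsum hi R
    rw [hF, ← ha.tsum_eq]
    exact ha.summable.le_tsum n fun j _ => average_nonneg (h0 j) R
  have hanti : Antitone E := by
    rintro m n hmn x ⟨⟨R, hR, hx, hd, ht⟩, hb⟩
    have hc : (m : ℝ) ≤ n := by exact_mod_cast hmn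
    refine ⟨⟨R, hR, hx, hd.trans_le ?_, hc.trans_lt ht⟩, hb⟩
    exact one_div_le_one_div_of_le (by positivity) (by linarith)
  have heq : {x | upperDerivative s F x = ⊤} ∩ Metric.ball v r = ⋂ K, E K := by
    rw [← Set.iInter_inter]
    congr 1
    ext x
    rw [Set.mem_iInter]
    exact upperDerivative_eq_top_iff
  rw [heq]
  have hl := tendsto_measure_iInter_atTop (μ := volume) (s := E)
    (fun n => ((isOpen_exceedsSmall _ _ _ _).inter
      Metric.isOpen_ball).measurableSet.nullMeasurableSet) hanti
    ⟨0, ne_top_of_le_ne_top measure_ball_lt_top.ne (measure_mono Set.inter_subset_right)⟩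
  exact lt_of_lt_of_le (by simp) (ge_of_tendsto' hl hE)

end Sum

/-! ### Digit sets with collapsing projections. -/

/-- The sums of arithmetic progressions with `c` terms, of steps `b⁻¹, …, b⁻ⁿ` in the abscissa and
of slopes `σ, σ + α, …, σ + (n - 1) α`. -/
def slatPoints (b c : ℕ) (α : ℝ) : ℕ → ℝ → Finset (ℝ × ℝ)
  | 0, _ => {(0, 0)}
  | n + 1, σ => (Finset.range c ×ˢ slatPoints b c α n (σ + α)).image
      fun q => (((q.1 : ℝ) + q.2.1) / b, (σ * q.1 + q.2.2) / b)

section Slat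

variable {b c : ℕ} {α : ℝ}

lemma mem_slatPoints_succ {n : ℕ} {σ : ℝ} {z : ℝ × ℝ} :
    z ∈ slatPoints b c α (n + 1) σ ↔ ∃ d : ℕ, d < c ∧ ∃ u ∈ slatPoints b c α n (σ + α),
      z = (((d : ℝ) + u.1) / b, (σ * d + u.2) / b) := by
  simp only [slatPoints, Finset.mem_image, Finset.mem_product, Finset.mem_range, Prod.exists]
  constructor
  · rintro ⟨d, t, y, ⟨hd, hu⟩, rfl⟩
    exact ⟨d, hd, t, y, hu, rfl⟩
  · rintro ⟨d, hd, t, y, hu, rfl⟩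
    exact ⟨d, t, y, ⟨hd, hu⟩, rfl⟩

lemma slatPoints_fst (hb : 0 < b) (hcb : c ≤ b) {n : ℕ} {σ : ℝ} {z : ℝ × ℝ}
    (hz : z ∈ slatPoints b c α n σ) :
    0 ≤ z.1 ∧ z.1 + (c / b : ℝ) / b ^ n ≤ c / b := by
  have hb' : (0 : ℝ) < b := by exact_mod_cast hb
  have hβ : (c / b : ℝ) ≤ 1 := by rw [div_le_one hb']; exact_mod_cast hcb
  induction n generalizing σ z with
  | zero =>
    simp only [slatPoints, Finset.mem_singleton] at hz
    subst hz; simp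
  | succ n ih =>
    obtain ⟨d, hd, u, hu, rfl⟩ := mem_slatPoints_succ.1 hz
    obtain ⟨h1, h2⟩ := ih hu
    have hd' : (d : ℝ) + 1 ≤ c := by exact_mod_cast hd
    refine ⟨by positivity, ?_⟩
    have : ((d : ℝ) + u.1) / b + (c / b : ℝ) / b ^ (n + 1)
        = (d + (u.1 + (c / b : ℝ) / b ^ n)) / b := by
      rw [pow_succ, ← div_div]; ring
    simp only [this]
    exact div_le_div_of_nonneg_right (by linarith) hb'.le

lemma slatPoints_fst_lt (hb : 0 < b) (hc : 0 < c) (hcb : c ≤ b) {n : ℕ} {σ : ℝ} {z : ℝ × ℝ}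
    (hz : z ∈ slatPoints b c α n σ) : z.1 < 1 := by
  have hb' : (0 : ℝ) < b := by exact_mod_cast hb
  have hc' : (0 : ℝ) < c := by exact_mod_cast hc
  have hβ : (c / b : ℝ) ≤ 1 := by rw [div_le_one hb']; exact_mod_cast hcb
  have := (slatPoints_fst hb hcb hz).2
  have h2 : 0 < (c / b : ℝ) / b ^ n := by positivity
  linarith

/-- Seen along the slope just below its first one, the whole set fits in an interval of length `α`.
The induction adds up to `α (c + 1) / b`, which is why one digit must be left unused. -/
lemma slatPoints_snd (hb : 0 < b) (hc : 0 < c) (hcb : c + 1 ≤ b) (hα : 0 ≤ α) {n : ℕ} {σ : ℝ}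
    {z : ℝ × ℝ} (hz : z ∈ slatPoints b c α n σ) :
    0 ≤ z.2 - (σ - α) * z.1 ∧ z.2 - (σ - α) * z.1 ≤ α := by
  have hb' : (0 : ℝ) < b := by exact_mod_cast hb
  have hcb' : (c : ℝ) + 1 ≤ b := by exact_mod_cast hcb
  induction n generalizing σ z with
  | zero =>
    simp only [slatPoints, Finset.mem_singleton] at hz
    subst hz; simp [hα]
  | succ n ih =>
    obtain ⟨d, hd, u, hu, rfl⟩ := mem_slatPoints_succ.1 hz
    obtain ⟨h1, h2⟩ := ih hu
    rw [add_sub_cancel_right] at h1 h2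
    have h3 := (slatPoints_fst hb (by omega) hu).1
    have h4 := (slatPoints_fst_lt hb hc (by omega) hu).le
    have hd' : (d : ℝ) + 1 ≤ c := by exact_mod_cast hd
    have : (σ * d + u.2) / b - (σ - α) * ((d + u.1) / b)
        = (α * d + (u.2 - σ * u.1) + α * u.1) / b := by ring
    simp only [this]
    refine ⟨by positivity, ?_⟩
    rw [div_le_iff₀ hb']
    nlinarith

lemma slatPoints_sep (hb : 0 < b) (hcb : c + 1 ≤ b) {n : ℕ} {σ : ℝ}
    {z z' : ℝ × ℝ} (hz : z ∈ slatPoints b c α n σ) (hz' : z' ∈ slatPoints b c α n σ)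
    (hne : z ≠ z') : 1 / (b : ℝ) ^ n ≤ |z.1 - z'.1| := by
  have hb' : (0 : ℝ) < b := by exact_mod_cast hb
  have hβ : (c / b : ℝ) ≤ 1 := by
    rw [div_le_one hb']; exact_mod_cast (Nat.le_of_succ_le hcb)
  induction n generalizing σ z z' with
  | zero =>
    simp only [slatPoints, Finset.mem_singleton] at hz hz'
    exact absurd (hz.trans hz'.symm) hne
  | succ n ih =>
    obtain ⟨d, hd, u, hu, rfl⟩ := mem_slatPoints_succ.1 hz
    obtain ⟨d', hd', u', hu', rfl⟩ := mem_slatPoints_succ.1 hz'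
    have hdiff : ((d : ℝ) + u.1) / b - ((d' : ℝ) + u'.1) / b = (((d : ℝ) - d') + (u.1 - u'.1)) / b := by
      ring
    simp only [hdiff, abs_div, abs_of_pos hb', pow_succ, ← div_div]
    refine div_le_div_of_nonneg_right ?_ hb'.le
    by_cases hdd : d = d'
    · subst hdd
      rw [sub_self, zero_add]
      refine ih hu hu' fun h => hne ?_
      rw [h]
    · have h1 : (1 : ℝ) ≤ |(d : ℝ) - d'| := by
        have : (1 : ℤ) ≤ |(d : ℤ) - d'| := Int.one_le_abs (by omega)
        exact_mod_cast this
      obtain ⟨a1, a2⟩ := slatPoints_fst hb (by omega) hu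
      obtain ⟨a3, a4⟩ := slatPoints_fst hb (by omega) hu'
      have h2 : |u.1 - u'.1| ≤ (c / b : ℝ) - (c / b : ℝ) / b ^ n :=
        abs_le.2 ⟨by linarith, by linarith⟩
      have h3 := abs_sub_abs_le_abs_sub ((d : ℝ) - d') (-(u.1 - u'.1))
      rw [abs_neg, sub_neg_eq_add] at h3
      have h4 : (1 : ℝ) / b ^ n ≤ 1 := by
        rw [div_le_one (by positivity)]
        exact one_le_pow₀ (by exact_mod_cast hb)
      have h5 : (c / b : ℝ) / b ^ n = (c / b : ℝ) * (1 / b ^ n) := by ring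
      nlinarith

/-- At the first stage where two points differ, the unused digits keep the rescaled abscissas at
least `1 - c / b` apart, while the rescaled chord deviates from the slope `σ` by at most `α`; by
`hA` this adds at most `A` to the slope `σ ≤ A`. -/
lemma slatPoints_lip (hb : 0 < b) (hc : 0 < c) (hcb : c + 1 ≤ b) (hα : 0 ≤ α) {A : ℝ}
    (hA : α ≤ A * (1 - c / b)) {n : ℕ} {σ : ℝ} (hσ : 0 ≤ σ) (hσA : σ + n * α ≤ A + α)
    {z z' : ℝ × ℝ} (hz : z ∈ slatPoints b c α n σ) (hz' : z' ∈ slatPoints b c α n σ) :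
    |z.2 - z'.2| ≤ 2 * A * |z.1 - z'.1| := by
  have hb' : (0 : ℝ) < b := by exact_mod_cast hb
  have hcb' : (c : ℝ) + 1 ≤ b := by exact_mod_cast hcb
  have hβ : (c / b : ℝ) < 1 := by
    rw [div_lt_one hb']; linarith
  have hA0 : 0 ≤ A := by
    by_contra h
    nlinarith
  induction n generalizing σ z z' with
  | zero =>
    simp only [slatPoints, Finset.mem_singleton] at hz hz'
    subst hz hz'; simp
  | succ n ih =>
    obtain ⟨d, hd, u, hu, rfl⟩ := mem_slatPoints_succ.1 hz
    obtain ⟨d', hd', u', hu', rfl⟩ := mem_slatPoints_succ.1 hz'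
    push_cast at hσA
    have hσ' : σ ≤ A := by nlinarith [show (0 : ℝ) ≤ n * α by positivity]
    by_cases hdd : d = d'
    · subst hdd
      have := ih (by positivity) (by linarith) hu hu'
      have e1 : ((d : ℝ) + u.1) / b - ((d : ℝ) + u'.1) / b = (u.1 - u'.1) / b := by ring
      have e2 : (σ * d + u.2) / b - (σ * d + u'.2) / b = (u.2 - u'.2) / b := by ring
      simp only [e1, e2, abs_div, abs_of_pos hb']
      rw [← mul_div_assoc]
      exact div_le_div_of_nonneg_right this hb'.le
    · have h1 : (1 : ℝ) ≤ |(d : ℝ) - d'| := by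
        have : (1 : ℤ) ≤ |(d : ℤ) - d'| := Int.one_le_abs (by omega)
        exact_mod_cast this
      obtain ⟨a1, a2⟩ := slatPoints_fst hb (by omega) hu
      obtain ⟨a3, a4⟩ := slatPoints_fst hb (by omega) hu'
      have a5 : (0 : ℝ) ≤ (c / b : ℝ) / b ^ n := by positivity
      have h2 : |u.1 - u'.1| ≤ (c / b : ℝ) := abs_le.2 ⟨by linarith, by linarith⟩
      have h3 := abs_sub_abs_le_abs_sub ((d : ℝ) - d') (-(u.1 - u'.1))
      rw [abs_neg, sub_neg_eq_add] at h3
      obtain ⟨b1, b2⟩ := slatPoints_snd hb hc hcb hα hu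
      obtain ⟨b3, b4⟩ := slatPoints_snd hb hc hcb hα hu'
      rw [add_sub_cancel_right] at b1 b2 b3 b4
      have h4 : |(u.2 - σ * u.1) - (u'.2 - σ * u'.1)| ≤ α :=
        abs_le.2 ⟨by linarith, by linarith⟩
      have e1 : ((d : ℝ) + u.1) / b - ((d' : ℝ) + u'.1) / b
          = (((d : ℝ) - d') + (u.1 - u'.1)) / b := by ring
      have e2 : (σ * d + u.2) / b - (σ * d' + u'.2) / b
          = (σ * (((d : ℝ) - d') + (u.1 - u'.1))
            + ((u.2 - σ * u.1) - (u'.2 - σ * u'.1))) / b := by ring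
      simp only [e1, e2, abs_div, abs_of_pos hb']
      rw [← mul_div_assoc]
      refine div_le_div_of_nonneg_right ?_ hb'.le
      refine (abs_add_le _ _).trans ?_
      rw [abs_mul, abs_of_nonneg hσ]
      set D := |((d : ℝ) - d') + (u.1 - u'.1)|
      have h5 : 1 - (c / b : ℝ) ≤ D := by linarith
      have h6 : A * (1 - c / b) ≤ A * D := mul_le_mul_of_nonneg_left h5 hA0
      have h7 : σ * D ≤ A * D := mul_le_mul_of_nonneg_right hσ' (abs_nonneg _)
      linarith

lemma slatPoints_card (hb : 0 < b) (hc : 0 < c) (hcb : c ≤ b) (n : ℕ) (σ : ℝ) :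
    (slatPoints b c α n σ).card = c ^ n := by
  have hb' : (0 : ℝ) < b := by exact_mod_cast hb
  induction n generalizing σ with
  | zero => simp [slatPoints]
  | succ n ih =>
    rw [slatPoints, Finset.card_image_of_injOn, Finset.card_product, Finset.card_range, ih,
      pow_succ, mul_comm]
    rintro ⟨d, u⟩ h1 ⟨d', u'⟩ h2 heq
    simp only [Finset.coe_product, Set.mem_prod, Finset.mem_coe] at h1 h2
    simp only [Prod.mk.injEq] at heq
    obtain ⟨e1, e2⟩ := heq
    rw [div_left_inj' hb'.ne'] at e1 e2
    obtain ⟨a1, -⟩ := slatPoints_fst hb hcb h1.2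
    obtain ⟨a3, -⟩ := slatPoints_fst hb hcb h2.2
    have a2 := slatPoints_fst_lt hb hc hcb h1.2
    have a4 := slatPoints_fst_lt hb hc hcb h2.2
    have hd : d = d' := by
      have v1 : (d : ℝ) < d' + 1 := by linarith
      have v2 : (d' : ℝ) < d + 1 := by linarith
      have v1' : d < d' + 1 := by exact_mod_cast v1
      have v2' : d' < d + 1 := by exact_mod_cast v2
      omega
    subst hd
    simp only [Prod.mk.injEq, true_and]
    exact Prod.ext (by linarith) (by linarith)

/-- The first stage whose slope is at least `m` lies within `α` of `m`, and from there on everything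
projects into an interval of length `2 α`. Each earlier stage makes `c` copies contracted by `b ≥
c`, which does not increase the total length. The lower bound on `l` leaves room for thickening the
points to boxes. -/
lemma slatPoints_proj (hb : 0 < b) (hc : 0 < c) (hcb : c + 1 ≤ b) (hα : 0 ≤ α) {n : ℕ} {σ m : ℝ}
    (hm1 : σ - α ≤ m) (hm2 : m ≤ σ + n * α) :
    ∃ (Z : Finset ℝ) (l : ℝ), 2 * α / b ^ n ≤ l ∧ Z.card * l ≤ 2 * α ∧
      ∀ z ∈ slatPoints b c α (n + 1) σ, ∃ ζ ∈ Z, ζ ≤ z.2 - m * z.1 ∧ z.2 - m * z.1 ≤ ζ + l := by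
  have hb' : (0 : ℝ) < b := by exact_mod_cast hb
  have hb1 : (1 : ℝ) ≤ b := by exact_mod_cast hb
  induction n generalizing σ with
  | zero =>
    refine ⟨{-α}, 2 * α, by simp, by simp, fun z hz => ⟨-α, by simp, ?_⟩⟩
    obtain ⟨h1, h2⟩ := slatPoints_snd hb hc hcb hα hz
    have h3 := (slatPoints_fst hb (by omega) hz).1
    have h4 := (slatPoints_fst_lt hb hc (by omega) hz).le
    simp only [Nat.cast_zero, zero_mul, add_zero] at hm2
    constructor <;> nlinarith
  | succ n ih =>
    -- The collapsing stage is reached: `slatPoints_snd` and `σ - α ≤ m ≤ σ` confine the projection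
    -- to `[-α, α]`.
    by_cases hmσ : m ≤ σ
    · refine ⟨{-α}, 2 * α, ?_, by simp, fun z hz => ⟨-α, by simp, ?_⟩⟩
      · exact div_le_self (by positivity) (one_le_pow₀ hb1)
      obtain ⟨h1, h2⟩ := slatPoints_snd hb hc hcb hα hz
      have h3 := (slatPoints_fst hb (by omega) hz).1
      have h4 := (slatPoints_fst_lt hb hc (by omega) hz).le
      constructor <;> nlinarith
    · push_cast at hm2
      obtain ⟨Z, l, hl, hZ, hcov⟩ := ih (σ := σ + α) (by linarith) (by linarith)
      have hl0 : 0 ≤ l := le_trans (by positivity) hl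
      refine ⟨(Finset.range c ×ˢ Z).image fun q => ((σ - m) * q.1 + q.2) / b, l / b, ?_, ?_, ?_⟩
      · rw [pow_succ, ← div_div]
        exact div_le_div_of_nonneg_right hl hb'.le
      · have h1 : ((((Finset.range c ×ˢ Z).image fun q => ((σ - m) * q.1 + q.2) / b).card : ℕ) : ℝ)
            ≤ c * Z.card := by
          have := Finset.card_image_le (s := Finset.range c ×ˢ Z)
            (f := fun q => ((σ - m) * q.1 + q.2) / b)
          rw [Finset.card_product, Finset.card_range] at this
          exact_mod_cast this
        have hcb' : (c : ℝ) ≤ b := by exact_mod_cast (Nat.le_of_succ_le hcb)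
        calc _ ≤ (c * Z.card : ℝ) * (l / b) := mul_le_mul_of_nonneg_right h1 (by positivity)
          _ = (c / b : ℝ) * (Z.card * l) := by ring
          _ ≤ 1 * (2 * α) := by
              refine mul_le_mul ?_ hZ (by positivity) zero_le_one
              rw [div_le_one hb']; exact hcb'
          _ = 2 * α := one_mul _
      · intro z hz
        obtain ⟨d, hd, u, hu, rfl⟩ := mem_slatPoints_succ.1 hz
        obtain ⟨ζ, hζ, h1, h2⟩ := hcov u hu
        refine ⟨((σ - m) * d + ζ) / b, Finset.mem_image.2 ⟨(d, ζ), by simp [hd, hζ], rfl⟩, ?_⟩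
        have e : (σ * d + u.2) / b - m * ((d + u.1) / b)
            = ((σ - m) * d + (u.2 - m * u.1)) / b := by ring
        simp only [e]
        constructor
        · exact div_le_div_of_nonneg_right (by linarith) hb'.le
        · rw [← add_div]
          exact div_le_div_of_nonneg_right (by linarith) hb'.le

end Slat

/-! ### The directional set: thickening the digit set. -/

/-- The union of the boxes of dimensions `w × τ` with lower left corners in `P`. -/
def boxes (P : Finset (ℝ × ℝ)) (w τ : ℝ) : Set Plane :=
  ⋃ z ∈ P, rectangle 0 z.1 (z.1 + w) z.2 (z.2 + τ)

lemma mem_box {z : ℝ × ℝ} {w τ : ℝ} {x : Plane} :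
    x ∈ rectangle 0 z.1 (z.1 + w) z.2 (z.2 + τ) ↔
      x 0 ∈ Set.Ioo z.1 (z.1 + w) ∧ x 1 ∈ Set.Ioo z.2 (z.2 + τ) := by
  simp [rectangle]

lemma isOpen_boxes (P : Finset (ℝ × ℝ)) (w τ : ℝ) : IsOpen (boxes P w τ) :=
  isOpen_biUnion fun _ _ => isOpen_rectangle _ _ _ _ _

lemma volume_frontier_boxes (P : Finset (ℝ × ℝ)) (w τ : ℝ) :
    volume (frontier (boxes P w τ)) = 0 := by
  classical
  unfold boxes
  induction P using Finset.induction_on with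
  | empty => simp
  | insert z P _ ih =>
    rw [Finset.set_biUnion_insert]
    refine measure_mono_null (frontier_union_subset _ _) (measure_union_null ?_ ?_)
    · exact measure_mono_null Set.inter_subset_left (volume_frontier_rectangle _ _ _ _ _)
    · exact measure_mono_null Set.inter_subset_right ih

lemma volume_boxes {P : Finset (ℝ × ℝ)} {w τ : ℝ} (hw : 0 ≤ w)
    (hsep : ∀ z ∈ P, ∀ z' ∈ P, z ≠ z' → 2 * w ≤ |z.1 - z'.1|) :
    volume (boxes P w τ) = P.card * ENNReal.ofReal (w * τ) := by
  unfold boxes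
  rw [measure_biUnion_finset]
  · rw [Finset.sum_congr rfl fun z _ => volume_rectangle 0 z.2 (z.2 + τ)
      (show z.1 ≤ z.1 + w by linarith)]
    simp
  · intro z hz z' hz' hne
    rw [Function.onFun, Set.disjoint_left]
    intro x hx hx'
    obtain ⟨⟨h1, h2⟩, -⟩ := mem_box.1 hx
    obtain ⟨⟨h3, h4⟩, -⟩ := mem_box.1 hx'
    have := hsep z hz z' hz' hne
    have h5 : |z.1 - z'.1| < w := abs_lt.2 ⟨by linarith, by linarith⟩
    linarith
  · exact fun _ _ => (isOpen_rectangle _ _ _ _ _).measurableSet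

lemma volume_box_inter (z : ℝ × ℝ) (w τ : ℝ) {S : Set (ℝ × ℝ)} (hS : MeasurableSet S) :
    volume (rectangle 0 z.1 (z.1 + w) z.2 (z.2 + τ) ∩ {x | (x 0, x 1) ∈ S})
      = ∫⁻ y in Set.Ioo 0 τ, volume (Set.Ioo z.1 (z.1 + w) ∩ {t | (t, z.2 + y) ∈ S}) := by
  have h1 : rectangle 0 z.1 (z.1 + w) z.2 (z.2 + τ) ∩ {x | (x 0, x 1) ∈ S}
      = (fun x : Plane => (x 0, x 1)) ⁻¹'
        ((Set.Ioo z.1 (z.1 + w) ×ˢ Set.Ioo z.2 (z.2 + τ)) ∩ S) := by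
    ext x
    rw [Set.mem_inter_iff, mem_box]
    rfl
  have hm : MeasurableSet ((Set.Ioo z.1 (z.1 + w) ×ˢ Set.Ioo z.2 (z.2 + τ)) ∩ S) :=
    (measurableSet_Ioo.prod measurableSet_Ioo).inter hS
  rw [h1, measurePreserving_coord.measure_preimage hm.nullMeasurableSet, Measure.volume_eq_prod,
    Measure.prod_apply_symm hm, ← lintegral_add_left_eq_self _ z.2,
    ← lintegral_indicator measurableSet_Ioo]
  refine lintegral_congr fun y => ?_
  by_cases hy : y ∈ Set.Ioo 0 τ
  · rw [Set.indicator_of_mem hy]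
    congr 1
    ext t
    simp only [Set.mem_preimage, Set.mem_inter_iff, Set.mem_prod, Set.mem_ofPred_eq]
    have : z.2 + y ∈ Set.Ioo z.2 (z.2 + τ) := ⟨by linarith [hy.1], by linarith [hy.2]⟩
    tauto
  · rw [Set.indicator_of_notMem hy]
    convert measure_empty (μ := (volume : Measure ℝ))
    ext t
    simp only [Set.mem_preimage, Set.mem_inter_iff, Set.mem_prod, Set.mem_empty_iff_false,
      iff_false]
    rintro ⟨⟨-, h1, h2⟩, -⟩
    exact hy ⟨by simpa using h1, by simpa using h2⟩

/-- At a fixed height inside the boxes, the union behaves like the graph of a `4 A`-Lipschitz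
function of the abscissa. A strip whose direction has sine at least `12 A` crosses such a graph over
a set of diameter at most `(d - c) / (8 A)`; integrate over the height. -/
lemma volume_boxes_inter_strip_le {P : Finset (ℝ × ℝ)} {w τ A : ℝ}
    (hA : 0 < A) (hsep : ∀ z ∈ P, ∀ z' ∈ P, z ≠ z' → 2 * w ≤ |z.1 - z'.1|)
    (hlip : ∀ z ∈ P, ∀ z' ∈ P, |z.2 - z'.2| ≤ 2 * A * |z.1 - z'.1|) {s : ℝ}
    (hs : 12 * A ≤ |Real.sin s|) (c d : ℝ) :
    volume (boxes P w τ ∩ {x | cY s x ∈ Set.Ioo c d})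
      ≤ ENNReal.ofReal ((d - c) / (8 * A)) * ENNReal.ofReal τ := by
  let S : Set (ℝ × ℝ) := {p | -(p.1 * Real.sin s) + p.2 * Real.cos s ∈ Set.Ioo c d}
  have hSo : IsOpen S := isOpen_Ioo.preimage (by fun_prop)
  have hSm := hSo.measurableSet
  have hslice : ∀ (z : ℝ × ℝ) y, MeasurableSet (Set.Ioo z.1 (z.1 + w) ∩ {t | (t, z.2 + y) ∈ S}) :=
    fun z y => measurableSet_Ioo.inter (hSo.preimage (by fun_prop)).measurableSet
  have hslice2 : ∀ z : ℝ × ℝ, Measurable fun y =>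
      volume (Set.Ioo z.1 (z.1 + w) ∩ {t | (t, z.2 + y) ∈ S}) := by
    intro z
    have : MeasurableSet {p : ℝ × ℝ | p.2 ∈ Set.Ioo z.1 (z.1 + w) ∧ (p.2, z.2 + p.1) ∈ S} :=
      (measurableSet_Ioo.preimage measurable_snd).inter
        (hSo.preimage (by fun_prop)).measurableSet
    exact measurable_measure_prodMk_left this
  have key : ∀ y, ∑ z ∈ P, volume (Set.Ioo z.1 (z.1 + w) ∩ {t | (t, z.2 + y) ∈ S})
      ≤ ENNReal.ofReal ((d - c) / (8 * A)) := by
    intro y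
    rw [← measure_biUnion_finset _ fun z _ => hslice z y]
    · refine (Real.volume_le_diam _).trans (Metric.ediam_le fun t ht t' ht' => ?_)
      simp only [Set.mem_iUnion] at ht ht'
      obtain ⟨z, hz, ⟨h1, h2⟩, h3, h4⟩ := ht
      obtain ⟨z', hz', ⟨k1, k2⟩, k3, k4⟩ := ht'
      rw [edist_dist, Real.dist_eq]
      refine ENNReal.ofReal_le_ofReal ?_
      rw [le_div_iff₀ (by positivity)]
      -- Separation by `2 w` makes the distance between the corners at most twice the distance
      -- between points of the boxes, so the constant `2 A` doubles.
      have e1 : |z.2 - z'.2| ≤ 4 * A * |t - t'| := by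
        by_cases hzz : z = z'
        · subst hzz; rw [sub_self, abs_zero]; positivity
        · have a1 := hsep z hz z' hz' hzz
          have a2 := hlip z hz z' hz'
          have a3 : |z.1 - z'.1| ≤ |t - t'| + w := by
            have b1 := abs_sub_abs_le_abs_sub (z.1 - z'.1) (t - t')
            have b2 : |(z.1 - z'.1) - (t - t')| ≤ w := abs_le.2 ⟨by linarith, by linarith⟩
            linarith
          nlinarith
      simp only at h3 h4 k3 k4
      have e2 : |(t - t') * Real.sin s - (z.2 - z'.2) * Real.cos s| ≤ d - c :=
        abs_le.2 ⟨by linarith, by linarith⟩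
      have e3 := abs_sub_abs_le_abs_sub ((t - t') * Real.sin s) ((z.2 - z'.2) * Real.cos s)
      rw [abs_mul, abs_mul] at e3
      have e4 : |z.2 - z'.2| * |Real.cos s| ≤ |z.2 - z'.2| :=
        mul_le_of_le_one_right (abs_nonneg _) (Real.abs_cos_le_one s)
      nlinarith [abs_nonneg (t - t')]
    · intro z hz z' hz' hne
      rw [Function.onFun, Set.disjoint_left]
      rintro t ⟨⟨h1, h2⟩, -⟩ ⟨⟨h3, h4⟩, -⟩
      have := hsep z hz z' hz' hne
      have h5 : |z.1 - z'.1| < w := abs_lt.2 ⟨by linarith, by linarith⟩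
      linarith
  have hset : boxes P w τ ∩ {x | cY s x ∈ Set.Ioo c d}
      = ⋃ z ∈ P, rectangle 0 z.1 (z.1 + w) z.2 (z.2 + τ) ∩ {x : Plane | (x 0, x 1) ∈ S} := by
    unfold boxes
    rw [Set.iUnion₂_inter]
    rfl
  rw [hset]
  calc _ ≤ ∑ z ∈ P, volume (rectangle 0 z.1 (z.1 + w) z.2 (z.2 + τ)
          ∩ {x : Plane | (x 0, x 1) ∈ S}) := measure_biUnion_finset_le _ _
    _ = ∫⁻ y in Set.Ioo 0 τ, ∑ z ∈ P,
          volume (Set.Ioo z.1 (z.1 + w) ∩ {t | (t, z.2 + y) ∈ S}) := by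
        rw [lintegral_finsetSum _ fun z _ => hslice2 z]
        exact Finset.sum_congr rfl fun z _ => volume_box_inter z w τ hSm
    _ ≤ ∫⁻ _ in Set.Ioo 0 τ, ENNReal.ofReal ((d - c) / (8 * A)) := lintegral_mono fun y => key y
    _ = _ := by simp

set_option maxHeartbeats 800000 in
/-- For directions near the abscissa the set `E` has small projections, while the projections of its
normalized area in directions far from the axes have bounded densities. -/
lemma exists_directional_set {A η : ℝ} (hA : 0 < A) (hA1 : A ≤ 1) (hη : 0 < η) :
    ∃ E : Set Plane, IsOpen E ∧ volume (frontier E) = 0 ∧ volume E ≠ 0 ∧ (∀ x ∈ E, ‖x‖ ≤ 3) ∧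
      (∀ s, 12 * A ≤ |Real.sin s| → ∀ c d, volume (E ∩ {x | cY s x ∈ Set.Ioo c d})
        ≤ ENNReal.ofReal ((d - c) / A) * volume E) ∧
      ∀ s, 0 < Real.cos s → 0 ≤ Real.sin s → Real.sin s ≤ A * Real.cos s →
        ∃ (Z : Finset ℝ) (l : ℝ), 0 < l ∧ Z.card * l ≤ η ∧
          ∀ x ∈ E, ∃ ζ ∈ Z, cY s x ∈ Set.Icc ζ (ζ + l) := by
  -- The covering found below has total length at most `4 α = 4 A / M`, and `M > k > 4 / η`. Taking
  -- `M` even lets Bernoulli's inequality at exponent `M / 2` give `(1 - 1 / M) ^ M ≥ 1 / 4`.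
  obtain ⟨k, hk⟩ := exists_nat_gt (4 / η)
  obtain ⟨M, hM⟩ : ∃ M, M = 2 * (k + 1) := ⟨_, rfl⟩
  obtain ⟨p, hp⟩ : ∃ p, M = p + 1 := ⟨M - 1, by omega⟩
  have hMk : (M : ℝ) = 2 * ((k : ℝ) + 1) := by rw [hM]; push_cast; ring
  have hk0 : (0 : ℝ) ≤ k := Nat.cast_nonneg k
  have hM2 : (2 : ℝ) ≤ M := by linarith
  have hMp : (M : ℝ) = p + 1 := by rw [hp]; push_cast; ring
  have hM0 : (0 : ℝ) < M := by linarith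
  -- Here `c / b = 1 - 1 / M`: with `α = A / M` the hypothesis of `slatPoints_lip` is an equality,
  -- and `M` stages keep at least a quarter of the mass.
  set b : ℕ := M * M with hb
  set c : ℕ := M * p with hc
  have hbpos : 0 < b := by rw [hb, hp]; positivity
  have hp0 : 0 < p := by omega
  have hcpos : 0 < c := by rw [hc, hp]; positivity
  have hcb : c + 1 ≤ b := by rw [hc, hb, hp]; nlinarith
  have hbR : (b : ℝ) = M * M := by rw [hb]; push_cast; ring
  have hcR : (c : ℝ) = M * (M - 1) := by rw [hc, hMp]; push_cast [hp]; ring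
  have hβ : (c : ℝ) / b = 1 - 1 / M := by rw [hbR, hcR]; field_simp
  set α : ℝ := A / M with hα
  have hα0 : 0 < α := by positivity
  have hαM : α * M = A := by rw [hα]; field_simp
  have hbM : (1 : ℝ) ≤ (b : ℝ) ^ M := one_le_pow₀ (by exact_mod_cast hbpos)
  have hbM0 : (0 : ℝ) < (b : ℝ) ^ M := by linarith
  set P := slatPoints b c α M α with hP
  set w : ℝ := 1 / (b : ℝ) ^ M / 2 with hw
  set τ : ℝ := α / (b : ℝ) ^ M with hτ
  have hw0 : 0 < w := by positivity
  have hτ0 : 0 < τ := by positivity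
  have hsep : ∀ z ∈ P, ∀ z' ∈ P, z ≠ z' → 2 * w ≤ |z.1 - z'.1| := by
    intro z hz z' hz' hne
    have := slatPoints_sep hbpos hcb hz hz' hne
    rw [hw]; linarith
  have hlip : ∀ z ∈ P, ∀ z' ∈ P, |z.2 - z'.2| ≤ 2 * A * |z.1 - z'.1| := by
    intro z hz z' hz'
    refine slatPoints_lip hbpos hcpos hcb hα0.le ?_ hα0.le ?_ hz hz'
    · rw [hβ, hα]; apply le_of_eq; ring
    · rw [mul_comm (M : ℝ), hαM]; linarith
  have hvol : volume (boxes P w τ) = ENNReal.ofReal ((c : ℝ) ^ M * (w * τ)) := by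
    rw [volume_boxes hw0.le hsep, slatPoints_card hbpos hcpos (by omega),
      ENNReal.ofReal_mul (p := (c : ℝ) ^ M) (by positivity), ← Nat.cast_pow, ENNReal.ofReal_natCast]
  have hlow : τ / 8 ≤ (c : ℝ) ^ M * (w * τ) := by
    have h1 : (c : ℝ) ^ M * (w * τ) = (c / b : ℝ) ^ M / 2 * τ := by
      rw [hw, div_pow]; ring
    have h2 : (1 / 4 : ℝ) ≤ (c / b : ℝ) ^ M := by
      have h3 := one_add_mul_le_pow (a := -(1 / (M : ℝ))) (by
        have : 1 / (M : ℝ) ≤ 1 := by rw [div_le_one hM0]; linarith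
        linarith) (k + 1)
      have h4 : 1 + ((k + 1 : ℕ) : ℝ) * -(1 / (M : ℝ)) = 1 / 2 := by
        rw [hMk]; push_cast; field_simp; ring
      rw [h4, ← sub_eq_add_neg] at h3
      have h5 : ∀ x : ℝ, x ^ M = (x ^ (k + 1)) ^ 2 := fun x => by
        rw [← pow_mul, hM, mul_comm]
      rw [hβ, h5]
      nlinarith
    rw [h1]; nlinarith
  have hα1 : α ≤ 1 / 2 := by nlinarith
  refine ⟨boxes P w τ, isOpen_boxes _ _ _, volume_frontier_boxes _ _ _, ?_, ?_, ?_, ?_⟩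
  · rw [hvol, Ne, ENNReal.ofReal_eq_zero, not_le]
    linarith
  · intro x hx
    simp only [boxes, Set.mem_iUnion] at hx
    obtain ⟨z, hz, hx⟩ := hx
    obtain ⟨⟨h1, h2⟩, h3, h4⟩ := mem_box.1 hx
    have h5 := (slatPoints_fst hbpos (by omega) hz).1
    have h6 := slatPoints_fst_lt hbpos hcpos (by omega) hz
    have h7 := slatPoints_snd hbpos hcpos hcb hα0.le hz
    rw [sub_self, zero_mul, sub_zero] at h7
    have h8 : w ≤ 1 / 2 := by
      rw [hw]
      exact div_le_div_of_nonneg_right ((div_le_one hbM0).2 hbM) (by norm_num)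
    have h9 : τ ≤ α := div_le_self hα0.le hbM
    have := norm_le_abs_add 0 x
    simp only [cX, cY, Real.cos_zero, Real.sin_zero, mul_one, mul_zero, add_zero, neg_zero,
      zero_add] at this
    rw [abs_of_pos (by linarith), abs_of_pos (by linarith)] at this
    linarith
  · intro s hs c' d'
    refine (volume_boxes_inter_strip_le hA hsep hlip hs c' d').trans ?_
    by_cases hcd : c' ≤ d'
    swap
    · rw [ENNReal.ofReal_of_nonpos (div_nonpos_of_nonpos_of_nonneg (by linarith) (by positivity)),
        zero_mul]
      exact zero_le
    rw [hvol, ← ENNReal.ofReal_mul (div_nonneg (by linarith) (by positivity)),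
      ← ENNReal.ofReal_mul (div_nonneg (by linarith) (by positivity))]
    refine ENNReal.ofReal_le_ofReal ?_
    calc (d' - c') / (8 * A) * τ = (d' - c') / A * (τ / 8) := by field_simp
      _ ≤ _ := mul_le_mul_of_nonneg_left hlow (div_nonneg (by linarith) hA.le)
  · intro s hcos hsin hle
    set m := Real.sin s / Real.cos s with hm
    have hm0 : 0 ≤ m := by positivity
    have hmA : m ≤ A := by rw [hm, div_le_iff₀ hcos]; exact hle
    have hms : Real.sin s = m * Real.cos s := by rw [hm]; field_simp
    obtain ⟨Z, l, hl, hZ, hcov⟩ := slatPoints_proj (n := p) (σ := α) (m := m) hbpos hcpos hcb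
      hα0.le (by linarith) (by rw [hMp] at hαM; linarith)
    rw [← hp] at hcov
    have hbp : (b : ℝ) ^ M = b ^ p * b := by rw [← pow_succ, ← hp]
    have hbp0 : (0 : ℝ) < (b : ℝ) ^ p := by positivity
    have hl' : 2 * α * b / b ^ M ≤ l := by
      refine le_trans (le_of_eq ?_) hl
      rw [hbp]; field_simp
    have hl0 : 0 < l := lt_of_lt_of_le (by positivity) hl
    -- A box projects to length at most `A w + τ` before the factor `cos s`, so intervals of length
    -- `2 l` cover the thickened set.
    have hbound : A * w + τ ≤ l := by
      refine le_trans ?_ hl'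
      have : A * w + τ = α * (M / 2 + 1) / (b : ℝ) ^ M := by
        rw [hw, hτ, ← hαM]; ring
      rw [this]
      refine div_le_div_of_nonneg_right ?_ hbM0.le
      rw [mul_comm 2 α, mul_assoc]
      refine mul_le_mul_of_nonneg_left ?_ hα0.le
      rw [hbR]; nlinarith
    refine ⟨Z.image fun ζ => Real.cos s * (ζ - A * w), 2 * l, by positivity, ?_, ?_⟩
    · have h1 : (((Z.image fun ζ => Real.cos s * (ζ - A * w)).card : ℕ) : ℝ) ≤ Z.card := by
        exact_mod_cast Finset.card_image_le
      have h2 : 4 * α ≤ η := by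
        have h3 : 4 < k * η := by rwa [div_lt_iff₀ hη] at hk
        have h4 : (k : ℝ) * η ≤ M * η := mul_le_mul_of_nonneg_right (by linarith) hη.le
        rw [hα, ← mul_div_assoc, div_le_iff₀ hM0]
        linarith
      have h5 := mul_le_mul_of_nonneg_right h1 (show 0 ≤ 2 * l by positivity)
      linarith
    · intro x hx
      simp only [boxes, Set.mem_iUnion] at hx
      obtain ⟨z, hz, hx⟩ := hx
      obtain ⟨⟨h1, h2⟩, h3, h4⟩ := mem_box.1 hx
      obtain ⟨ζ, hζ, h5, h6⟩ := hcov z hz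
      refine ⟨_, Finset.mem_image_of_mem _ hζ, ?_⟩
      have e : cY s x = Real.cos s * (x 1 - m * x 0) := by rw [cY, hms]; ring
      have g1 : m * (x 0 - z.1) ≤ A * w := mul_le_mul hmA (by linarith) (by linarith) hA.le
      have g2 : 0 ≤ m * (x 0 - z.1) := mul_nonneg hm0 (by linarith)
      have g0 : m * x 0 = m * z.1 + m * (x 0 - z.1) := by ring
      rw [e]
      constructor
      · exact mul_le_mul_of_nonneg_left (by linarith) hcos.le
      · have g3 : x 1 - m * x 0 ≤ (ζ - A * w) + 2 * l := by linarith
        have g4 := mul_le_mul_of_nonneg_left g3 hcos.le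
        have g5 : Real.cos s * (2 * l) ≤ 2 * l :=
          mul_le_of_le_one_left (by positivity) (Real.cos_le_one s)
        rw [mul_add] at g4
        linarith

/-! ### Lower bounds for the maximal function of a concentrated measure on the line. -/

/-- The superlevel set of the maximal function of a measure on the line. -/
def heavySet (ν : Measure ℝ) (h : ℝ) : Set ℝ :=
  {y | ∃ c d, c < y ∧ y < d ∧ ENNReal.ofReal (h * (d - c)) < ν (Set.Ioo c d)}

lemma isOpen_heavySet (ν : Measure ℝ) (h : ℝ) : IsOpen (heavySet ν h) := by
  rw [isOpen_iff_mem_nhds]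
  rintro y ⟨c, d, hc, hd, hν⟩
  filter_upwards [Ioo_mem_nhds hc hd] with z hz
  exact ⟨c, d, hz.1, hz.2, hν⟩

/-- A covering interval with a point outside the heavy set has mass at most `2 h l`, as its double
is not heavy; all of these together carry at most half of the mass. -/
lemma half_le_measure_heavySet {ν : Measure ℝ} [IsProbabilityMeasure ν] {Z : Finset ℝ} {l h : ℝ}
    (hl : 0 < l) (hh : 0 < h) (hcov : ν (⋃ ζ ∈ Z, Set.Icc ζ (ζ + l))ᶜ = 0)
    (hZ : h * (Z.card * l) ≤ 1 / 4) : 1 / 2 ≤ ν (heavySet ν h) := by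
  classical
  have h1 : ν (heavySet ν h)ᶜ ≤ ENNReal.ofReal (1 / 2) := by
    have hsub : (heavySet ν h)ᶜ ⊆ (⋃ ζ ∈ Z, Set.Icc ζ (ζ + l))ᶜ ∪
        ⋃ ζ ∈ Z.filter (fun ζ => ∃ y ∈ Set.Icc ζ (ζ + l), y ∉ heavySet ν h),
          Set.Icc ζ (ζ + l) := by
      intro y hy
      by_cases hyZ : y ∈ ⋃ ζ ∈ Z, Set.Icc ζ (ζ + l)
      · right
        simp only [Set.mem_iUnion] at hyZ ⊢
        obtain ⟨ζ, hζ, hyζ⟩ := hyZ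
        exact ⟨ζ, Finset.mem_filter.2 ⟨hζ, y, hyζ, hy⟩, hyζ⟩
      · exact Or.inl hyZ
    refine (measure_mono hsub).trans ((measure_union_le _ _).trans ?_)
    rw [hcov, zero_add]
    refine (measure_biUnion_finset_le _ _).trans ?_
    refine (Finset.sum_le_card_nsmul _ _ (ENNReal.ofReal (2 * h * l)) fun ζ hζ => ?_).trans ?_
    · obtain ⟨-, y, hy, hyn⟩ := Finset.mem_filter.1 hζ
      by_contra hlt
      refine hyn ⟨ζ - l / 2, ζ + 3 * l / 2, by linarith [hy.1], by linarith [hy.2], ?_⟩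
      rw [show h * (ζ + 3 * l / 2 - (ζ - l / 2)) = 2 * h * l by ring]
      refine (not_le.1 hlt).trans_le (measure_mono fun t ht => ?_)
      exact ⟨by linarith [ht.1], by linarith [ht.2]⟩
    · rw [nsmul_eq_mul, ← ENNReal.ofReal_natCast, ← ENNReal.ofReal_mul (Nat.cast_nonneg _)]
      refine ENNReal.ofReal_le_ofReal ?_
      have h2 : ((Finset.card (Z.filter fun ζ => ∃ y ∈ Set.Icc ζ (ζ + l), y ∉ heavySet ν h) : ℕ)
          : ℝ) ≤ Z.card := by exact_mod_cast Finset.card_filter_le _ _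
      have h3 := mul_le_mul_of_nonneg_right h2 (show 0 ≤ 2 * h * l by positivity)
      linarith
  have h2 := (isOpen_heavySet ν h).measurableSet
  have h3 := prob_add_prob_compl (μ := ν) h2
  have h4 : ENNReal.ofReal (1 / 2) = 2⁻¹ := by
    rw [ENNReal.ofReal_div_of_pos (by norm_num)]; simp
  rw [h4] at h1
  have h5 : (2⁻¹ : ENNReal) + 2⁻¹ ≤ ν (heavySet ν h) + 2⁻¹ := by
    rw [ENNReal.inv_two_add_inv_two, ← h3]
    gcongr
  rw [one_div]
  exact (ENNReal.add_le_add_iff_right (by simp)).1 h5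

/-- A reverse weak-type inequality. Around each point take a heavy interval of nearly maximal
radius, so that its fivefold enlargement is no longer heavy. A disjoint Vitali subfamily lies inside
the heavy set, and its enlargements cover that set. -/
lemma measure_heavySet_le (ν : Measure ℝ) [IsProbabilityMeasure ν] {h : ℝ} (hh : 0 < h) :
    ν (heavySet ν h) ≤ ENNReal.ofReal (5 * h) * volume (heavySet ν h) := by
  let Q : ℝ → Set ℝ := fun y => {r | 0 < r ∧ ∃ x, y ∈ Metric.ball x r ∧
    ENNReal.ofReal (h * (2 * r)) < ν (Metric.ball x r)}
  have hQne : ∀ y ∈ heavySet ν h, (Q y).Nonempty := by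
    rintro y ⟨c, d, hc, hd, hν⟩
    refine ⟨(d - c) / 2, by linarith, (c + d) / 2, ?_, ?_⟩
    · rw [Real.ball_eq_Ioo]; constructor <;> linarith
    · rw [Real.ball_eq_Ioo, show (c + d) / 2 - (d - c) / 2 = c by ring,
        show (c + d) / 2 + (d - c) / 2 = d by ring, show 2 * ((d - c) / 2) = d - c by ring]
      exact hν
  have hQb : ∀ y, ∀ r ∈ Q y, r ≤ 1 / (2 * h) := by
    rintro y r ⟨hr, x, -, hx⟩
    have h1 : ENNReal.ofReal (h * (2 * r)) < 1 := hx.trans_le prob_le_one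
    rw [ENNReal.ofReal_lt_one] at h1
    rw [le_div_iff₀ (by positivity)]; linarith
  have hch : ∀ y : heavySet ν h, ∃ r x, r ∈ Q y ∧ (y : ℝ) ∈ Metric.ball x r ∧
      ENNReal.ofReal (h * (2 * r)) < ν (Metric.ball x r) ∧ 5 * r ∉ Q y := by
    intro y
    obtain ⟨r0, hr0⟩ := hQne y y.2
    have hpos : 0 < sSup (Q y) := hr0.1.trans_le (le_csSup ⟨_, hQb y⟩ hr0)
    obtain ⟨r, hr, hlt⟩ := exists_lt_of_lt_csSup ⟨r0, hr0⟩ (show sSup (Q y) / 2 < sSup (Q y) by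
      linarith)
    obtain ⟨hr1, x, hx1, hx2⟩ := hr
    refine ⟨r, x, ⟨hr1, x, hx1, hx2⟩, hx1, hx2, fun h5 => ?_⟩
    have := le_csSup ⟨_, hQb y⟩ h5
    linarith
  choose r x hrQ hyx hν h5 using hch
  have hr0 : ∀ y, 0 < r y := fun y => (hrQ y).1
  obtain ⟨u, -, hdisj, hcov⟩ := Vitali.exists_disjoint_subfamily_covering_enlargement_closedBall
    Set.univ x r (1 / (2 * h)) (fun y _ => hQb y _ (hrQ y)) 4 (by norm_num)
  have hu : u.Countable := by
    refine hdisj.countable_of_nonempty_interior fun y _ => ?_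
    exact ⟨x y, Metric.ball_subset_interior_closedBall (Metric.mem_ball_self (hr0 y))⟩
  have hbig : ∀ y : heavySet ν h, ν (Metric.ball (x y) (5 * r y)) ≤
      ENNReal.ofReal (5 * h) * volume (Metric.ball (x y) (r y)) := by
    intro y
    rw [Real.volume_ball, ← ENNReal.ofReal_mul (by positivity),
      show 5 * h * (2 * r y) = h * (2 * (5 * r y)) by ring]
    by_contra hlt
    have h0 := hr0 y
    exact h5 y ⟨by positivity, x y, Metric.ball_subset_ball (by linarith) (hyx y), not_le.1 hlt⟩
  calc ν (heavySet ν h) ≤ ν (⋃ y ∈ u, Metric.ball (x y) (5 * r y)) := by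
        refine measure_mono fun y hy => ?_
        obtain ⟨b, hb, hsub⟩ := hcov ⟨y, hy⟩ (Set.mem_univ _)
        simp only [Set.mem_iUnion]
        refine ⟨b, hb, ?_⟩
        have h1 := hsub (Metric.ball_subset_closedBall (hyx ⟨y, hy⟩))
        exact Metric.closedBall_subset_ball (by linarith [hr0 b]) h1
    _ ≤ ∑' y : u, ν (Metric.ball (x y) (5 * r y)) := measure_biUnion_le _ hu _
    _ ≤ ∑' y : u, ENNReal.ofReal (5 * h) * volume (Metric.ball (x y) (r y)) :=
        ENNReal.tsum_le_tsum fun y => hbig y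
    _ = ENNReal.ofReal (5 * h) * volume (⋃ y ∈ u, Metric.ball (x y) (r y)) := by
        rw [ENNReal.tsum_mul_left, measure_biUnion hu]
        · exact fun a ha b hb hab => (hdisj ha hb hab).mono Metric.ball_subset_closedBall
            Metric.ball_subset_closedBall
        · exact fun _ _ => Metric.isOpen_ball.measurableSet
    _ ≤ _ := by
        gcongr
        refine Set.iUnion₂_subset fun y _ z hz => ?_
        refine ⟨x y - r y, x y + r y, ?_, ?_, ?_⟩
        · rw [Real.ball_eq_Ioo] at hz; exact hz.1
        · rw [Real.ball_eq_Ioo] at hz; exact hz.2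
        · rw [← Real.ball_eq_Ioo, show x y + r y - (x y - r y) = 2 * r y by ring]
          exact hν y

lemma le_volume_heavySet {ν : Measure ℝ} [IsProbabilityMeasure ν] {Z : Finset ℝ} {l h : ℝ}
    (hl : 0 < l) (hh : 0 < h) (hcov : ν (⋃ ζ ∈ Z, Set.Icc ζ (ζ + l))ᶜ = 0)
    (hZ : h * (Z.card * l) ≤ 1 / 4) :
    ENNReal.ofReal (1 / (10 * h)) ≤ volume (heavySet ν h) := by
  have h1 := (half_le_measure_heavySet hl hh hcov hZ).trans (measure_heavySet_le ν hh)
  rw [show (1 / (10 * h)) = (1 / 2) / (5 * h) by field_simp; norm_num,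
    ENNReal.ofReal_div_of_pos (by positivity), ENNReal.ofReal_div_of_pos (by norm_num)]
  refine ENNReal.div_le_of_le_mul' ?_
  simpa using h1

/-! ### Area swept by rectangles with large mean. -/

/-- The points lying in a rectangle of slope `s`, with sides at most `U`, in which the normalized
area of `E` has mean larger than `Λ`. -/
def hitSet (E : Set Plane) (Λ U s : ℝ) : Set Plane :=
  {x | ∃ a b c d, a < b ∧ c < d ∧ b - a ≤ U ∧ d - c ≤ U ∧ x ∈ rectangle s a b c d ∧
    ENNReal.ofReal (Λ * ((b - a) * (d - c))) * volume E < volume (E ∩ rectangle s a b c d)}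

lemma isOpen_hitSet_graph {E : Set Plane} (hE : IsOpen E) (Λ U : ℝ) :
    IsOpen {p : ℝ × Plane | p.2 ∈ hitSet E Λ U p.1} := by
  rw [isOpen_iff_mem_nhds]
  rintro ⟨s, x⟩ ⟨a, b, c, d, hab, hcd, hb, hd, hx, hv⟩
  have ho : IsOpen {p : ℝ × Plane | p.2 ∈ rectangle p.1 a b c d} :=
    (isOpen_Ioo.preimage continuous_cX').inter (isOpen_Ioo.preimage continuous_cY')
  have h2 := isOpen_setOf_lt_volume_section ((hE.preimage continuous_snd).inter ho)
    (ENNReal.ofReal (Λ * ((b - a) * (d - c))) * volume E)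
  filter_upwards [ho.mem_nhds hx, (h2.preimage continuous_fst).mem_nhds
    (show (s, x) ∈ _ from hv)] with p hp1 hp2
  exact ⟨a, b, c, d, hab, hcd, hb, hd, hp1, hp2⟩

lemma norm_le_of_mem_hitSet {E : Set Plane} {r Λ U s : ℝ} (hE : ∀ x ∈ E, ‖x‖ ≤ r) {x : Plane}
    (hx : x ∈ hitSet E Λ U s) : ‖x‖ ≤ r + 2 * U := by
  obtain ⟨a, b, c, d, hab, hcd, hb, hd, hx, hv⟩ := hx
  obtain ⟨y, hyE, hyR⟩ := nonempty_of_measure_ne_zero (ne_bot_of_gt hv)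
  have h1 := dist_le_of_mem_rectangle hx hyR
  have h2 := hE y hyE
  rw [dist_eq_norm] at h1
  have h3 := norm_add_le (x - y) y
  rw [sub_add_cancel] at h3
  linarith

/-- At distance about `u` from `E`, a rectangle of length about `u` containing a strip of `E` has
mean above `Λ` as soon as the projected density of the strip exceeds `3 Λ u`. By
`le_volume_heavySet` the transverse measure of such positions is at least `1 / (30 Λ u)`, so each
dyadic `u` contributes area `1 / (30 Λ)` and `L` scales add up. -/
lemma le_volume_hitSet {E : Set Plane} (hE0 : volume E ≠ 0)
    (hE : ∀ x ∈ E, ‖x‖ ≤ 3) {Λ : ℝ} (hΛ : 1 ≤ Λ) (L : ℕ) {s : ℝ} {Z : Finset ℝ} {l : ℝ} (hl : 0 < l)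
    (hZ : 12 * Λ * 2 ^ L * (Z.card * l) ≤ 1 / 4)
    (hcov : ∀ x ∈ E, ∃ ζ ∈ Z, cY s x ∈ Set.Icc ζ (ζ + l)) :
    ENNReal.ofReal (L * (1 / (30 * Λ))) ≤ volume (hitSet E Λ (12 * 2 ^ L) s) := by
  have hEtop : volume E ≠ ⊤ := ne_top_of_le_ne_top
    (measure_closedBall_lt_top (x := (0 : Plane)) (r := 3)).ne
    (measure_mono fun x hx => by simpa using hE x hx)
  have hYm : Measurable (cY s) := (continuous_cY s).measurable
  let ν : Measure ℝ := (volume E)⁻¹ • (volume.restrict E).map (cY s)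
  have hνapp : ∀ S, MeasurableSet S → ν S = (volume E)⁻¹ * volume (E ∩ {x | cY s x ∈ S}) := by
    intro S hS
    rw [Measure.smul_apply, Measure.map_apply hYm hS, Measure.restrict_apply (hYm hS), smul_eq_mul,
      Set.inter_comm]
    rfl
  have : IsProbabilityMeasure ν := ⟨by
    rw [hνapp _ MeasurableSet.univ]
    simp [ENNReal.inv_mul_cancel hE0 hEtop]⟩
  have hcov' : ν (⋃ ζ ∈ Z, Set.Icc ζ (ζ + l))ᶜ = 0 := by
    rw [hνapp _ (Finset.measurableSet_biUnion _ fun _ _ => measurableSet_Icc).compl]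
    convert mul_zero _
    convert measure_empty (μ := (volume : Measure Plane))
    ext x
    simp only [Set.mem_inter_iff, Set.mem_empty_iff_false, iff_false]
    rintro ⟨hx, hx2⟩
    obtain ⟨ζ, hζ, hxζ⟩ := hcov x hx
    exact hx2 (Set.mem_biUnion hζ hxζ)
  let u : ℕ → ℝ := fun j => 4 * 2 ^ j
  have hu : ∀ j, 4 ≤ u j := fun j => by
    have : (1 : ℝ) ≤ 2 ^ j := one_le_pow₀ (by norm_num)
    change 4 ≤ 4 * (2 : ℝ) ^ j
    linarith
  have huL : ∀ j, j < L → u j ≤ 4 * 2 ^ L := fun j hj => by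
    have : (2 : ℝ) ^ j ≤ 2 ^ L := pow_le_pow_right₀ (by norm_num) hj.le
    change 4 * (2 : ℝ) ^ j ≤ _
    linarith
  let T : ℕ → Set Plane := fun j =>
    {x | cX s x ∈ Set.Ioo (u j) (2 * u j) ∧ cY s x ∈ heavySet ν (3 * Λ * u j)}
  have hTvol : ∀ j < L, ENNReal.ofReal (1 / (30 * Λ)) ≤ volume (T j) := by
    intro j hj
    have hu0 : 0 < u j := by linarith [hu j]
    have h1 := le_volume_heavySet (ν := ν) (h := 3 * Λ * u j) hl (by positivity) hcov' (by
      refine le_trans ?_ hZ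
      refine mul_le_mul_of_nonneg_right ?_ (by positivity)
      have := mul_le_mul_of_nonneg_left (huL j hj) (show 0 ≤ 3 * Λ by positivity)
      linarith)
    rw [show volume (T j) = _ from
      volume_coords measurableSet_Ioo (isOpen_heavySet ν _).measurableSet, Real.volume_Ioo]
    refine le_trans ?_ (mul_le_mul_right h1 _)
    rw [← ENNReal.ofReal_mul (by linarith)]
    refine ENNReal.ofReal_le_ofReal (le_of_eq ?_)
    field_simp; ring
  have hTdisj : Set.PairwiseDisjoint ((Finset.range L : Finset ℕ) : Set ℕ) T := by
    have key : ∀ i j, i < j → Disjoint (T i) (T j) := by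
      intro i j hij
      rw [Set.disjoint_left]
      rintro x ⟨⟨-, h1⟩, -⟩ ⟨⟨h2, -⟩, -⟩
      have h3 : (2 : ℝ) ^ (i + 1) ≤ 2 ^ j := pow_le_pow_right₀ (by norm_num) hij
      rw [pow_succ] at h3
      change cX s x < 2 * (4 * 2 ^ i) at h1
      change 4 * 2 ^ j < cX s x at h2
      linarith
    intro i _ j _ hij
    rcases lt_or_gt_of_ne hij with h | h
    · exact key i j h
    · exact (key j i h).symm
  have hTm : ∀ j ∈ Finset.range L, MeasurableSet (T j) := fun j _ =>
    ((isOpen_Ioo.preimage (continuous_cX s)).inter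
      ((isOpen_heavySet ν _).preimage (continuous_cY s))).measurableSet
  have hsub : (⋃ j ∈ Finset.range L, T j) ⊆ hitSet E Λ (12 * 2 ^ L) s := by
    refine Set.iUnion₂_subset fun j hj => ?_
    rw [Finset.mem_range] at hj
    rintro x ⟨⟨hx1, hx2⟩, c, d, hc, hd, hν⟩
    have huj := hu j
    have hujL := huL j hj
    have hlt1 : ENNReal.ofReal (3 * Λ * u j * (d - c)) < 1 := hν.trans_le prob_le_one
    rw [ENNReal.ofReal_lt_one] at hlt1
    -- Since `E` lies in the disc of radius 3, this rectangle contains the whole strip of `E`; its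
    -- length `2 u + 4` is at most `3 u` because `u ≥ 4`.
    refine ⟨-4, 2 * u j, c, d, by linarith, by linarith, by linarith, ?_, ?_, ?_⟩
    · have h1 : 1 * (d - c) ≤ 3 * Λ * u j * (d - c) :=
        mul_le_mul_of_nonneg_right (by nlinarith) (by linarith)
      linarith
    · exact ⟨⟨by change -4 < cX s x; linarith, hx2⟩, hc, hd⟩
    · rw [hνapp _ measurableSet_Ioo, mul_comm (volume E)⁻¹, ← div_eq_mul_inv,
        ENNReal.lt_div_iff_mul_lt (Or.inl hE0) (Or.inl hEtop)] at hν
      have hEq : E ∩ rectangle s (-4) (2 * u j) c d = E ∩ {x | cY s x ∈ Set.Ioo c d} := by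
        ext y
        refine and_congr_right fun hy => ?_
        rw [mem_rectangle]
        have h1 := (abs_cX_le s y).trans (hE y hy)
        rw [abs_le] at h1
        exact and_iff_right ⟨by linarith [h1.1], by linarith [h1.2]⟩
      rw [hEq]
      refine lt_of_le_of_lt (mul_le_mul_left (ENNReal.ofReal_le_ofReal ?_) _) hν
      have h1 : Λ * (2 * u j + 4) ≤ Λ * (3 * u j) :=
        mul_le_mul_of_nonneg_left (by linarith) (by linarith)
      have h2 := mul_le_mul_of_nonneg_right h1 (show 0 ≤ d - c by linarith)
      linarith
  calc ENNReal.ofReal (L * (1 / (30 * Λ)))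
      = ∑ j ∈ Finset.range L, ENNReal.ofReal (1 / (30 * Λ)) := by
        rw [Finset.sum_const, Finset.card_range, nsmul_eq_mul, ENNReal.ofReal_mul (Nat.cast_nonneg _),
          ENNReal.ofReal_natCast]
    _ ≤ ∑ j ∈ Finset.range L, volume (T j) :=
        Finset.sum_le_sum fun j hj => hTvol j (Finset.mem_range.1 hj)
    _ = volume (⋃ j ∈ Finset.range L, T j) := (measure_biUnion_finset hTdisj hTm).symm
    _ ≤ _ := measure_mono hsub

/-! ### Sparse sums of translates are harmless in the far directions. -/

/-- The part, in the rectangle or set `R`, of the normalized area of the translate of `E`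
by `p`. -/
def share (E : Set Plane) (p : Plane) (R : Set Plane) : ℝ :=
  volume.real (R ∩ {x | x - p ∈ E}) / volume.real E

/-- The sum of the normalized indicator functions of the translates of `E` by the `p i`. -/
def placed {ι : Type*} [Fintype ι] (E : Set Plane) (p : ι → Plane) (x : Plane) : ℝ :=
  ∑ i, {x | x - p i ∈ E}.indicator (fun _ => (volume.real E)⁻¹) x

section Placed

variable {ι : Type*} [Fintype ι] {E : Set Plane} {p : ι → Plane}

lemma volume_translate (E : Set Plane) (q : Plane) : volume {x | x - q ∈ E} = volume E := by
  have := measure_preimage_add_right (volume : Measure Plane) (-q) E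
  simp only [← sub_eq_add_neg] at this
  exact this

lemma measurableSet_translate (hE : MeasurableSet E) (q : Plane) :
    MeasurableSet {x | x - q ∈ E} :=
  hE.preimage (by fun_prop)

lemma share_nonneg (q : Plane) (R : Set Plane) : 0 ≤ share E q R :=
  div_nonneg measureReal_nonneg measureReal_nonneg

lemma share_le_one (hEtop : volume E ≠ ⊤) (q : Plane) (R : Set Plane) : share E q R ≤ 1 := by
  refine div_le_one_of_le₀ ?_ measureReal_nonneg
  refine ENNReal.toReal_mono hEtop ?_
  rw [← volume_translate E q]
  exact measure_mono Set.inter_subset_right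

lemma share_eq_zero {q : Plane} {R : Set Plane} (h : ∀ x ∈ R, x - q ∉ E) : share E q R = 0 := by
  have : R ∩ {x | x - q ∈ E} = ∅ := Set.disjoint_iff_inter_eq_empty.1 (Set.disjoint_left.2 h)
  rw [share, this]; simp

lemma share_le_strip (hEtop : volume E ≠ ⊤) (hE0 : volume E ≠ 0) {s C : ℝ} (hC : 0 ≤ C)
    (hstrip : ∀ c d, volume (E ∩ {x | cY s x ∈ Set.Ioo c d})
      ≤ ENNReal.ofReal (C * (d - c)) * volume E) (q : Plane) (a b : ℝ) {c d : ℝ} (hcd : c ≤ d) :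
    share E q (rectangle s a b c d) ≤ C * (d - c) := by
  have hpos : 0 < volume.real E := ENNReal.toReal_pos hE0 hEtop
  rw [share, div_le_iff₀ hpos]
  have h1 : volume (rectangle s a b c d ∩ {x | x - q ∈ E})
      ≤ ENNReal.ofReal (C * (d - c)) * volume E := by
    have h2 := hstrip (c - cY s q) (d - cY s q)
    rw [sub_sub_sub_cancel_right] at h2
    refine le_trans ?_ h2
    rw [← volume_translate (E ∩ _) q]
    refine measure_mono ?_
    rintro x ⟨⟨-, h3, h4⟩, h5⟩
    refine ⟨h5, ?_⟩
    change cY s (x - q) ∈ Set.Ioo (c - cY s q) (d - cY s q)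
    rw [cY_sub]
    exact ⟨sub_lt_sub_right h3 _, sub_lt_sub_right h4 _⟩
  have h3 := ENNReal.toReal_mono (ENNReal.mul_ne_top ENNReal.ofReal_ne_top hEtop) h1
  rw [ENNReal.toReal_mul, ENNReal.toReal_ofReal (mul_nonneg hC (by linarith))] at h3
  exact h3

lemma placed_nonneg (x : Plane) : 0 ≤ placed E p x :=
  Finset.sum_nonneg fun _ _ => Set.indicator_nonneg (fun _ _ => inv_nonneg.2 measureReal_nonneg) _

lemma integrable_indicator_translate (hE : MeasurableSet E) (hEtop : volume E ≠ ⊤) (q : Plane) :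
    Integrable ({x | x - q ∈ E}.indicator fun _ => (volume.real E)⁻¹) := by
  rw [integrable_indicator_iff (measurableSet_translate hE q)]
  exact integrableOn_const (by rwa [volume_translate])

lemma integrable_placed (hE : MeasurableSet E) (hEtop : volume E ≠ ⊤) :
    Integrable (placed E p) :=
  integrable_finsetSum _ fun i _ => integrable_indicator_translate hE hEtop (p i)

lemma setIntegral_placed (hE : MeasurableSet E) (hEtop : volume E ≠ ⊤) (R : Set Plane) :
    ∫ x in R, placed E p x = ∑ i, share E (p i) R := by
  unfold placed
  rw [integral_finsetSum _ fun i _ => (integrable_indicator_translate hE hEtop (p i)).integrableOn]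
  refine Finset.sum_congr rfl fun i _ => ?_
  rw [integral_indicator (measurableSet_translate hE (p i)),
    Measure.restrict_restrict (measurableSet_translate hE (p i)), setIntegral_const, smul_eq_mul,
    share, Set.inter_comm]
  rfl

lemma integral_placed (hE : MeasurableSet E) (hEtop : volume E ≠ ⊤) (hE0 : volume E ≠ 0) :
    ∫ x, placed E p x = Fintype.card ι := by
  rw [← setIntegral_univ, setIntegral_placed hE hEtop]
  have hpos : 0 < volume.real E := ENNReal.toReal_pos hE0 hEtop
  have : ∀ i, share E (p i) Set.univ = 1 := fun i => by
    rw [share, Set.univ_inter, measureReal_def, volume_translate, ← measureReal_def,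
      div_self hpos.ne']
  simp [this]

lemma continuousAt_indicator_const_of_notMem_frontier {S : Set Plane} {x : Plane}
    (hx : x ∉ frontier S) (r : ℝ) : ContinuousAt (fun y => S.indicator (fun _ => r) y) x := by
  have hc : S ∈ 𝓝 x ∨ Sᶜ ∈ 𝓝 x := by
    by_contra hcon
    push Not at hcon
    rw [mem_interior_iff_mem_nhds.symm, mem_interior_iff_mem_nhds.symm, interior_compl,
      Set.mem_compl_iff, not_not] at hcon
    exact hx ⟨hcon.2, hcon.1⟩
  rcases hc with h | h
  · refine (continuousAt_const (y := r)).congr ?_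
    filter_upwards [h] with y hy
    rw [Set.indicator_of_mem hy]
  · refine (continuousAt_const (y := (0 : ℝ))).congr ?_
    filter_upwards [h] with y hy
    rw [Set.indicator_of_notMem hy]

lemma ae_continuousAt_placed (hE : volume (frontier E) = 0) :
    ∀ᵐ x, ContinuousAt (placed E p) x := by
  have h1 : ∀ i, ∀ᵐ x, x - p i ∉ frontier E := fun i => by
    rw [ae_iff]
    have := volume_translate (frontier E) (p i)
    rw [hE] at this
    simpa using this
  filter_upwards [ae_all_iff.2 h1] with x hx
  unfold placed
  refine tendsto_finsetSum _ fun i _ => ?_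
  have hc : ContinuousAt (fun y => E.indicator (fun _ => (volume.real E)⁻¹) y) (x - p i) :=
    continuousAt_indicator_const_of_notMem_frontier (hx i) _
  have h2 : ContinuousAt (fun y : Plane => y - p i) x := by fun_prop
  exact ContinuousAt.comp (f := fun y : Plane => y - p i) hc h2

/-- The points far from the `p i` that lie in a rectangle of slope `s`, whose longest sides have
the slope `s`, where the mean of `placed E p` is large. -/
def farHeavy (E : Set Plane) (p : ι → Plane) (s ε : ℝ) : Set Plane :=
  {x | (∀ i, 4 < dist x (p i)) ∧ ∃ a b c d, a < b ∧ c < d ∧ d - c ≤ b - a ∧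
    x ∈ rectangle s a b c d ∧ ε * ((b - a) * (d - c)) < ∑ i, share E (p i) (rectangle s a b c d)}

/-- A rectangle longer in the orthogonal direction is a rectangle of slope `s + π / 2`, so only
rectangles whose first side is the longer one remain to be studied. -/
lemma exceeds_placed_subset (hE : MeasurableSet E) (hEtop : volume E ≠ ⊤) (s ε : ℝ) :
    exceeds (placed E p) s ε ⊆ (⋃ i, Metric.closedBall (p i) 4) ∪
      (farHeavy E p s ε ∪ farHeavy E p (s + Real.pi / 2) ε) := by
  rintro x ⟨R, ⟨a, b, c, d, hab, hcd, rfl⟩, hx, ht⟩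
  by_cases hfar : ∀ i, 4 < dist x (p i)
  swap
  · push Not at hfar
    obtain ⟨i, hi⟩ := hfar
    exact Or.inl (Set.mem_iUnion.2 ⟨i, hi⟩)
  right
  have hpos : 0 < (b - a) * (d - c) := mul_pos (sub_pos.2 hab) (sub_pos.2 hcd)
  rw [rectangle_average _ _ hab hcd, setIntegral_placed hE hEtop, ← div_eq_inv_mul,
    lt_div_iff₀ hpos] at ht
  by_cases hle : d - c ≤ b - a
  · exact Or.inl ⟨hfar, a, b, c, d, hab, hcd, hle, hx, ht⟩
  · right
    have hR : rectangle (s + Real.pi / 2) c d (-b) (-a) = rectangle s a b c d := by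
      ext y
      rw [mem_rectangle, mem_rectangle, cX_add_pi_div_two, cY_add_pi_div_two]
      simp only [Set.mem_Ioo]
      constructor <;> rintro ⟨⟨_, _⟩, _, _⟩ <;> refine ⟨⟨?_, ?_⟩, ?_, ?_⟩ <;> linarith
    refine ⟨hfar, c, d, -b, -a, hcd, by linarith, by linarith, by rwa [hR], ?_⟩
    rwa [hR, show ε * ((d - c) * (-a - -b)) = ε * ((b - a) * (d - c)) by ring]

open Classical in
lemma card_hits_mul_le {D : ℝ} (hD : 0 < D)
    (hq : Function.Injective fun i => (⌊p i 0 / D⌋, ⌊p i 1 / D⌋)) {s a b c d : ℝ} (hab : a ≤ b)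
    (hcd : c ≤ d) :
    ((Finset.univ.filter fun i => p i ∈ rectangle s a b c d).card : ℝ) * (D * D)
      ≤ (b - a + 4 * D) * (d - c + 4 * D) := by
  set H := Finset.univ.filter fun i => p i ∈ rectangle s a b c d
  let cell : ι → Set Plane := fun i => {y | cX 0 y ∈ Set.Ico (D * ⌊p i 0 / D⌋) (D * ⌊p i 0 / D⌋ + D) ∧
    cY 0 y ∈ Set.Ico (D * ⌊p i 1 / D⌋) (D * ⌊p i 1 / D⌋ + D)}
  have hfl : ∀ (t : ℝ) (n : ℤ), t ∈ Set.Ico (D * n) (D * n + D) ↔ ⌊t / D⌋ = n := by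
    intro t n
    rw [Int.floor_eq_iff, le_div_iff₀ hD, div_lt_iff₀ hD, Set.mem_Ico]
    constructor <;> rintro ⟨h1, h2⟩ <;> constructor <;> linarith
  have hcX : ∀ y : Plane, cX 0 y = y 0 := fun y => by simp [cX]
  have hcY : ∀ y : Plane, cY 0 y = y 1 := fun y => by simp [cY]
  have hcell : ∀ i y, y ∈ cell i ↔ (⌊y 0 / D⌋, ⌊y 1 / D⌋) = (⌊p i 0 / D⌋, ⌊p i 1 / D⌋) := by
    intro i y
    rw [Prod.mk.injEq, ← hfl, ← hfl, ← hcX y, ← hcY y]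
    rfl
  have hvol : ∀ i, volume (cell i) = ENNReal.ofReal (D * D) := by
    intro i
    rw [show volume (cell i) = _ from volume_coords measurableSet_Ico measurableSet_Ico]
    simp [ENNReal.ofReal_mul hD.le]
  have hm : ∀ i, MeasurableSet (cell i) := fun i =>
    (measurableSet_Ico.preimage (continuous_cX 0).measurable).inter
      (measurableSet_Ico.preimage (continuous_cY 0).measurable)
  have hsub : (⋃ i ∈ H, cell i) ⊆
      rectangle s (a - 2 * D) (b + 2 * D) (c - 2 * D) (d + 2 * D) := by
    refine Set.iUnion₂_subset fun i hi y hy => ?_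
    have hpi : p i ∈ rectangle s a b c d := (Finset.mem_filter.1 hi).2
    have hpc : p i ∈ cell i := (hcell i _).2 rfl
    have hd : ‖y - p i‖ ≤ 2 * D := by
      refine (norm_le_abs_add 0 _).trans ?_
      rw [cX_sub, cY_sub]
      have h1 : |cX 0 y - cX 0 (p i)| ≤ D :=
        abs_le.2 ⟨by linarith [hy.1.1, hpc.1.2], by linarith [hy.1.2, hpc.1.1]⟩
      have h2 : |cY 0 y - cY 0 (p i)| ≤ D :=
        abs_le.2 ⟨by linarith [hy.2.1, hpc.2.2], by linarith [hy.2.2, hpc.2.1]⟩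
      linarith
    have h1 := (abs_cX_le s _).trans hd
    have h2 := (abs_cY_le s _).trans hd
    rw [cX_sub, abs_le] at h1
    rw [cY_sub, abs_le] at h2
    obtain ⟨⟨k1, k2⟩, k3, k4⟩ := mem_rectangle.1 hpi
    exact mem_rectangle.2 ⟨⟨by linarith [h1.1], by linarith [h1.2]⟩, by linarith [h2.1],
      by linarith [h2.2]⟩
  have hdisj : Set.PairwiseDisjoint (H : Set ι) cell := by
    intro i _ j _ hij
    rw [Function.onFun, Set.disjoint_left]
    intro y h1 h2
    exact hij (hq (((hcell i y).1 h1).symm.trans ((hcell j y).1 h2)))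
  have h := measure_mono (μ := volume) hsub
  rw [measure_biUnion_finset hdisj fun i _ => hm i, Finset.sum_congr rfl fun i _ => hvol i,
    Finset.sum_const, nsmul_eq_mul, volume_rectangle _ _ _ (by linarith), ← ENNReal.ofReal_natCast,
    ← ENNReal.ofReal_mul (Nat.cast_nonneg _), ENNReal.ofReal_le_ofReal_iff] at h
  · refine h.trans (le_of_eq ?_)
    ring
  · exact mul_nonneg (by linarith) (by linarith)

-- A rectangle with both sides at least `v` meets so few cells that its mean is at most `ε`. A
-- thinner one receives at most `C (d - c)` from each translate, so the factor `d - c` cancels and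
-- only a count of centres in a strip of fixed width remains.
open Classical in
lemma exists_hits_of_mem_farHeavy (hE : ∀ x ∈ E, ‖x‖ ≤ 3) (hEtop : volume E ≠ ⊤)
    (hE0 : volume E ≠ 0) {s C ε v D : ℝ} (hC : 0 ≤ C) (hε : 0 < ε) (hv : 0 < v)
    (hvε : 100 ≤ ε * (v * v)) (hvD : v ≤ 5 * D) (hD : 8 ≤ D)
    (hq : Function.Injective fun i => (⌊p i 0 / D⌋, ⌊p i 1 / D⌋))
    (hstrip : ∀ c d, volume (E ∩ {x | cY s x ∈ Set.Ioo c d})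
      ≤ ENNReal.ofReal (C * (d - c)) * volume E) {x : Plane} (hx : x ∈ farHeavy E p s ε) :
    ∃ a b, 1 / 2 < b - a ∧ cX s x ∈ Set.Ioo a b ∧
      ε * (b - a) < C * (Finset.univ.filter fun i => p i ∈
        rectangle s (a - 4) (b + 4) (cY s x - (v + 4)) (cY s x + (v + 4))).card := by
  obtain ⟨hfar, a, b, c, d, hab, hcd, hle, hxR, hlt⟩ := hx
  set R := rectangle s a b c d with hR
  have hx' := mem_rectangle.1 hxR
  have hhit : ∀ i, share E (p i) R ≠ 0 →
      p i ∈ rectangle s (a - 4) (b + 4) (c - 4) (d + 4) ∧ 1 / 2 < b - a := by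
    intro i hi
    have : ∃ y ∈ R, y - p i ∈ E := by
      by_contra hcon
      push Not at hcon
      exact hi (share_eq_zero hcon)
    obtain ⟨y, hyR, hyE⟩ := this
    have h3 := hE _ hyE
    have h4 := dist_le_of_mem_rectangle hxR hyR
    have h5 := dist_triangle x y (p i)
    rw [dist_eq_norm y] at h5
    refine ⟨?_, by linarith [hfar i]⟩
    have h1 := (abs_cX_le s _).trans h3
    have h2 := (abs_cY_le s _).trans h3
    rw [cX_sub, abs_le] at h1
    rw [cY_sub, abs_le] at h2
    obtain ⟨⟨k1, k2⟩, k3, k4⟩ := mem_rectangle.1 hyR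
    exact mem_rectangle.2 ⟨⟨by linarith [h1.2], by linarith [h1.1]⟩, by linarith [h2.2],
      by linarith [h2.1]⟩
  have hsum : ∀ M : ℝ, 0 ≤ M → (∀ i, share E (p i) R ≤ M) → ∑ i, share E (p i) R
      ≤ M * (Finset.univ.filter fun i => p i ∈
        rectangle s (a - 4) (b + 4) (c - 4) (d + 4)).card := by
    intro M hM hbd
    rw [mul_comm, ← nsmul_eq_mul, ← Finset.sum_const, Finset.sum_filter]
    refine Finset.sum_le_sum fun i _ => ?_
    split_ifs with h
    · exact hbd i
    · by_contra hcon
      exact h (hhit i (by linarith)).1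
  have hpos : 0 < (b - a) * (d - c) := mul_pos (sub_pos.2 hab) (sub_pos.2 hcd)
  have hu : 1 / 2 < b - a := by
    by_contra hcon
    have : ∀ i, share E (p i) R = 0 := fun i => by
      by_contra hi
      exact hcon (hhit i hi).2
    simp only [this, Finset.sum_const_zero] at hlt
    nlinarith
  -- Otherwise the number of translates met is at most `(10 / v) ^ 2` times the area, and `100 ≤ ε v
  -- ^ 2` contradicts the large mean.
  have hthin : d - c < v := by
    by_contra hcon
    have hdv : v ≤ d - c := not_lt.1 hcon
    have h1 := hsum 1 zero_le_one fun i => share_le_one hEtop _ _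
    rw [one_mul] at h1
    have h2 := card_hits_mul_le (s := s) (a := a - 4) (b := b + 4) (c := c - 4) (d := d + 4)
      (show 0 < D by linarith) hq (by linarith) (by linarith)
    set k : ℝ := ((Finset.univ.filter fun i => p i ∈
      rectangle s (a - 4) (b + 4) (c - 4) (d + 4)).card : ℝ)
    have h3 : k * (D * D) ≤ (b - a + 5 * D) * (d - c + 5 * D) := by
      refine h2.trans (mul_le_mul (by linarith) (by linarith) (by linarith) (by linarith))
    have h4 : v * (b - a + 5 * D) ≤ 10 * D * (b - a) := by
      have := mul_le_mul_of_nonneg_left (show v ≤ b - a by linarith) (show 0 ≤ 5 * D by linarith)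
      have := mul_le_mul_of_nonneg_right hvD (show 0 ≤ b - a by linarith)
      linarith
    have h5 : v * (d - c + 5 * D) ≤ 10 * D * (d - c) := by
      have := mul_le_mul_of_nonneg_left hdv (show 0 ≤ 5 * D by linarith)
      have := mul_le_mul_of_nonneg_right hvD (show 0 ≤ d - c by linarith)
      linarith
    have h6 : (v * (b - a + 5 * D)) * (v * (d - c + 5 * D))
        ≤ (10 * D * (b - a)) * (10 * D * (d - c)) :=
      mul_le_mul h4 h5 (mul_nonneg hv.le (by linarith))
        (mul_nonneg (by linarith) (by linarith))
    have h7 : (v * v) * (k * (D * D)) ≤ (v * v) * ((b - a + 5 * D) * (d - c + 5 * D)) :=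
      mul_le_mul_of_nonneg_left h3 (by positivity)
    have h8 : 0 < (v * v) * (D * D) := by
      have : 0 < D := by linarith
      positivity
    have h9 := mul_lt_mul_of_pos_right (hlt.trans_le h1) h8
    have h10 : 100 * (((b - a) * (d - c)) * (D * D))
        ≤ (ε * (v * v)) * (((b - a) * (d - c)) * (D * D)) :=
      mul_le_mul_of_nonneg_right hvε (by positivity)
    linarith
  refine ⟨a, b, hu, hx'.1, ?_⟩
  have h1 := hsum (C * (d - c)) (mul_nonneg hC (by linarith)) fun i =>
    share_le_strip hEtop hE0 hC hstrip (p i) a b hcd.le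
  have h2 : (Finset.univ.filter fun i => p i ∈
        rectangle s (a - 4) (b + 4) (c - 4) (d + 4)).card ≤ (Finset.univ.filter fun i => p i ∈
        rectangle s (a - 4) (b + 4) (cY s x - (v + 4)) (cY s x + (v + 4))).card := by
    refine Finset.card_le_card fun i hi => ?_
    rw [Finset.mem_filter] at hi ⊢
    obtain ⟨k0, k3, k4⟩ := hi.2
    refine ⟨Finset.mem_univ _, k0, ?_, ?_⟩
    · exact lt_of_le_of_lt (by linarith [hx'.2.2]) k3
    · exact k4.trans_le (by linarith [hx'.2.1])
  have h3 : ((Finset.univ.filter fun i => p i ∈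
        rectangle s (a - 4) (b + 4) (c - 4) (d + 4)).card : ℝ) ≤ (Finset.univ.filter fun i => p i ∈
        rectangle s (a - 4) (b + 4) (cY s x - (v + 4)) (cY s x + (v + 4))).card := by
    exact_mod_cast h2
  have h4 := hlt.trans_le h1
  have hdc : 0 < d - c := by linarith
  have h5 : (d - c) * (ε * (b - a)) < (d - c) * (C * (Finset.univ.filter fun i => p i ∈
        rectangle s (a - 4) (b + 4) (c - 4) (d + 4)).card) := by linarith
  exact (lt_of_mul_lt_mul_left h5 hdc.le).trans_le (mul_le_mul_of_nonneg_left h3 hC)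

/-- Vitali's lemma for parallel rectangles of one fixed width: disjoint rectangles contain disjoint
sets of centres, so the sum of their lengths is at most `C / ε` times the number of centres. -/
lemma volume_le_of_hits {X : Set Plane} {s C ε N : ℝ} (hε : 0 < ε) (hC : 0 ≤ C)
    (hN : 0 < N)
    (hX : ∀ x ∈ X, ∃ a b, 1 / 2 < b - a ∧ cX s x ∈ Set.Ioo a b ∧ ε * (b - a) < C *
      {i | p i ∈ rectangle s (a - 4) (b + 4) (cY s x - N) (cY s x + N)}.ncard) :
    volume X ≤ ENNReal.ofReal (212 * N * C / ε) * Fintype.card ι := by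
  classical
  choose! a b hab hx hk using hX
  let B : Plane → Set Plane := fun x => rectangle s (a x - 4) (b x + 4) (cY s x - N) (cY s x + N)
  have hmemB : ∀ x ∈ X, x ∈ B x := fun x hxX =>
    mem_rectangle.2 ⟨⟨by linarith [(hx x hxX).1], by linarith [(hx x hxX).2]⟩, by linarith,
      by linarith⟩
  let K : Plane → Finset ι := fun x => Finset.univ.filter fun i => p i ∈ B x
  have hK : ∀ x ∈ X, ε * (b x - a x) < C * (K x).card := by
    intro x hxX
    convert hk x hxX using 3
    rw [← Set.ncard_coe_finset]
    congr 1
    ext i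
    simp [K, B]
  obtain ⟨u, huX, hdisj, hcov⟩ := Vitali.exists_disjoint_subfamily_covering_enlargement
    B X (fun x => b x - a x) 2 (by norm_num) (fun x hxX => by linarith [hab x hxX])
    (C * Fintype.card ι / ε) (fun x hxX => by
      rw [le_div_iff₀ hε, mul_comm]
      refine (hK x hxX).le.trans (mul_le_mul_of_nonneg_left ?_ hC)
      exact_mod_cast Finset.card_le_univ _) (fun x hxX => ⟨x, hmemB x hxX⟩)
  have hKne : ∀ x ∈ X, (K x).Nonempty := by
    intro x hxX
    rw [Finset.nonempty_iff_ne_empty]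
    intro h0
    have := hK x hxX
    rw [h0, Finset.card_empty, Nat.cast_zero, mul_zero] at this
    nlinarith [hab x hxX]
  have hKdisj : ∀ x ∈ u, ∀ y ∈ u, x ≠ y → Disjoint (K x) (K y) := by
    intro x hxu y hyu hxy
    rw [Finset.disjoint_left]
    intro i hi hj
    exact Set.disjoint_left.1 (hdisj hxu hyu hxy) (Finset.mem_filter.1 hi).2
      (Finset.mem_filter.1 hj).2
  have hfin : u.Finite := by
    have : ∀ x : u, ∃ i, i ∈ K x := fun x => hKne x (huX x.2)
    choose f hf using this
    have hinj : Function.Injective f := by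
      intro x y hxy
      by_contra hne
      have := hKdisj x x.2 y y.2 (fun h => hne (Subtype.ext h))
      exact Finset.disjoint_left.1 this (hf x) (hxy ▸ hf y)
    have := Finite.of_injective f hinj
    exact Set.toFinite u
  have hsub : X ⊆ ⋃ y ∈ hfin.toFinset, rectangle s (a y - 12 - 2 * (b y - a y))
      (b y + 12 + 2 * (b y - a y)) (cY s y - 2 * N) (cY s y + 2 * N) := by
    intro x hxX
    obtain ⟨y, hyu, ⟨z, hz1, hz2⟩, hle⟩ := hcov x hxX
    simp only [Set.mem_iUnion]
    refine ⟨y, hfin.mem_toFinset.2 hyu, ?_⟩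
    obtain ⟨⟨k1, k2⟩, k3, k4⟩ := mem_rectangle.1 hz1
    obtain ⟨⟨m1, m2⟩, m3, m4⟩ := mem_rectangle.1 hz2
    obtain ⟨n1, n2⟩ := hx x hxX
    exact mem_rectangle.2 ⟨⟨by linarith, by linarith⟩, by linarith, by linarith⟩
  have hcard : ∑ y ∈ hfin.toFinset, (K y).card ≤ Fintype.card ι := by
    rw [← Finset.card_biUnion]
    · exact Finset.card_le_univ _
    · intro x hxu y hyu hxy
      exact hKdisj x (hfin.mem_toFinset.1 hxu) y (hfin.mem_toFinset.1 hyu) hxy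
  calc volume X ≤ _ := measure_mono hsub
    _ ≤ ∑ y ∈ hfin.toFinset, volume (rectangle s (a y - 12 - 2 * (b y - a y))
      (b y + 12 + 2 * (b y - a y)) (cY s y - 2 * N) (cY s y + 2 * N)) :=
        measure_biUnion_finset_le _ _
    _ ≤ ∑ y ∈ hfin.toFinset, ENNReal.ofReal (212 * N * C / ε) * (K y).card := by
        refine Finset.sum_le_sum fun y hy => ?_
        have hyX := huX (hfin.mem_toFinset.1 hy)
        have h1 := hab y hyX
        have h2 := hK y hyX
        rw [volume_rectangle _ _ _ (by linarith), ← ENNReal.ofReal_natCast,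
          ← ENNReal.ofReal_mul (by positivity)]
        refine ENNReal.ofReal_le_ofReal ?_
        rw [div_mul_eq_mul_div, le_div_iff₀ hε]
        -- The excess 24 is absorbed by `b - a > 1 / 2`; with the width `4 N` this gives `212 = 53 *
        -- 4`.
        have h3 : (b y + 12 + 2 * (b y - a y) - (a y - 12 - 2 * (b y - a y))) ≤ 53 * (b y - a y) := by
          linarith
        have h4 := mul_le_mul_of_nonneg_right h3 (show 0 ≤ 4 * N * ε by positivity)
        have h5 := mul_le_mul_of_nonneg_left h2.le (show 0 ≤ 212 * N by positivity)
        linarith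
    _ ≤ _ := by
        rw [← Finset.mul_sum]
        gcongr
        exact_mod_cast hcard

end Placed

/-- The factor in front of the number of translates does not involve the cell size `D`, so `D` can
be chosen afterwards to make the density of the exceptional set small. -/
lemma volume_exceeds_placed_le {ι : Type*} [Fintype ι] {E : Set Plane} {p : ι → Plane}
    (hEm : MeasurableSet E) (hE : ∀ x ∈ E, ‖x‖ ≤ 3) (hEtop : volume E ≠ ⊤)
    (hE0 : volume E ≠ 0) {s C ε v D : ℝ} (hC : 0 ≤ C) (hε : 0 < ε) (hv : 0 < v)
    (hvε : 100 ≤ ε * (v * v)) (hvD : v ≤ 5 * D) (hD : 8 ≤ D)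
    (hq : Function.Injective fun i => (⌊p i 0 / D⌋, ⌊p i 1 / D⌋))
    (hstrip : ∀ t ∈ ({s, s + Real.pi / 2} : Set ℝ), ∀ c d,
      volume (E ∩ {x | cY t x ∈ Set.Ioo c d}) ≤ ENNReal.ofReal (C * (d - c)) * volume E) :
    volume (exceeds (placed E p) s ε)
      ≤ ENNReal.ofReal (64 + 424 * (v + 4) * C / ε) * Fintype.card ι := by
  classical
  have hfar : ∀ t ∈ ({s, s + Real.pi / 2} : Set ℝ), volume (farHeavy E p t ε)
      ≤ ENNReal.ofReal (212 * (v + 4) * C / ε) * Fintype.card ι := by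
    intro t ht
    refine volume_le_of_hits (p := p) (s := t) hε hC (by linarith) fun x hx => ?_
    obtain ⟨a, b, h1, h2, h3⟩ := exists_hits_of_mem_farHeavy hE hEtop hE0 hC hε hv hvε hvD hD hq
      (hstrip t ht) hx
    refine ⟨a, b, h1, h2, ?_⟩
    convert h3 using 3
    rw [← Set.ncard_coe_finset]
    congr 1
    ext i
    simp
  have hball : ∀ i, volume (Metric.closedBall (p i) 4) ≤ ENNReal.ofReal 64 := by
    intro i
    have h1 := volume_coords (s := 0) (measurableSet_Icc (a := cX 0 (p i) - 4)
      (b := cX 0 (p i) + 4)) (measurableSet_Icc (a := cY 0 (p i) - 4) (b := cY 0 (p i) + 4))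
    rw [Real.volume_Icc, Real.volume_Icc, ← ENNReal.ofReal_mul (by linarith)] at h1
    rw [show (64 : ℝ) = (cX 0 (p i) + 4 - (cX 0 (p i) - 4)) * (cY 0 (p i) + 4 - (cY 0 (p i) - 4))
      by ring, ← h1]
    refine measure_mono fun x hx => ?_
    rw [Metric.mem_closedBall, dist_eq_norm] at hx
    have h2 := (abs_cX_le 0 _).trans hx
    have h3 := (abs_cY_le 0 _).trans hx
    rw [cX_sub, abs_le] at h2
    rw [cY_sub, abs_le] at h3
    exact ⟨⟨by linarith [h2.1], by linarith [h2.2]⟩, by linarith [h3.1], by linarith [h3.2]⟩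
  calc volume (exceeds (placed E p) s ε)
      ≤ volume (⋃ i, Metric.closedBall (p i) 4) + (volume (farHeavy E p s ε)
          + volume (farHeavy E p (s + Real.pi / 2) ε)) :=
        (measure_mono (exceeds_placed_subset hEm hEtop s ε)).trans
          ((measure_union_le _ _).trans (add_le_add le_rfl (measure_union_le _ _)))
    _ ≤ ENNReal.ofReal 64 * Fintype.card ι
        + (ENNReal.ofReal (212 * (v + 4) * C / ε) * Fintype.card ι
          + ENNReal.ofReal (212 * (v + 4) * C / ε) * Fintype.card ι) := by
        refine add_le_add ?_ (add_le_add (hfar _ (by simp)) (hfar _ (by simp)))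
        refine (measure_iUnion_fintype_le _ _).trans
          ((Finset.sum_le_card_nsmul _ _ _ fun i _ => hball i).trans (le_of_eq ?_))
        rw [nsmul_eq_mul, mul_comm, Finset.card_univ]
    _ = _ := by
        have h0 : 0 ≤ 212 * (v + 4) * C / ε := by positivity
        rw [← add_mul, ← add_mul, ← ENNReal.ofReal_add h0 h0, ← ENNReal.ofReal_add (by norm_num)
          (by positivity)]
        congr 3
        ring

/-! ### Placing translates so that all sections cover at once. -/

/-- The margin `ρ` is uniform over the compact set of slopes, so one finite lattice of positions
serves all of them. -/
lemma exists_uniform_thick_subset {G : Set (ℝ × Plane)} (hG : IsOpen G) {K : Set ℝ}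
    (hK : IsCompact K) {c : ENNReal} (hc : ∀ s ∈ K, c < volume {x | (s, x) ∈ G}) :
    ∃ ρ > 0, ∀ s ∈ K, ∃ C : Set Plane, c ≤ volume C ∧ ∀ y ∈ C, ∀ z, dist z y < ρ → (s, z) ∈ G := by
  refine hK.induction_on (p := fun K' => ∃ ρ > 0, ∀ s ∈ K', ∃ C : Set Plane, c ≤ volume C ∧
    ∀ y ∈ C, ∀ z, dist z y < ρ → (s, z) ∈ G) ?_ ?_ ?_ ?_
  · exact ⟨1, one_pos, fun s hs => hs.elim⟩
  · rintro S T hST ⟨ρ, hρ, h⟩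
    exact ⟨ρ, hρ, fun s hs => h s (hST hs)⟩
  · rintro S T ⟨ρ, hρ, h⟩ ⟨ρ', hρ', h'⟩
    refine ⟨min ρ ρ', lt_min hρ hρ', fun s hs => ?_⟩
    rcases hs with hs | hs
    · obtain ⟨C, hC, hC'⟩ := h s hs
      exact ⟨C, hC, fun y hy z hz => hC' y hy z (hz.trans_le (min_le_left _ _))⟩
    · obtain ⟨C, hC, hC'⟩ := h' s hs
      exact ⟨C, hC, fun y hy z hz => hC' y hy z (hz.trans_le (min_le_right _ _))⟩
  · intro s hs
    have ho : IsOpen {x | (s, x) ∈ G} := hG.preimage (by fun_prop)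
    obtain ⟨C, hCs, hC, hcC⟩ := ho.exists_lt_isCompact (hc s hs)
    have hsub : ({s} : Set ℝ) ×ˢ C ⊆ G := by
      rintro ⟨t, x⟩ ⟨ht, hx⟩
      rw [Set.mem_singleton_iff] at ht
      simp only at ht
      rw [ht]; exact hCs hx
    obtain ⟨ρ, hρ, hthick⟩ := (isCompact_singleton.prod hC).exists_thickening_subset_open hG hsub
    refine ⟨Metric.ball s ρ, mem_nhdsWithin_of_mem_nhds (Metric.ball_mem_nhds s hρ), ρ, hρ,
      fun t ht => ⟨C, hcC.le, fun y hy z hz => hthick ?_⟩⟩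
    rw [Metric.mem_thickening_iff]
    exact ⟨(s, y), ⟨rfl, hy⟩, by rw [Prod.dist_eq]; exact max_lt ht hz⟩

lemma card_avoiding_le {α β : Type*} [Fintype α] [Fintype β] [DecidableEq α] [DecidableEq β]
    [Nonempty β] (H : α → Finset β) :
    ((Finset.univ.filter fun c : α → β => ∀ a, c a ∉ H a).card : ℝ)
      ≤ Fintype.card (α → β) * Real.exp (-(∑ a, ((H a).card : ℝ)) / Fintype.card β) := by
  have hN : (0 : ℝ) < Fintype.card β := by exact_mod_cast Fintype.card_pos
  have h1 : (Finset.univ.filter fun c : α → β => ∀ a, c a ∉ H a)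
      = Fintype.piFinset fun a => (H a)ᶜ := by
    ext c; simp
  rw [h1, Fintype.card_piFinset, Fintype.card_fun]
  push_cast
  have h2 : ∀ a, (((H a)ᶜ.card : ℕ) : ℝ)
      ≤ Fintype.card β * Real.exp (-((H a).card : ℝ) / Fintype.card β) := by
    intro a
    rw [Finset.card_compl, Nat.cast_sub (Finset.card_le_univ _)]
    have h3 := Real.add_one_le_exp (-((H a).card : ℝ) / Fintype.card β)
    have h4 := mul_le_mul_of_nonneg_left h3 hN.le
    refine le_trans (le_of_eq ?_) h4
    field_simp; ring
  refine (Finset.prod_le_prod (fun _ _ => Nat.cast_nonneg _) fun a _ => h2 a).trans (le_of_eq ?_)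
  rw [Finset.prod_mul_distrib, Finset.prod_const, Finset.card_univ, ← Real.exp_sum,
    ← Finset.sum_div, Finset.sum_neg_distrib]

/-- The point of index `k` of the cell of index `i`, in the lattice of step `δ` whose cells have
`m × m` points. -/
def latticePoint (δ : ℝ) (m : ℕ) (i k : ℕ × ℕ) : Plane :=
  !₂[δ * (i.1 * m + k.1 : ℝ), δ * (i.2 * m + k.2 : ℝ)]

@[simp] lemma latticePoint_zero (δ : ℝ) (m : ℕ) (i k : ℕ × ℕ) :
    latticePoint δ m i k 0 = δ * (i.1 * m + k.1 : ℝ) := rfl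

@[simp] lemma latticePoint_one (δ : ℝ) (m : ℕ) (i k : ℕ × ℕ) :
    latticePoint δ m i k 1 = δ * (i.2 * m + k.2 : ℝ) := rfl

lemma exists_index {δ t : ℝ} (hδ : 0 < δ) {n m : ℕ} (ht0 : 0 ≤ t) (ht : t < δ * (n * m)) :
    ∃ (i : Fin n) (k : Fin m), δ * ((i : ℕ) * m + (k : ℕ) : ℝ) ≤ t ∧
      t < δ * ((i : ℕ) * m + (k : ℕ) : ℝ) + δ := by
  have h1 : t / δ < n * m := by rw [div_lt_iff₀ hδ]; linarith
  have h2 : ⌊t / δ⌋₊ < n * m := by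
    rw [Nat.floor_lt (by positivity)]; exact_mod_cast h1
  have hm : 0 < m := by
    rcases Nat.eq_zero_or_pos m with h | h
    · subst h; simp at h2
    · exact h
  have h3 : ((⌊t / δ⌋₊ / m : ℕ) * m + (⌊t / δ⌋₊ % m : ℕ) : ℝ) = ⌊t / δ⌋₊ := by
    exact_mod_cast Nat.div_add_mod' _ _
  refine ⟨⟨⌊t / δ⌋₊ / m, Nat.div_lt_of_lt_mul (by rwa [mul_comm])⟩,
    ⟨⌊t / δ⌋₊ % m, Nat.mod_lt _ hm⟩, ?_, ?_⟩
  · simp only [h3]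
    have := Nat.floor_le (show 0 ≤ t / δ by positivity)
    rwa [le_div_iff₀ hδ, mul_comm] at this
  · simp only [h3]
    have := Nat.lt_floor_add_one (t / δ)
    rw [div_lt_iff₀ hδ] at this
    linarith

/-- The square of side `T` at the origin, shrunk by `r`. -/
def innerSquare (r T : ℝ) : Set Plane :=
  {x | cX 0 x ∈ Set.Ioo r (T - r) ∧ cY 0 x ∈ Set.Ioo r (T - r)}

lemma isOpen_innerSquare (r T : ℝ) : IsOpen (innerSquare r T) :=
  (isOpen_Ioo.preimage (continuous_cX 0)).inter (isOpen_Ioo.preimage (continuous_cY 0))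

lemma volume_innerSquare {r T : ℝ} (h : 2 * r ≤ T) :
    volume (innerSquare r T) = ENNReal.ofReal ((T - 2 * r) ^ 2) := by
  rw [show volume (innerSquare r T) = _ from volume_coords measurableSet_Ioo measurableSet_Ioo,
    Real.volume_Ioo, ← ENNReal.ofReal_mul (by linarith)]
  congr 1; ring

/-- Every point of `C` lies in a lattice square of side `δ` whose corner `x - latticePoint` is
within `2 δ < ρ` of it, hence in `A`. Keeping `x` at distance `r` from the boundary ensures that the
required positions belong to the grid. -/
lemma le_card_hits {A C : Set Plane} {r δ ρ : ℝ} {n m : ℕ} (hδ : 0 < δ) (hδρ : 2 * δ < ρ)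
    (hA : ∀ x ∈ A, ‖x‖ ≤ r) (hC : ∀ y ∈ C, ∀ z, dist z y < ρ → z ∈ A) {x : Plane}
    (hx : x ∈ innerSquare r (δ * (n * m)))
    (H : Fin n × Fin n → Finset (Fin m × Fin m))
    (hH : ∀ i k, k ∈ H i ↔ x - latticePoint δ m (i.1, i.2) (k.1, k.2) ∈ A) :
    volume C ≤ ENNReal.ofReal ((δ * δ) * ∑ i, ((H i).card : ℝ)) := by
  let sq : (Fin n × Fin n) → (Fin m × Fin m) → Set Plane := fun i k =>
    {y | cX 0 y ∈ Set.Ioc (cX 0 (x - latticePoint δ m (i.1, i.2) (k.1, k.2)) - δ)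
        (cX 0 (x - latticePoint δ m (i.1, i.2) (k.1, k.2))) ∧
      cY 0 y ∈ Set.Ioc (cY 0 (x - latticePoint δ m (i.1, i.2) (k.1, k.2)) - δ)
        (cY 0 (x - latticePoint δ m (i.1, i.2) (k.1, k.2)))}
  have hsq : ∀ i k, volume (sq i k) = ENNReal.ofReal (δ * δ) := by
    intro i k
    rw [show volume (sq i k) = _ from volume_coords measurableSet_Ioc measurableSet_Ioc]
    simp [ENNReal.ofReal_mul hδ.le]
  have hX : ∀ i k, cX 0 (x - latticePoint δ m i k) = cX 0 x - δ * (i.1 * m + k.1 : ℝ) := by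
    intro i k; rw [cX_sub]; simp [cX]
  have hY : ∀ i k, cY 0 (x - latticePoint δ m i k) = cY 0 x - δ * (i.2 * m + k.2 : ℝ) := by
    intro i k; rw [cY_sub]; simp [cY]
  have hsub : C ⊆ ⋃ i ∈ (Finset.univ : Finset (Fin n × Fin n)), ⋃ k ∈ H i, sq i k := by
    intro y hy
    have hyA : y ∈ A := hC y hy y (by rw [dist_self]; linarith)
    have hyr := hA y hyA
    have h1 := abs_le.1 ((abs_cX_le 0 y).trans hyr)
    have h2 := abs_le.1 ((abs_cY_le 0 y).trans hyr)
    obtain ⟨⟨a1, a2⟩, a3, a4⟩ := hx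
    obtain ⟨i, k, b1, b2⟩ := exists_index hδ (t := cX 0 x - cX 0 y) (n := n) (m := m)
      (by linarith) (by linarith)
    obtain ⟨j, l, b3, b4⟩ := exists_index hδ (t := cY 0 x - cY 0 y) (n := n) (m := m)
      (by linarith) (by linarith)
    have hmem : y ∈ sq (i, j) (k, l) := by
      refine ⟨?_, ?_⟩
      · rw [hX]; exact ⟨by simp only; linarith, by simp only; linarith⟩
      · rw [hY]; exact ⟨by simp only; linarith, by simp only; linarith⟩
    simp only [Set.mem_iUnion]
    refine ⟨(i, j), Finset.mem_univ _, (k, l), (hH _ _).2 (hC y hy _ ?_), hmem⟩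
    rw [dist_eq_norm]
    refine lt_of_le_of_lt (norm_le_abs_add 0 _) ?_
    rw [cX_sub _ _ y, cY_sub _ _ y]
    obtain ⟨⟨c1, c2⟩, c3, c4⟩ := hmem
    have d1 := abs_le.2 (⟨by linarith, by linarith⟩ : -δ ≤ cX 0 (x - latticePoint δ m (i, j) (k, l))
      - cX 0 y ∧ cX 0 (x - latticePoint δ m (i, j) (k, l)) - cX 0 y ≤ δ)
    have d2 := abs_le.2 (⟨by linarith, by linarith⟩ : -δ ≤ cY 0 (x - latticePoint δ m (i, j) (k, l))
      - cY 0 y ∧ cY 0 (x - latticePoint δ m (i, j) (k, l)) - cY 0 y ≤ δ)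
    linarith
  refine (measure_mono hsub).trans ((measure_biUnion_finset_le _ _).trans ?_)
  rw [Finset.mul_sum, ENNReal.ofReal_sum_of_nonneg fun i _ => by positivity]
  refine Finset.sum_le_sum fun i _ => (measure_biUnion_finset_le _ _).trans (le_of_eq ?_)
  rw [Finset.sum_congr rfl fun k _ => hsq i k, Finset.sum_const, nsmul_eq_mul, mul_comm,
    ENNReal.ofReal_mul (p := δ * δ) (by positivity), ENNReal.ofReal_natCast]

/-- If the sets `H i` are large enough in total, three quarters of all configurations meet one of
them. -/
lemma le_card_meeting {α κ : Type*} [Fintype α] [DecidableEq α] [Fintype κ] [DecidableEq κ]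
    [Nonempty κ] (H : α → Finset κ) (h : 3 * (Fintype.card κ : ℝ) ≤ ∑ i, ((H i).card : ℝ)) :
    3 / 4 * (Fintype.card (α → κ) : ℝ)
      ≤ ((Finset.univ.filter fun c : α → κ => ¬ ∀ i, c i ∉ H i).card : ℝ) := by
  have h3 := card_avoiding_le H
  have hκ : (0 : ℝ) < Fintype.card κ := by exact_mod_cast Fintype.card_pos
  have h4 : Real.exp (-(∑ i, ((H i).card : ℝ)) / Fintype.card κ) ≤ 1 / 4 := by
    have e1 : -(∑ i, ((H i).card : ℝ)) / Fintype.card κ ≤ -3 := by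
      rw [div_le_iff₀ hκ]
      linarith
    refine (Real.exp_le_exp.2 e1).trans ?_
    rw [Real.exp_neg, one_div]
    refine inv_anti₀ (by norm_num) ?_
    have := Real.add_one_le_exp 3
    linarith
  have h5 := h3.trans (mul_le_mul_of_nonneg_left h4 (Nat.cast_nonneg _))
  have h6 := Finset.card_filter_add_card_filter_not (s := Finset.univ)
    (fun c : α → κ => ∀ i, c i ∉ H i)
  rw [Finset.card_univ] at h6
  have h7 := congrArg (Nat.cast : ℕ → ℝ) h6
  rw [Nat.cast_add] at h7
  linarith

/-- The points of the inner square that are covered, in the configuration `c`, by the translates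
of `A`. -/
def covered (A : Set Plane) (δ r : ℝ) {n m : ℕ} (c : Fin n × Fin n → Fin m × Fin m) :
    Set Plane :=
  innerSquare r (δ * (n * m)) ∩
    {x | ∃ i : Fin n × Fin n, x - latticePoint δ m (i.1, i.2) ((c i).1, (c i).2) ∈ A}

lemma isOpen_covered {A : Set Plane} (hA : IsOpen A) (δ r : ℝ) {n m : ℕ}
    (c : Fin n × Fin n → Fin m × Fin m) : IsOpen (covered A δ r c) := by
  refine (isOpen_innerSquare _ _).inter ?_
  rw [show {x | ∃ i : Fin n × Fin n, x - latticePoint δ m (i.1, i.2) ((c i).1, (c i).2) ∈ A}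
    = ⋃ i : Fin n × Fin n, (fun x => x - latticePoint δ m (i.1, i.2) ((c i).1, (c i).2)) ⁻¹' A by
      ext x; simp]
  exact isOpen_iUnion fun i => hA.preimage (by fun_prop)

lemma le_sum_indicator_covered {A C : Set Plane} {r δ ρ : ℝ} {n m : ℕ} (hm : 0 < m)
    (hδ : 0 < δ) (hδρ : 2 * δ < ρ)
    (hA : ∀ x ∈ A, ‖x‖ ≤ r) (hC : ∀ y ∈ C, ∀ z, dist z y < ρ → z ∈ A)
    (hCvol : ENNReal.ofReal (3 * (δ * m) ^ 2) ≤ volume C) {x : Plane}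
    (hx : x ∈ innerSquare r (δ * (n * m))) :
    ENNReal.ofReal (3 / 4 * Fintype.card (Fin n × Fin n → Fin m × Fin m))
      ≤ ∑ c : Fin n × Fin n → Fin m × Fin m, (covered A δ r c).indicator 1 x := by
  classical
  have : Nonempty (Fin m × Fin m) := ⟨(⟨0, hm⟩, ⟨0, hm⟩)⟩
  have hmR : (0 : ℝ) < m := by exact_mod_cast hm
  let H : Fin n × Fin n → Finset (Fin m × Fin m) := fun i =>
    Finset.univ.filter fun k => x - latticePoint δ m (i.1, i.2) (k.1, k.2) ∈ A
  have hHm : ∀ i k, k ∈ H i ↔ x - latticePoint δ m (i.1, i.2) (k.1, k.2) ∈ A := by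
    intro i k; simp [H]
  have h1 := hCvol.trans (le_card_hits hδ hδρ hA hC hx H hHm)
  clear_value H
  rw [ENNReal.ofReal_le_ofReal_iff (by positivity)] at h1
  have h2 : 3 * (m : ℝ) ^ 2 ≤ ∑ i, ((H i).card : ℝ) := by
    have : (δ * δ) * (3 * (m : ℝ) ^ 2) ≤ (δ * δ) * ∑ i, ((H i).card : ℝ) := by
      refine le_trans (le_of_eq ?_) h1; ring
    exact le_of_mul_le_mul_left this (by positivity)
  have h3 := le_card_meeting H (by
    rw [Fintype.card_prod, Fintype.card_fin, Nat.cast_mul, ← sq]; exact h2)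
  have h8 : ∀ c : Fin n × Fin n → Fin m × Fin m, (covered A δ r c).indicator 1 x
      = if ¬ ∀ i, c i ∉ H i then (1 : ENNReal) else 0 := by
    intro c
    have : x ∈ covered A δ r c ↔ ¬ ∀ i, c i ∉ H i := by
      push Not
      simp only [hHm]
      exact and_iff_right hx
    by_cases hc : x ∈ covered A δ r c
    · rw [Set.indicator_of_mem hc, if_pos (this.1 hc)]; rfl
    · rw [Set.indicator_of_notMem hc, if_neg (mt this.2 hc)]
  rw [Finset.sum_congr rfl fun c _ => h8 c, Finset.sum_ite, Finset.sum_const_zero, add_zero,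
    Finset.sum_const, nsmul_eq_mul, mul_one, ← ENNReal.ofReal_natCast]
  exact ENNReal.ofReal_le_ofReal h3

/-- On average over all configurations, three quarters of the inner square are covered. -/
lemma sum_volume_covered {A C : Set Plane} (hAo : IsOpen A) {r δ ρ : ℝ} {n m : ℕ} (hm : 0 < m)
    (hδ : 0 < δ) (hδρ : 2 * δ < ρ)
    (hA : ∀ x ∈ A, ‖x‖ ≤ r) (hC : ∀ y ∈ C, ∀ z, dist z y < ρ → z ∈ A)
    (hCvol : ENNReal.ofReal (3 * (δ * m) ^ 2) ≤ volume C) (hr : 2 * r ≤ δ * (n * m)) :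
    ENNReal.ofReal (3 / 4 * Fintype.card (Fin n × Fin n → Fin m × Fin m)
        * (δ * (n * m) - 2 * r) ^ 2)
      ≤ ∑ c : Fin n × Fin n → Fin m × Fin m, volume (covered A δ r c) := by
  have hmeas := fun c : Fin n × Fin n → Fin m × Fin m =>
    (isOpen_covered hAo δ r c).measurableSet
  calc _ = ENNReal.ofReal (3 / 4 * Fintype.card (Fin n × Fin n → Fin m × Fin m))
        * volume (innerSquare r (δ * (n * m))) := by
        rw [volume_innerSquare hr,
          ENNReal.ofReal_mul (mul_nonneg (by norm_num) (Nat.cast_nonneg _))]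
    _ = ∫⁻ _ in innerSquare r (δ * (n * m)),
        ENNReal.ofReal (3 / 4 * Fintype.card (Fin n × Fin n → Fin m × Fin m)) := by
        rw [setLIntegral_const]
    _ ≤ ∫⁻ x in innerSquare r (δ * (n * m)),
        ∑ c : Fin n × Fin n → Fin m × Fin m, (covered A δ r c).indicator 1 x :=
        setLIntegral_mono' (isOpen_innerSquare _ _).measurableSet fun x hx =>
          le_sum_indicator_covered hm hδ hδρ hA hC hCvol hx
    _ ≤ ∫⁻ x, ∑ c : Fin n × Fin n → Fin m × Fin m, (covered A δ r c).indicator 1 x :=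
        setLIntegral_le_lintegral _ _
    _ = _ := by
        rw [lintegral_finsetSum _ fun c _ => measurable_one.indicator (hmeas c)]
        exact Finset.sum_congr rfl fun c _ => lintegral_indicator_one (hmeas c)

/-- A configuration with one translate of each section of `G` in each cell of side `D` that covers
half of a large square, for every section. -/
lemma exists_placement {G : Set (ℝ × Plane)} (hG : IsOpen G) {K : Set ℝ} (hK : IsCompact K)
    {r : ℝ} (hr : 0 < r) (hGr : ∀ s ∈ K, ∀ x, (s, x) ∈ G → ‖x‖ ≤ r) {D : ℝ} (hD : 0 < D)
    (hvol : ∀ s ∈ K, ENNReal.ofReal (3 * D ^ 2) < volume {x | (s, x) ∈ G}) (T₀ : ℝ) :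
    ∃ (ι : Type) (_ : Fintype ι) (p : ι → Plane) (n : ℕ), Fintype.card ι = n ^ 2 ∧ T₀ ≤ n * D ∧
      (Function.Injective fun i => (⌊p i 0 / D⌋, ⌊p i 1 / D⌋)) ∧
      ∀ s ∈ K, ENNReal.ofReal ((n * D) ^ 2 / 2)
        ≤ volume (innerSquare 0 (n * D) ∩ {x | ∃ i, (s, x - p i) ∈ G}) := by
  classical
  obtain ⟨ρ, hρ, hthick⟩ := exists_uniform_thick_subset hG hK hvol
  obtain ⟨m, hm⟩ := exists_nat_gt (2 * D / ρ)
  have hmR : (0 : ℝ) < m := lt_of_le_of_lt (by positivity) hm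
  have hm0 : 0 < m := by exact_mod_cast hmR
  obtain ⟨k, hk⟩ := exists_nat_gt (max (16 * r) T₀ / D)
  rw [div_lt_iff₀ hD] at hk
  have hk1 : 16 * r < k * D := (le_max_left _ _).trans_lt hk
  have hk2 : T₀ < k * D := (le_max_right _ _).trans_lt hk
  have hkR : (0 : ℝ) < k := by
    by_contra hcon
    nlinarith
  have hk0 : 0 < k := by exact_mod_cast hkR
  set δ : ℝ := D / m with hδ
  have hδ0 : 0 < δ := by positivity
  have hδm : δ * m = D := by rw [hδ]; field_simp
  have hδρ : 2 * δ < ρ := by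
    rw [hδ, ← mul_div_assoc, div_lt_iff₀ hmR]
    rw [div_lt_iff₀ hρ] at hm
    linarith
  -- A single configuration good for every `s` is not needed: all of them are laid side by side, and
  -- the average coverage, at least 3/4 for each `s`, becomes actual coverage. Each is repeated `W`
  -- times only to make the whole a square.
  let Conf := Fin k × Fin k → Fin m × Fin m
  set W := Fintype.card Conf with hW
  let e : Conf ≃ Fin W := Fintype.equivFin Conf
  have hW0 : 0 < W := Fintype.card_pos_iff.2 ⟨fun _ => (⟨0, hm0⟩, ⟨0, hm0⟩)⟩
  let p : Conf × Fin W × (Fin k × Fin k) → Plane := fun q =>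
    latticePoint δ m (k * e q.1 + q.2.2.1, k * q.2.1 + q.2.2.2)
      ((q.1 q.2.2).1, (q.1 q.2.2).2)
  let o : Conf × Fin W → Plane := fun q => latticePoint δ m (k * e q.1, k * q.2) (0, 0)
  have hpo : ∀ a b i, p (a, b, i)
      = o (a, b) + latticePoint δ m (i.1, i.2) ((a i).1, (a i).2) := by
    intro a b i
    ext j
    fin_cases j
    · simp [p, o]; ring
    · simp [p, o]; ring
  refine ⟨Conf × Fin W × (Fin k × Fin k), inferInstance, p, W * k, ?_, ?_, ?_, ?_⟩
  · simp only [Fintype.card_prod, Fintype.card_fin]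
    rw [← hW]; ring
  · refine hk2.le.trans ?_
    have h1 : (1 : ℝ) ≤ W := by exact_mod_cast hW0
    push_cast
    refine mul_le_mul_of_nonneg_right ?_ hD.le
    nlinarith
  · have hfl : ∀ (i : ℕ) (j : Fin m), ⌊δ * (i * m + (j : ℕ) : ℝ) / D⌋ = i := by
      intro i j
      have hj : ((j : ℕ) : ℝ) + 1 ≤ m := by exact_mod_cast j.2
      have hj0 : (0 : ℝ) ≤ (j : ℕ) := Nat.cast_nonneg _
      rw [Int.floor_eq_iff, le_div_iff₀ hD, div_lt_iff₀ hD, ← hδm]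
      push_cast
      constructor <;> nlinarith
    have hdm : ∀ (i j : ℕ) (i' j' : Fin k), ((k * i + i' : ℕ) : ℤ) = ((k * j + j' : ℕ) : ℤ) →
        i = j ∧ i' = j' := by
      intro i j i' j' h
      have h' : k * i + (i' : ℕ) = k * j + j' := by exact_mod_cast h
      have h1 := congrArg (· / k) h'
      have h2 := congrArg (· % k) h'
      simp only [Nat.mul_add_div hk0, Nat.div_eq_of_lt i'.2, Nat.div_eq_of_lt j'.2, add_zero] at h1
      simp only [Nat.mul_add_mod, Nat.mod_eq_of_lt i'.2, Nat.mod_eq_of_lt j'.2] at h2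
      exact ⟨h1, Fin.ext h2⟩
    rintro ⟨a, b, i⟩ ⟨a', b', i'⟩ h
    simp only [p, latticePoint_zero, latticePoint_one, hfl, Prod.mk.injEq] at h
    obtain ⟨h1, h2⟩ := hdm _ _ _ _ h.1
    obtain ⟨h3, h4⟩ := hdm _ _ _ _ h.2
    have h5 : a = a' := e.injective (Fin.ext h1)
    rw [h5, Fin.ext h3, Prod.ext h2 h4]
  · intro s hs
    obtain ⟨C, hC, hCG⟩ := hthick s hs
    set A : Set Plane := {x | (s, x) ∈ G} with hA
    have hAo : IsOpen A := hG.preimage (by fun_prop)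
    have hT : δ * (k * m) = k * D := by rw [← hδm]; ring
    have hsum := sum_volume_covered (A := A) (C := C) (n := k) hAo hm0 hδ0 hδρ
      (fun x hx => hGr s hs x hx) hCG (by rwa [hδm]) (by rw [hT]; linarith)
    rw [hT] at hsum
    let B : Conf × Fin W → Set Plane := fun q => {x | x - o q ∈ covered A δ r q.1}
    have hBo : ∀ q, IsOpen (B q) := fun q => (isOpen_covered hAo δ r q.1).preimage (by fun_prop)
    have hBvol : ∀ q, volume (B q) = volume (covered A δ r q.1) := fun q => volume_translate _ _
    have hoX : ∀ q, cX 0 (o q) = (k * D) * e q.1 := by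
      intro q
      simp only [cX, o, Real.cos_zero, Real.sin_zero, mul_one, mul_zero, add_zero,
        latticePoint_zero, ← hδm]
      push_cast; ring
    have hoY : ∀ q, cY 0 (o q) = (k * D) * q.2 := by
      intro q
      simp only [cY, o, Real.cos_zero, Real.sin_zero, mul_one, mul_zero, neg_zero, zero_add,
        latticePoint_one, ← hδm]
      push_cast; ring
    have hBx : ∀ q, ∀ x ∈ B q, cX 0 x ∈ Set.Ioo ((k * D) * (e q.1 : ℕ) : ℝ)
        ((k * D) * (e q.1 : ℕ) + k * D) ∧
        cY 0 x ∈ Set.Ioo ((k * D) * (q.2 : ℕ) : ℝ) ((k * D) * (q.2 : ℕ) + k * D) := by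
      rintro q x ⟨⟨⟨h1, h2⟩, h3, h4⟩, -⟩
      rw [cX_sub, hoX] at h1 h2
      rw [cY_sub, hoY] at h3 h4
      rw [hT] at h2 h4
      exact ⟨⟨by linarith, by linarith⟩, by linarith, by linarith⟩
    have hkD : 0 < k * D := by positivity
    have huniq : ∀ (t : ℝ) (i j : ℕ), t ∈ Set.Ioo ((k * D) * i) ((k * D) * i + k * D) →
        t ∈ Set.Ioo ((k * D) * j) ((k * D) * j + k * D) → i = j := by
      intro t i j hi hj
      have v1 : (k * D) * i < (k * D) * (j + 1) := by linarith [hi.1, hj.2]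
      have v2 : (k * D) * j < (k * D) * (i + 1) := by linarith [hi.2, hj.1]
      have w1 := lt_of_mul_lt_mul_left v1 hkD.le
      have w2 := lt_of_mul_lt_mul_left v2 hkD.le
      have x1 : i < j + 1 := by exact_mod_cast w1
      have x2 : j < i + 1 := by exact_mod_cast w2
      omega
    have hdisj : Pairwise (Function.onFun Disjoint B) := by
      intro q q' hqq
      rw [Function.onFun, Set.disjoint_left]
      intro x hx hx'
      obtain ⟨h1, h2⟩ := hBx q x hx
      obtain ⟨h3, h4⟩ := hBx q' x hx'
      exact hqq (Prod.ext (e.injective (Fin.ext (huniq _ _ _ h1 h3)))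
        (Fin.ext (huniq _ _ _ h2 h4)))
    have hsub : (⋃ q, B q) ⊆ innerSquare 0 ((W * k : ℕ) * D) ∩ {x | ∃ i, (s, x - p i) ∈ G} := by
      refine Set.iUnion_subset fun q x hx => ⟨?_, ?_⟩
      · obtain ⟨h1, h2⟩ := hBx q x hx
        have key : ∀ (t : ℝ) (i : Fin W),
            t ∈ Set.Ioo ((k * D) * (i : ℕ) : ℝ) ((k * D) * (i : ℕ) + k * D) →
            t ∈ Set.Ioo 0 ((W * k : ℕ) * D - 0) := by
          intro t i ht
          have hi : ((i : ℕ) : ℝ) + 1 ≤ W := by exact_mod_cast i.2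
          refine ⟨lt_of_le_of_lt (by positivity) ht.1, ht.2.trans_le ?_⟩
          have := mul_le_mul_of_nonneg_left hi hkD.le
          push_cast
          linarith
        exact ⟨key _ _ h1, key _ _ h2⟩
      · obtain ⟨-, i, hi⟩ := hx
        refine ⟨(q.1, q.2, i), ?_⟩
        rw [hpo, ← sub_sub]
        exact hi
    refine le_trans ?_ (measure_mono hsub)
    rw [measure_iUnion hdisj fun q => (hBo q).measurableSet, tsum_fintype]
    simp_rw [hBvol]
    rw [Fintype.sum_prod_type]
    simp only [Finset.sum_const, Finset.card_univ, Fintype.card_fin]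
    rw [← Finset.smul_sum, nsmul_eq_mul]
    refine le_trans ?_ (mul_le_mul_right hsum _)
    rw [← ENNReal.ofReal_natCast, ← ENNReal.ofReal_mul (Nat.cast_nonneg _)]
    refine ENNReal.ofReal_le_ofReal ?_
    -- The margin costs at most an eighth of the side since `16 r < k D`, and `3 / 4 * (7 / 8) ^ 2 >
    -- 1 / 2`.
    have h1 : 7 / 8 * (k * D) ≤ k * D - 2 * r := by linarith
    have h2 : (7 / 8 * (k * D)) ^ 2 ≤ (k * D - 2 * r) ^ 2 :=
      pow_le_pow_left₀ (by positivity) h1 2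
    have h3 : (0 : ℝ) ≤ (W : ℝ) * (3 / 4 * W) := by positivity
    have h4 := mul_le_mul_of_nonneg_left h2 h3
    have h5 : 0 ≤ ((W : ℝ) * (k * D)) ^ 2 := by positivity
    push_cast
    linarith

/-! ### Transport by similarities. -/

/-- The direct similarity that maps `v` to the origin, rotates by `-θ` and scales by `t`. -/
def similarity (v : Plane) (θ t : ℝ) (x : Plane) : Plane := t • rot θ (x - v)

section Similarity

variable {v : Plane} {θ t : ℝ}

lemma cX_similarity (s : ℝ) (x : Plane) :
    cX s (similarity v θ t x) = t * (cX (s + θ) x - cX (s + θ) v) := by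
  rw [similarity, cX_smul, cX_rot, cX_sub]

lemma cY_similarity (s : ℝ) (x : Plane) :
    cY s (similarity v θ t x) = t * (cY (s + θ) x - cY (s + θ) v) := by
  rw [similarity, cY_smul, cY_rot, cY_sub]

lemma continuous_similarity : Continuous (similarity v θ t) := by
  unfold similarity; fun_prop

lemma measurableEmbedding_similarity (ht : 0 < t) : MeasurableEmbedding (similarity v θ t) :=
  (((Homeomorph.subRight v).trans (rot θ).toHomeomorph).trans
    (Homeomorph.smulOfNeZero t ht.ne')).measurableEmbedding

lemma map_similarity (ht : 0 < t) :
    (volume : Measure Plane).map (similarity v θ t) = ENNReal.ofReal ((t ^ 2)⁻¹) • volume := by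
  have h1 : (volume : Measure Plane).map (fun x => rot θ (x - v)) = volume :=
    ((rot θ).measurePreserving.comp (measurePreserving_sub_right volume v)).map_eq
  have h2 := Measure.map_addHaar_smul (volume : Measure Plane) ht.ne'
  rw [show similarity v θ t = (fun x : Plane => t • x) ∘ fun x => rot θ (x - v) from rfl,
    ← Measure.map_map (by fun_prop) (by fun_prop), h1]
  rw [finrank_euclideanSpace, Fintype.card_fin, abs_of_nonneg (by positivity)] at h2
  exact h2

lemma volume_preimage_similarity (ht : 0 < t) (S : Set Plane) :
    volume (similarity v θ t ⁻¹' S) = ENNReal.ofReal ((t ^ 2)⁻¹) * volume S := by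
  rw [← (measurableEmbedding_similarity ht).map_apply, map_similarity ht, Measure.smul_apply,
    smul_eq_mul]

lemma preimage_rectangle (ht : 0 < t) (s a b c d : ℝ) :
    similarity v θ t ⁻¹' rectangle s a b c d = rectangle (s + θ) (cX (s + θ) v + a / t)
      (cX (s + θ) v + b / t) (cY (s + θ) v + c / t) (cY (s + θ) v + d / t) := by
  ext x
  have h : ∀ y z w : ℝ, (w + y / t < z ↔ y < t * (z - w)) ∧ (z < w + y / t ↔ t * (z - w) < y) := by
    intro y z w
    rw [← lt_sub_iff_add_lt', div_lt_iff₀ ht, mul_comm, ← sub_lt_iff_lt_add', lt_div_iff₀ ht,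
      mul_comm (z - w)]
    exact ⟨Iff.rfl, Iff.rfl⟩
  simp only [Set.mem_preimage, mem_rectangle, cX_similarity, cY_similarity, Set.mem_Ioo, h]

lemma average_preimage_similarity (ht : 0 < t) (F : Plane → ℝ) (R : Set Plane) :
    ⨍ x in similarity v θ t ⁻¹' R, F (similarity v θ t x) = ⨍ x in R, F x := by
  have hp : 0 < (t ^ 2)⁻¹ := by positivity
  have h := (measurableEmbedding_similarity (v := v) (θ := θ) ht).setIntegral_map
    (μ := volume) F R
  rw [map_similarity ht, Measure.restrict_smul, integral_smul_measure,
    ENNReal.toReal_ofReal hp.le] at h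
  rw [setAverage_eq, setAverage_eq, ← h, measureReal_def, volume_preimage_similarity ht,
    ENNReal.toReal_mul, ENNReal.toReal_ofReal hp.le, ← measureReal_def, smul_smul, mul_inv,
    mul_right_comm, inv_mul_cancel₀ hp.ne', one_mul]

lemma integral_similarity (ht : 0 < t) (F : Plane → ℝ) :
    ∫ x, F (similarity v θ t x) = (t ^ 2)⁻¹ * ∫ x, F x := by
  have hp : 0 < (t ^ 2)⁻¹ := by positivity
  rw [← (measurableEmbedding_similarity ht).integral_map, map_similarity ht, integral_smul_measure,
    ENNReal.toReal_ofReal hp.le, smul_eq_mul]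

lemma integrable_similarity (ht : 0 < t) {F : Plane → ℝ} (hF : Integrable F) :
    Integrable fun x => F (similarity v θ t x) := by
  have := (measurableEmbedding_similarity (v := v) (θ := θ) ht).integrable_map_iff
    (μ := volume) (g := F)
  rw [map_similarity ht] at this
  exact this.1 (hF.smul_measure ENNReal.ofReal_ne_top)

lemma ae_continuousAt_similarity (ht : 0 < t) {F : Plane → ℝ} (hF : ∀ᵐ x, ContinuousAt F x) :
    ∀ᵐ x, ContinuousAt (fun x => F (similarity v θ t x)) x := by
  have h : ∀ᵐ x, ContinuousAt F (similarity v θ t x) := by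
    rw [ae_iff] at hF ⊢
    have := volume_preimage_similarity (v := v) (θ := θ) ht {x | ¬ ContinuousAt F x}
    rw [hF, mul_zero] at this
    exact this
  filter_upwards [h] with x hx
  exact ContinuousAt.comp (f := similarity v θ t) hx continuous_similarity.continuousAt

lemma exceeds_similarity_subset (ht : 0 < t) (F : Plane → ℝ) (s ε : ℝ) :
    exceeds (fun x => F (similarity v θ t x)) (s + θ) ε ⊆ similarity v θ t ⁻¹' exceeds F s ε := by
  rintro x ⟨R, ⟨a, b, c, d, hab, hcd, rfl⟩, hx, h⟩
  have hR := preimage_rectangle (v := v) (θ := θ) ht s (t * (a - cX (s + θ) v))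
    (t * (b - cX (s + θ) v)) (t * (c - cY (s + θ) v)) (t * (d - cY (s + θ) v))
  simp only [mul_div_cancel_left₀ _ ht.ne', add_sub_cancel] at hR
  rw [← hR] at hx h
  rw [average_preimage_similarity ht] at h
  exact ⟨_, ⟨_, _, _, _, mul_lt_mul_of_pos_left (by linarith) ht,
    mul_lt_mul_of_pos_left (by linarith) ht, rfl⟩, hx, h⟩

lemma mem_exceedsSmall_similarity (ht : 0 < t) {F : Plane → ℝ} {s a b c d U ε Λ : ℝ}
    (hab : a < b) (hcd : c < d) (hb : b - a ≤ U) (hd : d - c ≤ U) (hU : 2 * U / t < ε) {x : Plane}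
    (hx : similarity v θ t x ∈ rectangle s a b c d) (h : Λ < ⨍ y in rectangle s a b c d, F y) :
    x ∈ exceedsSmall (fun x => F (similarity v θ t x)) (s + θ) ε Λ := by
  have h1 : cX (s + θ) v + a / t < cX (s + θ) v + b / t := by gcongr
  have h2 : cY (s + θ) v + c / t < cY (s + θ) v + d / t := by gcongr
  refine ⟨_, ⟨_, _, _, _, h1, h2, preimage_rectangle (v := v) ht s a b c d⟩, hx, ?_, ?_⟩
  · rw [preimage_rectangle ht]
    refine (diam_rectangle_le h1 h2).trans_lt (lt_of_le_of_lt ?_ hU)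
    rw [add_sub_add_left_eq_sub, add_sub_add_left_eq_sub, ← sub_div, ← sub_div, ← add_div]
    gcongr
    linarith
  · rwa [average_preimage_similarity ht]

lemma similarity_mem_innerSquare (ht : 0 < t) {x : Plane}
    (h : similarity v θ t x ∈ innerSquare 0 t) : x ∈ Metric.ball v 2 := by
  obtain ⟨⟨h1, h2⟩, h3, h4⟩ := h
  have e : ‖similarity v θ t x‖ = t * dist x v := by
    rw [similarity, norm_smul, Real.norm_of_nonneg ht.le, LinearIsometryEquiv.norm_map,
      dist_eq_norm]
  have := norm_le_abs_add 0 (similarity v θ t x)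
  rw [e, abs_of_pos h1, abs_of_pos h3] at this
  rw [Metric.mem_ball]
  by_contra hcon
  push Not at hcon
  nlinarith

end Similarity

/-! ### The building block. -/

lemma exists_rectangle_lt_average_placed {ι : Type*} [Fintype ι] {E : Set Plane} {p : ι → Plane}
    (hEm : MeasurableSet E) (hEtop : volume E ≠ ⊤) (hE0 : volume E ≠ 0) {Λ U s : ℝ} (hΛ : 0 ≤ Λ)
    {i : ι} {x : Plane} (hx : x - p i ∈ hitSet E Λ U s) :
    ∃ a b c d, a < b ∧ c < d ∧ b - a ≤ U ∧ d - c ≤ U ∧ x ∈ rectangle s a b c d ∧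
      Λ < ⨍ y in rectangle s a b c d, placed E p y := by
  obtain ⟨a, b, c, d, hab, hcd, hb, hd, hxR, hv⟩ := hx
  have hpos : 0 < volume.real E := ENNReal.toReal_pos hE0 hEtop
  have hmem : ∀ y, y - p i ∈ rectangle s a b c d ↔ y ∈ rectangle s (cX s (p i) + a)
      (cX s (p i) + b) (cY s (p i) + c) (cY s (p i) + d) := by
    intro y
    simp only [mem_rectangle, cX_sub, cY_sub, Set.mem_Ioo, lt_sub_iff_add_lt',
      sub_lt_iff_lt_add']
  refine ⟨cX s (p i) + a, cX s (p i) + b, cY s (p i) + c, cY s (p i) + d, by linarith, by linarith,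
    by linarith, by linarith, (hmem x).1 hxR, ?_⟩
  have hpos2 : 0 < (b - a) * (d - c) := mul_pos (sub_pos.2 hab) (sub_pos.2 hcd)
  rw [rectangle_average _ _ (by linarith) (by linarith), setIntegral_placed hEm hEtop,
    add_sub_add_left_eq_sub, add_sub_add_left_eq_sub, ← div_eq_inv_mul, lt_div_iff₀ hpos2]
  refine lt_of_lt_of_le ?_ (Finset.single_le_sum (fun j _ => share_nonneg (p j) _)
    (Finset.mem_univ i))
  have hset : rectangle s (cX s (p i) + a) (cX s (p i) + b) (cY s (p i) + c) (cY s (p i) + d)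
      ∩ {x | x - p i ∈ E} = {x | x - p i ∈ E ∩ rectangle s a b c d} := by
    ext y
    exact ⟨fun h => ⟨h.2, (hmem y).2 h.1⟩, fun h => ⟨(hmem y).1 h.2, h.1⟩⟩
  rw [share, hset, lt_div_iff₀ hpos, measureReal_def, measureReal_def, volume_translate]
  have h1 := (ENNReal.toReal_lt_toReal (ENNReal.mul_ne_top ENNReal.ofReal_ne_top hEtop)
    (ne_top_of_le_ne_top hEtop (measure_mono Set.inter_subset_left))).2 hv
  rwa [ENNReal.toReal_mul, ENNReal.toReal_ofReal (mul_nonneg hΛ hpos2.le)] at h1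

lemma le_abs_sin {h s : ℝ} (hs : ∀ n : ℤ, 40 * h ≤ |s + n * Real.pi|) :
    24 * h ≤ |Real.sin s| := by
  have hpi := Real.pi_pos
  set n := round (s / Real.pi) with hn
  have h1 := abs_sub_round (s / Real.pi)
  rw [← hn] at h1
  have h2 : |s - n * Real.pi| ≤ Real.pi / 2 := by
    have : s - n * Real.pi = (s / Real.pi - n) * Real.pi := by field_simp
    rw [this, abs_mul, abs_of_pos hpi]
    nlinarith
  have h3 := Real.mul_abs_le_abs_sin h2
  have h4 := hs (-n)
  push_cast at h4
  rw [neg_mul, ← sub_eq_add_neg] at h4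
  rw [Real.sin_sub_int_mul_pi, abs_mul, abs_zpow, abs_neg, abs_one, one_zpow, one_mul] at h3
  refine le_trans ?_ h3
  have h5 : 2 / Real.pi ≥ 3 / 5 := by
    rw [ge_iff_le, le_div_iff₀ hpi]
    linarith [Real.pi_lt_d2]
  nlinarith [abs_nonneg (s - n * Real.pi)]

/-- The order of choices matters: the thickness threshold `w` and the constant `B` depend only on
`ε` and `h`; then come the cell size `D`, the number `L` of scales, the set `E`, and last the size
`T` of the square. -/
theorem exists_block (v : Plane) (θ : ℝ) {h : ℝ} (hh : 0 < h) (hh1 : h ≤ 1 / 50) (Λ : ℝ) {ε : ℝ}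
    (hε : 0 < ε) :
    ∃ f : Plane → ℝ, (∀ x, 0 ≤ f x) ∧ Integrable f ∧ (∀ᵐ x, ContinuousAt f x) ∧ ∫ x, f x ≤ ε ∧
      (∀ s ∈ Set.Icc θ (θ + h), 1 / 2 ≤ volume (exceedsSmall f s ε Λ ∩ Metric.ball v 2)) ∧
      ∀ s, (∀ n : ℤ, 40 * h ≤ |s - θ + n * (Real.pi / 2)|) →
        volume (exceeds f s ε) ≤ ENNReal.ofReal ε := by
  -- For `s` in `[0, h]` one has `sin s ≤ h` and `cos s ≥ 1 / 2`, hence `sin s ≤ A cos s`.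
  set A := 2 * h with hA
  set M := max 1 Λ with hM
  have hM1 : 1 ≤ M := le_max_left _ _
  obtain ⟨w, hw0, hw⟩ : ∃ w : ℝ, 0 < w ∧ 100 ≤ ε * (w * w) := by
    refine ⟨max 1 (100 / ε), lt_of_lt_of_le one_pos (le_max_left _ _), ?_⟩
    have h1 := le_max_left 1 (100 / ε)
    have h2 := le_max_right 1 (100 / ε)
    rw [div_le_iff₀ hε] at h2
    nlinarith
  set B := 64 + 424 * (w + 4) * (1 / A) / ε with hB
  have hB1 : 1 ≤ B := by
    have : 0 ≤ 424 * (w + 4) * (1 / A) / ε := by positivity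
    linarith
  -- After rescaling, the integral is `1 / D ^ 2` and the exceptional set has measure at most `B / D
  -- ^ 2`.
  obtain ⟨D, hD8, hDw, hDB⟩ : ∃ D : ℝ, 8 ≤ D ∧ w ≤ 5 * D ∧ B ≤ ε * D ^ 2 := by
    refine ⟨max (max 8 w) (B / ε), (le_max_left _ _).trans (le_max_left _ _), ?_, ?_⟩
    · have := (le_max_right 8 w).trans (le_max_left _ (B / ε))
      linarith
    · have h1 := (le_max_left 8 w).trans (le_max_left _ (B / ε))
      have h2 := le_max_right (max 8 w) (B / ε)
      rw [div_le_iff₀ hε] at h2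
      have h3 : 0 ≤ max (max 8 w) (B / ε) := by linarith
      nlinarith
  -- Enough scales for the swept area `L / (30 M)` to exceed three cells, as the placement requires.
  obtain ⟨L, hL⟩ := exists_nat_gt (3 * D ^ 2 * (30 * M))
  obtain ⟨E, hEo, hEf, hE0, hE3, hstrip, hcov⟩ := exists_directional_set (A := A)
    (η := 1 / (48 * M * 2 ^ L)) (by positivity) (by linarith) (by positivity)
  have hEtop : volume E ≠ ⊤ := ne_top_of_le_ne_top
    (measure_closedBall_lt_top (x := (0 : Plane)) (r := 3)).ne
    (measure_mono fun x hx => by simpa using hE3 x hx)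
  set U : ℝ := 12 * 2 ^ L with hU
  have hU0 : 0 < U := by positivity
  obtain ⟨ι, _, p, n, hcard, hT, hinj, hcover⟩ := exists_placement
    (G := {q : ℝ × Plane | q.2 ∈ hitSet E M U q.1}) (isOpen_hitSet_graph hEo M U)
    (K := Set.Icc 0 h) isCompact_Icc (r := 3 + 2 * U) (by positivity)
    (fun s _ x hx => norm_le_of_mem_hitSet hE3 hx) (D := D) (by linarith)
    (fun s hs => by
      have hsin : 0 ≤ Real.sin s := Real.sin_nonneg_of_nonneg_of_le_pi hs.1
        (by linarith [hs.2, Real.pi_gt_three])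
      have hsin2 : Real.sin s ≤ s := Real.sin_le hs.1
      have hcos : 1 / 2 ≤ Real.cos s := by
        have := Real.one_sub_sq_div_two_le_cos (x := s)
        nlinarith [hs.1, hs.2]
      obtain ⟨Z, l, hl, hZl, hZ⟩ := hcov s (by linarith) hsin (by nlinarith [hs.2])
      refine lt_of_lt_of_le ?_ (le_volume_hitSet hE0 hE3 hM1 L hl ?_ hZ)
      · rw [ENNReal.ofReal_lt_ofReal_iff_of_nonneg (by positivity), mul_one_div,
          lt_div_iff₀ (by positivity)]
        exact hL
      · calc 12 * M * 2 ^ L * (Z.card * l) ≤ 12 * M * 2 ^ L * (1 / (48 * M * 2 ^ L)) := by gcongr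
          _ = 1 / 4 := by field_simp; norm_num)
    -- This size of the square makes the rectangles of sides at most `U` have diameter less than `ε`
    -- after rescaling.
    ((2 * U + 1) / ε)
  set T : ℝ := n * D with hTdef
  have hT0 : 0 < T := lt_of_lt_of_le (by positivity) hT
  have hD0 : 0 < D := by linarith
  have hTε : 2 * U / T < ε := by
    rw [div_le_iff₀ hε] at hT
    rw [div_lt_iff₀ hT0]
    linarith
  have hn0 : (n : ℝ) ≠ 0 := by
    rintro h0
    rw [hTdef, h0, zero_mul] at hT0
    exact lt_irrefl _ hT0
  have hscale : (T ^ 2)⁻¹ * (n : ℝ) ^ 2 = (D ^ 2)⁻¹ := by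
    rw [hTdef]; field_simp
  refine ⟨fun x => placed E p (similarity v θ T x), fun x => placed_nonneg _,
    integrable_similarity hT0 (integrable_placed hEo.measurableSet hEtop),
    ae_continuousAt_similarity hT0 (ae_continuousAt_placed hEf), ?_, fun s hs => ?_, fun s hs => ?_⟩
  · rw [integral_similarity hT0, integral_placed hEo.measurableSet hEtop hE0, hcard]
    push_cast
    rw [hscale, inv_le_iff_one_le_mul₀ (by positivity)]
    linarith
  · have hs0 : s - θ ∈ Set.Icc 0 h := ⟨by linarith [hs.1], by linarith [hs.2]⟩
    have h1 : similarity v θ T ⁻¹' (innerSquare 0 T ∩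
        {x | ∃ i, (s - θ, x - p i) ∈ {q : ℝ × Plane | q.2 ∈ hitSet E M U q.1}})
        ⊆ exceedsSmall (fun x => placed E p (similarity v θ T x)) s ε Λ ∩ Metric.ball v 2 := by
      rintro x ⟨hx1, i, hx2⟩
      refine ⟨?_, similarity_mem_innerSquare hT0 hx1⟩
      obtain ⟨a, b, c, d, hab, hcd, hb, hd, hx, hav⟩ :=
        exists_rectangle_lt_average_placed hEo.measurableSet hEtop hE0 (by linarith) hx2
      have := mem_exceedsSmall_similarity hT0 hab hcd hb hd hTε hx
        ((le_max_right 1 Λ).trans_lt hav)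
      rwa [sub_add_cancel] at this
    refine le_trans ?_ (measure_mono h1)
    rw [volume_preimage_similarity hT0]
    refine le_trans ?_ (mul_le_mul_right (hcover _ hs0) _)
    rw [← ENNReal.ofReal_mul (by positivity), ← mul_div_assoc, inv_mul_cancel₀ (by positivity),
      ENNReal.ofReal_div_of_pos (by norm_num)]
    simp
  · have hpar : ∀ t ∈ ({s - θ, s - θ + Real.pi / 2} : Set ℝ), ∀ c d,
        volume (E ∩ {x | cY t x ∈ Set.Ioo c d}) ≤ ENNReal.ofReal (1 / A * (d - c)) * volume E := by
      intro t ht c d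
      rw [one_div_mul_eq_div]
      refine hstrip t ?_ c d
      have : 24 * h ≤ |Real.sin t| := by
        refine le_abs_sin fun k => ?_
        rcases ht with rfl | rfl
        · have := hs (2 * k)
          push_cast at this
          convert this using 2
          ring
        · have := hs (2 * k + 1)
          push_cast at this
          convert this using 2
          ring
      linarith
    have h1 := volume_exceeds_placed_le hEo.measurableSet hE3 hEtop hE0 (C := 1 / A)
      (by positivity) hε hw0 hw hDw hD8 hinj hpar
    have h2 := exceeds_similarity_subset (v := v) (θ := θ) hT0 (placed E p) (s - θ) ε
    rw [sub_add_cancel] at h2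
    refine (measure_mono h2).trans ?_
    rw [volume_preimage_similarity hT0]
    refine (mul_le_mul_right h1 _).trans ?_
    rw [hcard, ← ENNReal.ofReal_natCast, ← ENNReal.ofReal_mul (by positivity),
      ← ENNReal.ofReal_mul (by positivity)]
    refine ENNReal.ofReal_le_ofReal ?_
    push_cast
    rw [mul_left_comm, hscale, ← div_eq_mul_inv, div_le_iff₀ (by positivity)]
    exact hDB

/-! ### Whitney intervals and the function of a single `G_δ` set. -/

/-- The interval `[l * 2 ^ (-i), (l + 1) * 2 ^ (-i)]` is of a length comparable to its distance
from the complement of `G`. -/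
def IsWhitney (G : Set ℝ) (i : ℕ) (l : ℤ) : Prop :=
  (∀ x : ℝ, |x - l * (1 / 2) ^ i| ≤ 40 * (1 / 2) ^ i → x ∈ G) ∧
    ∃ g : ℝ, g ∉ G ∧ |g - l * (1 / 2) ^ i| ≤ 102 * (1 / 2) ^ i

lemma exists_isWhitney {G : Set ℝ} (hG : IsOpen G) {a : ℝ}
    (hGa : G ⊆ Set.Ioo a (a + Real.pi / 2)) {s : ℝ} (hs : s ∈ G) :
    ∃ i l, IsWhitney G i l ∧ s ∈ Set.Icc (l * (1 / 2 : ℝ) ^ i) (l * (1 / 2) ^ i + (1 / 2) ^ i) := by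
  have ha : a ∈ Gᶜ := fun h => lt_irrefl a (hGa h).1
  set d := Metric.infDist s Gᶜ with hd
  have hd0 : 0 < d := (hG.isClosed_compl.notMem_iff_infDist_pos ⟨a, ha⟩).1 (by simpa using hs)
  have hd2 : d ≤ 2 := by
    refine (Metric.infDist_le_dist_of_mem ha).trans ?_
    rw [Real.dist_eq, abs_of_pos (by linarith [(hGa hs).1])]
    linarith [(hGa hs).2, Real.pi_le_four]
  -- With `h = (1 / 2) ^ (n + 1)` this means `50 h < d ≤ 100 h`. As `s` is within `h` of the left
  -- endpoint, the radius 40 is safe, and 102 reaches the complement.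
  obtain ⟨n, hn1, hn2⟩ := exists_nat_pow_near_of_lt_one (x := d / 50) (y := (1 / 2 : ℝ))
    (by positivity) (by linarith) (by norm_num) (by norm_num)
  have hp : (1 / 2 : ℝ) ^ n = 2 * (1 / 2) ^ (n + 1) := by rw [pow_succ]; ring
  rw [hp] at hn2
  set h : ℝ := (1 / 2) ^ (n + 1) with hh
  have hpos : 0 < h := by positivity
  have f1 : (⌊s / h⌋ : ℝ) * h ≤ s := (le_div_iff₀ hpos).1 (Int.floor_le _)
  have f2 : s ≤ (⌊s / h⌋ : ℝ) * h + h := by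
    have := ((div_lt_iff₀ hpos).1 (Int.lt_floor_add_one (s / h))).le
    linarith
  refine ⟨n + 1, ⌊s / h⌋, ⟨fun x hx => ?_, ?_⟩, ?_⟩
  · by_contra hxG
    have h1 := Metric.infDist_le_dist_of_mem (x := s) (s := Gᶜ) hxG
    rw [Real.dist_eq] at h1
    have h2 : |s - x| ≤ 41 * h := by
      rw [abs_le] at hx ⊢
      constructor <;> linarith [hx.1, hx.2]
    linarith
  · obtain ⟨g, hg, hgs⟩ := (Metric.infDist_lt_iff (x := s) (s := Gᶜ) (r := 101 * h) ⟨a, ha⟩).1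
      (by linarith)
    refine ⟨g, hg, ?_⟩
    rw [Real.dist_eq, abs_lt] at hgs
    rw [abs_le]
    constructor <;> linarith [hgs.1, hgs.2]
  · exact ⟨f1, f2⟩

/-- If `s` is in `G`, a nearby Whitney interval has length at least `1 / 142` of the distance from
`s` to the complement, which bounds `i` and then `l`. If `s` is not in `G`, no interval qualifies.
-/
lemma finite_isWhitney {G : Set ℝ} (hG : IsOpen G) (s : ℝ) :
    {p : ℕ × ℤ | IsWhitney G p.1 p.2 ∧
      |s - p.2 * (1 / 2 : ℝ) ^ p.1| ≤ 40 * (1 / 2) ^ p.1}.Finite := by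
  by_cases hs : s ∈ G
  swap
  · convert Set.finite_empty
    ext p
    simp only [Set.mem_empty_iff_false, iff_false]
    exact fun hp => hs (hp.1.1 s hp.2)
  rcases Set.eq_empty_or_nonempty Gᶜ with hne | hne
  · convert Set.finite_empty
    ext p
    simp only [Set.mem_empty_iff_false, iff_false]
    rintro ⟨⟨-, g, hg, -⟩, -⟩
    have : g ∈ Gᶜ := hg
    simp [hne] at this
  set d := Metric.infDist s Gᶜ with hd
  have hd0 : 0 < d := (hG.isClosed_compl.notMem_iff_infDist_pos hne).1 (by simpa using hs)
  obtain ⟨N, hN⟩ := exists_pow_lt_of_lt_one (show 0 < d / 142 by positivity)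
    (show (1 / 2 : ℝ) < 1 by norm_num)
  obtain ⟨L, hL⟩ := exists_nat_ge (|s| * 2 ^ N + 40)
  refine ((Finset.range N ×ˢ Finset.Icc (-(L : ℤ)) L).finite_toSet).subset ?_
  rintro ⟨i, l⟩ ⟨⟨-, g, hg, hgl⟩, hsl⟩
  simp only at hgl hsl
  have hpos : (0 : ℝ) < (1 / 2) ^ i := by positivity
  have hi : i < N := by
    by_contra hcon
    have h1 : (1 / 2 : ℝ) ^ i ≤ (1 / 2) ^ N :=
      pow_le_pow_of_le_one (by norm_num) (by norm_num) (not_lt.1 hcon)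
    have h2 := Metric.infDist_le_dist_of_mem (x := s) (s := Gᶜ) hg
    rw [Real.dist_eq] at h2
    have h3 : |s - g| ≤ 142 * (1 / 2) ^ i := by
      rw [abs_le] at hgl hsl ⊢
      constructor <;> linarith [hgl.1, hgl.2, hsl.1, hsl.2]
    linarith
  have hl : |(l : ℝ)| ≤ L := by
    have h1 : |(l : ℝ)| * (1 / 2) ^ i ≤ |s| + 40 * (1 / 2) ^ i := by
      rw [← abs_of_pos hpos, ← abs_mul, abs_of_pos hpos]
      have := abs_sub_abs_le_abs_sub ((l : ℝ) * (1 / 2) ^ i) s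
      rw [abs_sub_comm] at this
      linarith
    have h2 : (1 / 2 : ℝ) ^ i * 2 ^ i = 1 := by rw [← mul_pow]; norm_num
    have h3 : (2 : ℝ) ^ i ≤ 2 ^ N := pow_le_pow_right₀ (by norm_num) hi.le
    have h4 : |(l : ℝ)| ≤ |s| * 2 ^ i + 40 := by
      have := mul_le_mul_of_nonneg_right h1 (show (0 : ℝ) ≤ 2 ^ i by positivity)
      rw [mul_assoc, h2, mul_one, add_mul, mul_assoc, h2, mul_one] at this
      exact this
    nlinarith [abs_nonneg s]
  rw [abs_le] at hl
  simp only [Finset.coe_product, Set.mem_prod, Finset.mem_coe, Finset.mem_range, Finset.mem_Icc]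
  exact ⟨hi, by exact_mod_cast hl.1, by exact_mod_cast hl.2⟩

lemma exists_gδ_function {V : Set ℝ} (hV : IsGδ V) {a : ℝ} (hVa : V ⊆ Set.Ioo a (a + Real.pi / 2))
    (v : Plane) {ε : ℝ} (hε : 0 < ε) :
    ∃ F : Plane → ℝ, Integrable F ∧ ∫ x, ‖F x‖ ≤ ε ∧
      (∀ s : ℝ, (∀ n : ℤ, s + n * (Real.pi / 2) ∉ V) → Differentiates s F) ∧
      ∀ s ∈ V, 0 < volume ({x | upperDerivative s F x = ⊤} ∩ Metric.ball v 2) := by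
  obtain ⟨G', hG', hVG'⟩ := isGδ_iff_eq_iInter_nat.1 hV
  let G : ℕ → Set ℝ := fun k => Set.Ioo a (a + Real.pi / 2) ∩ ⋂ i ∈ Finset.range (k + 1), G' i
  have hG : ∀ k, IsOpen (G k) := fun k =>
    isOpen_Ioo.inter (isOpen_biInter_finset fun i _ => hG' i)
  have hGa : ∀ k, G k ⊆ Set.Ioo a (a + Real.pi / 2) := fun k => Set.inter_subset_left
  have hanti : ∀ {m n}, m ≤ n → G n ⊆ G m := by
    intro m n hmn x hx
    refine ⟨hx.1, ?_⟩
    have := hx.2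
    simp only [Set.mem_iInter, Finset.mem_range] at this ⊢
    exact fun i hi => this i (by omega)
  have hVG : ∀ x, x ∈ V ↔ ∀ k, x ∈ G k := by
    intro x
    constructor
    · intro hx k
      refine ⟨hVa hx, ?_⟩
      rw [hVG', Set.mem_iInter] at hx
      simp only [Set.mem_iInter]
      exact fun i _ => hx i
    · intro hx
      rw [hVG', Set.mem_iInter]
      intro i
      have := (hx i).2
      simp only [Set.mem_iInter, Finset.mem_range] at this
      exact this i (by omega)
  let φ : ℕ × ℕ × ℤ ≃ ℕ := Denumerable.eqv (ℕ × ℕ × ℤ)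
  let e : ℕ → ℝ := fun n => ε / 2 / 2 ^ n
  have he : ∀ n, 0 < e n := fun n => by positivity
  have hex : ∀ n, ∃ f : Plane → ℝ, (∀ x, 0 ≤ f x) ∧ Integrable f ∧ (∀ᵐ x, ContinuousAt f x) ∧
      ∫ x, f x ≤ e n ∧
      (IsWhitney (G (φ.symm n).1) (φ.symm n).2.1 (φ.symm n).2.2 →
        ∀ s ∈ Set.Icc ((φ.symm n).2.2 * (1 / 2 : ℝ) ^ (φ.symm n).2.1)
          ((φ.symm n).2.2 * (1 / 2 : ℝ) ^ (φ.symm n).2.1 + (1 / 2) ^ (φ.symm n).2.1),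
          1 / 2 ≤ volume (exceedsSmall f s (e n) ((φ.symm n).1 : ℝ) ∩ Metric.ball v 2)) ∧
      ∀ s, (IsWhitney (G (φ.symm n).1) (φ.symm n).2.1 (φ.symm n).2.2 →
        ∀ m : ℤ, 40 * (1 / 2 : ℝ) ^ (φ.symm n).2.1
          ≤ |s - (φ.symm n).2.2 * (1 / 2 : ℝ) ^ (φ.symm n).2.1 + m * (Real.pi / 2)|) →
        volume (exceeds f s (e n)) ≤ ENNReal.ofReal (e n) := by
    intro n
    obtain ⟨k, i, l⟩ := φ.symm n
    by_cases hW : IsWhitney (G k) i l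
    -- An interval of length `80 * (1 / 2) ^ i` fits in `G k`, which has length at most `π / 2`.
    · have hh : (1 / 2 : ℝ) ^ i ≤ 1 / 50 := by
        have h1 := (hGa k (hW.1 (l * (1 / 2) ^ i + 40 * (1 / 2) ^ i)
          (by simp [abs_of_nonneg]))).2
        have h2 := (hGa k (hW.1 (l * (1 / 2) ^ i - 40 * (1 / 2) ^ i)
          (by simp [abs_of_nonneg]))).1
        have := Real.pi_lt_d2
        linarith
      obtain ⟨f, h1, h2, h3, h4, h5, h6⟩ := exists_block v (l * (1 / 2 : ℝ) ^ i)
        (show (0 : ℝ) < (1 / 2) ^ i by positivity) hh k (he n)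
      exact ⟨f, h1, h2, h3, h4, fun _ => h5, fun s hs => h6 s (hs hW)⟩
    · refine ⟨fun _ => 0, fun _ => le_rfl, integrable_zero _ _ _, ?_, ?_, fun h => absurd h hW,
        fun s _ => ?_⟩
      · exact Eventually.of_forall fun x => continuousAt_const
      · simpa using (he n).le
      · have : exceeds (fun _ => 0) s (e n) = ∅ := by
          ext x
          simp only [Set.mem_empty_iff_false, iff_false]
          rintro ⟨R, -, -, hR⟩
          simp only [setAverage_eq, integral_zero, smul_zero] at hR
          exact absurd hR (not_lt.2 (he n).le)
        rw [this]; simp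
  choose f h0 hint hcont hi hA hB using hex
  have hsum : Summable e := summable_geometric_two' ε
  refine ⟨fun x => ∑' n, f n x, integrable_tsum_of_integral h0 hint hsum hi, ?_, ?_, ?_⟩
  · simp_rw [Real.norm_of_nonneg (tsum_nonneg fun n => h0 n _)]
    exact (integral_tsum_le h0 hint hsum hi).trans (tsum_geometric_two' ε).le
  · intro s hs
    have hfin1 : {n : ℤ | s + n * (Real.pi / 2) ∈ Set.Ioo a (a + Real.pi / 2)}.Finite := by
      have hpi : 0 < Real.pi / 2 := by positivity
      obtain ⟨L, hL⟩ := exists_nat_ge (|a - s| / (Real.pi / 2) + 1)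
      refine (Set.finite_Icc (-(L : ℤ)) L).subset ?_
      rintro n ⟨hn1, hn2⟩
      have e1 : |a - s| ≤ (L - 1) * (Real.pi / 2) := by
        rw [← div_le_iff₀ hpi]; linarith
      rw [abs_le] at e1
      have u1 : (-(L : ℝ)) * (Real.pi / 2) < n * (Real.pi / 2) := by linarith [e1.1]
      have u2 : (n : ℝ) * (Real.pi / 2) < L * (Real.pi / 2) := by linarith [e1.2]
      have u1' := lt_of_mul_lt_mul_right u1 hpi.le
      have u2' := lt_of_mul_lt_mul_right u2 hpi.le
      constructor
      · exact_mod_cast u1'.le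
      · exact_mod_cast u2'.le
    have hk0 : ∀ n : ℤ, ∃ k0, ∀ k, k0 ≤ k → s + n * (Real.pi / 2) ∉ G k := by
      intro n
      have := hs n
      rw [hVG] at this
      push Not at this
      obtain ⟨k0, hk0⟩ := this
      exact ⟨k0, fun k hk hmem => hk0 (hanti hk hmem)⟩
    choose k0 hk0 using hk0
    -- These are the indices of the blocks not known to be harmless at the slope `s`: finitely many
    -- translates of `s` matter, each leaves the sets `G k` from some `k` on, and for each remaining
    -- `k` it is close to finitely many Whitney intervals.
    have hfin : (⋃ n ∈ {n : ℤ | s + n * (Real.pi / 2) ∈ Set.Ioo a (a + Real.pi / 2)},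
        ⋃ k ∈ Set.Iio (k0 n), (fun p : ℕ × ℤ => φ (k, p)) ''
          {p : ℕ × ℤ | IsWhitney (G k) p.1 p.2 ∧
      |s + n * (Real.pi / 2) - p.2 * (1 / 2 : ℝ) ^ p.1| ≤ 40 * (1 / 2) ^ p.1}).Finite :=
      hfin1.biUnion fun n _ => (Set.finite_Iio _).biUnion fun k _ =>
        (finite_isWhitney (hG k) _).image _
    obtain ⟨N, hN⟩ := hfin.bddAbove
    refine differentiates_tsum h0 hint hcont hsum hi (N := N + 1) fun n hn => hB n s ?_
    intro hW m
    by_contra hlt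
    have hlt' := (not_le.1 hlt).le
    have hmem : s + m * (Real.pi / 2) ∈ G (φ.symm n).1 := hW.1 _ (by
      rw [show s + m * (Real.pi / 2) - (φ.symm n).2.2 * (1 / 2 : ℝ) ^ (φ.symm n).2.1
        = s - (φ.symm n).2.2 * (1 / 2 : ℝ) ^ (φ.symm n).2.1 + m * (Real.pi / 2) by ring]
      exact hlt')
    have : n ≤ N := by
      refine hN ?_
      simp only [Set.mem_iUnion]
      refine ⟨m, hGa _ hmem, (φ.symm n).1, ?_, (φ.symm n).2, ⟨hW, ?_⟩, by simp⟩
      · by_contra hcon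
        exact hk0 m _ (not_lt.1 hcon) hmem
      · rw [show s + m * (Real.pi / 2) - (φ.symm n).2.2 * (1 / 2 : ℝ) ^ (φ.symm n).2.1
          = s - (φ.symm n).2.2 * (1 / 2 : ℝ) ^ (φ.symm n).2.1 + m * (Real.pi / 2) by ring]
        exact hlt'
    omega
  · intro s hs
    refine volume_upperDerivative_tsum_pos h0 hint hsum hi fun K => ?_
    have hch : ∀ k, ∃ p : ℕ × ℤ, IsWhitney (G k) p.1 p.2 ∧
        s ∈ Set.Icc (p.2 * (1 / 2 : ℝ) ^ p.1) (p.2 * (1 / 2) ^ p.1 + (1 / 2) ^ p.1) := by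
      intro k
      obtain ⟨i, l, h⟩ := exists_isWhitney (hG k) (hGa k) ((hVG s).1 hs k)
      exact ⟨(i, l), h⟩
    choose p hp1 hp2 using hch
    -- Distinct generations have distinct indices, so along the blocks that are bad for `s` the
    -- bound `e` tends to zero while the level `k` tends to infinity.
    have hinj : Function.Injective fun k => φ (k, p k) := fun k k' hkk =>
      congrArg Prod.fst (φ.injective hkk)
    have hlim : Tendsto (fun k => e (φ (k, p k))) atTop (𝓝 0) :=
      hsum.tendsto_atTop_zero.comp hinj.nat_tendsto_atTop
    obtain ⟨k, hk1, hk2⟩ := ((hlim.eventually (ge_mem_nhds (b := 0)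
      (show (0 : ℝ) < 1 / ((K : ℝ) + 1) by positivity))).and (eventually_ge_atTop K)).exists
    refine ⟨φ (k, p k), (k : ℝ), by exact_mod_cast hk2, hk1, ?_⟩
    have := hA (φ (k, p k))
    rw [Equiv.symm_apply_apply] at this
    exact this (hp1 k) s (hp2 k)

/-! ### Countable unions: one vertical strip for each `G_δ` set. -/

lemma upperDerivative_congr {f g : Plane → ℝ} {s : ℝ} {x : Plane} (h : f =ᶠ[𝓝 x] g) :
    upperDerivative s f x = upperDerivative s g x := by
  refine limsup_congr ?_
  filter_upwards [eventually_shrinking_subset h] with R ⟨hR, _, hsub⟩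
  rw [setAverage_congr_fun (isOpen_of_mem_rectangles hR).measurableSet
    (Eventually.of_forall fun y hy => hsub hy)]

lemma tendsto_average_congr {f g : Plane → ℝ} {s : ℝ} {x : Plane} (h : f =ᶠ[𝓝 x] g)
    (hg : Tendsto (fun R : Set Plane => ⨍ y in R, g y) (shrinking s x) (𝓝 (g x))) :
    Tendsto (fun R : Set Plane => ⨍ y in R, f y) (shrinking s x) (𝓝 (f x)) := by
  rw [h.eq_of_nhds]
  refine hg.congr' ?_
  filter_upwards [eventually_shrinking_subset h] with R ⟨hR, _, hsub⟩
  exact (setAverage_congr_fun (isOpen_of_mem_rectangles hR).measurableSet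
    (Eventually.of_forall fun y hy => hsub hy)).symm

/-- Both properties are local in `x`, and off the boundary lines of the strips `F` coincides near
each point with a single `f n`. Thus the countably many functions never interact, as they would in a
sum. -/
lemma isWRSet_of_gδ_family {S : Set ℝ} (V : ℤ → Set ℝ) (a : ℤ → ℝ) (hV : ∀ n, IsGδ (V n))
    (hVa : ∀ n, V n ⊆ Set.Ioo (a n) (a n + Real.pi / 2)) (hSV : S = ⋃ n, V n)
    (hS : S ⊆ Set.Ico (0 : ℝ) (Real.pi / 2)) : IsWRSet S := by
  have hpi : 0 < Real.pi / 2 := by positivity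
  have hex := fun n : ℤ => exists_gδ_function (hV n) (hVa n) (!₂[10 * (n : ℝ) + 5, 0])
    (show (0 : ℝ) < (1 / 2) ^ n.natAbs by positivity)
  choose f hint hnorm hdiff hbad using hex
  let strip : ℤ → Set Plane := fun n => {x | ⌊x 0 / 10⌋ = n}
  have hstrip : ∀ n, MeasurableSet (strip n) := fun n =>
    (show Measurable fun x : Plane => ⌊x 0 / 10⌋ by fun_prop) (measurableSet_singleton n)
  let F : Plane → ℝ := fun x => f ⌊x 0 / 10⌋ x
  have hFs : ∀ n, Set.EqOn F (f n) (strip n) := by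
    intro n x hx
    change f ⌊x 0 / 10⌋ x = f n x
    rw [show ⌊x 0 / 10⌋ = n from hx]
  have hnhds : ∀ x : Plane, (∀ n : ℤ, x 0 ≠ 10 * n) → F =ᶠ[𝓝 x] f ⌊x 0 / 10⌋ := by
    intro x hx
    have h1 : ((⌊x 0 / 10⌋ : ℤ) : ℝ) < x 0 / 10 := lt_of_le_of_ne (Int.floor_le _) fun h =>
      hx ⌊x 0 / 10⌋ (by linarith)
    have hc : Continuous fun y : Plane => y 0 / 10 := by fun_prop
    filter_upwards [hc.continuousAt.eventually (lt_mem_nhds h1),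
      hc.continuousAt.eventually (gt_mem_nhds (Int.lt_floor_add_one (x 0 / 10)))] with y h2 h3
    exact hFs _ (Int.floor_eq_iff.2 ⟨h2.le, h3⟩)
  have hF : Integrable F := by
    rw [← integrableOn_univ, show (Set.univ : Set Plane) = ⋃ n, strip n by
      ext x; simp [strip]]
    refine integrableOn_iUnion_of_summable_integral_norm (fun n => ?_) ?_
    · exact (integrableOn_congr_fun (hFs n) (hstrip n)).2 (hint n).integrableOn
    · refine Summable.of_nonneg_of_le (fun n => integral_nonneg fun x => norm_nonneg _)
        (f := fun n : ℤ => (1 / 2 : ℝ) ^ n.natAbs) (fun n => ?_) ?_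
      · refine le_trans (le_of_eq ?_) ((setIntegral_le_integral (s := strip n) (hint n).norm
          (Eventually.of_forall fun x => norm_nonneg _)).trans (hnorm n))
        exact setIntegral_congr_fun (hstrip n) fun x hx => by simp only [hFs n hx]
      · refine Summable.of_nat_of_neg ?_ ?_ <;>
        simpa using summable_geometric_of_lt_one (r := (1 / 2 : ℝ)) (by norm_num) (by norm_num)
  refine ⟨F, hF, fun s hs => ?_, fun s hs => ?_⟩
  -- Both `s` and the elements of `S` lie in `[0, π / 2)`, so only the translate with `k = 0` could
  -- fall in `S`.
  · have hsV : ∀ n (k : ℤ), s + k * (Real.pi / 2) ∉ V n := by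
      intro n k hk
      have hkS : s + k * (Real.pi / 2) ∈ S := by rw [hSV]; exact Set.mem_iUnion.2 ⟨n, hk⟩
      have h1 := hS hkS
      have h2 := hs.1
      have u1 : (-1 : ℝ) * (Real.pi / 2) < k * (Real.pi / 2) := by linarith [h1.1, h2.2]
      have u2 : (k : ℝ) * (Real.pi / 2) < 1 * (Real.pi / 2) := by linarith [h1.2, h2.1]
      have u1' := lt_of_mul_lt_mul_right u1 hpi.le
      have u2' := lt_of_mul_lt_mul_right u2 hpi.le
      have k1 : -1 < k := by exact_mod_cast u1'
      have k2 : k < 1 := by exact_mod_cast u2'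
      have : k = 0 := by omega
      subst this
      exact hs.2 (by simpa using hkS)
    have hn : ∀ᵐ x : Plane, ∀ n : ℤ, x 0 ≠ 10 * n := by
      refine ae_all_iff.2 fun n => ae_iff.2 ?_
      have := volume_cX_eq 0 (10 * n)
      simpa [cX] using this
    filter_upwards [hn, ae_all_iff.2 fun n => hdiff n s (hsV n)] with x h1 h2
    exact tendsto_average_congr (hnhds x h1) (h2 _)
  · rw [hSV] at hs
    obtain ⟨n, hn⟩ := Set.mem_iUnion.1 hs
    refine (hbad n s hn).trans_le (measure_mono ?_)
    rintro x ⟨hx, hxb⟩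
    have hx0 : |x 0 - (10 * (n : ℝ) + 5)| < 2 := by
      rw [Metric.mem_ball, dist_eq_norm] at hxb
      have := abs_cX_le 0 (x - !₂[10 * (n : ℝ) + 5, 0])
      simp [cX] at this
      linarith
    rw [abs_lt] at hx0
    have hfl : ⌊x 0 / 10⌋ = n := by
      rw [Int.floor_eq_iff]
      constructor <;> linarith [hx0.1, hx0.2]
    have hne : ∀ m : ℤ, x 0 ≠ 10 * m := by
      intro m hm
      rw [hm] at hx0
      have v1 : (10 * n : ℝ) + 3 < 10 * m := by linarith [hx0.1]
      have v2 : (10 * m : ℝ) < 10 * n + 7 := by linarith [hx0.2]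
      have v1' : 10 * n + 3 < 10 * m := by exact_mod_cast v1
      have v2' : 10 * m < 10 * n + 7 := by exact_mod_cast v2
      omega
    change upperDerivative s F x = ⊤
    rw [upperDerivative_congr (hnhds x hne), hfl]
    exact hx

lemma isWRSet_of_isGδσ {S : Set ℝ} (hS : S ⊆ Set.Ico (0 : ℝ) (Real.pi / 2)) (h : IsGδσ S) :
    IsWRSet S := by
  have hpi : 0 < Real.pi := Real.pi_pos
  obtain ⟨V, hV, rfl⟩ := h
  -- The slope 0 is not interior to `[0, π / 2)`: it is split off as a `G_δ` set inside `(-π / 4, π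
  -- / 4)` and assigned to the negative indices.
  let W : ℤ → Set ℝ := fun n => if n < 0 then {0} ∩ ⋃ n, V n else
    V n.toNat ∩ Set.Ioo 0 (Real.pi / 2)
  refine isWRSet_of_gδ_family W (fun n => if n < 0 then -(Real.pi / 4) else 0) (fun n => ?_)
    (fun n => ?_) ?_ hS
  · by_cases hn : n < 0
    · simp only [W, hn, if_true]
      exact ((Set.finite_singleton (0 : ℝ)).subset Set.inter_subset_left).isClosed.isGδ
    · simp only [W, hn, if_false]
      exact (hV _).inter isOpen_Ioo.isGδ
  · by_cases hn : n < 0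
    · simp only [W, hn, if_true]
      rintro x ⟨hx, -⟩
      rw [Set.mem_singleton_iff] at hx
      subst hx
      constructor <;> linarith
    · simp only [W, hn, if_false, zero_add]
      exact Set.inter_subset_right
  · ext s
    constructor
    · intro hs
      rcases (hS hs).1.eq_or_lt with h0 | h0
      · refine Set.mem_iUnion.2 ⟨-1, ?_⟩
        simp only [W, show (-1 : ℤ) < 0 by norm_num, if_true]
        exact ⟨h0.symm, hs⟩
      · obtain ⟨n, hn⟩ := Set.mem_iUnion.1 hs
        refine Set.mem_iUnion.2 ⟨n, ?_⟩
        simp only [W, show ¬ ((n : ℤ) < 0) by omega, if_false, Int.toNat_natCast]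
        exact ⟨hn, h0, (hS hs).2⟩
    · intro hs
      obtain ⟨n, hn⟩ := Set.mem_iUnion.1 hs
      by_cases h : n < 0
      · simp only [W, h, if_true] at hn
        exact hn.2
      · simp only [W, h, if_false] at hn
        exact Set.mem_iUnion.2 ⟨_, hn.1⟩

end WeakRSet

end

theorem theorem2 (S : Set ℝ) (hS : S ⊆ Set.Ico (0 : ℝ) (Real.pi / 2)) :
    WeakRSet.IsWRSet S ↔ WeakRSet.IsGδσ S :=
  ⟨WeakRSet.isGδσ_of_isWRSet hS, WeakRSet.isWRSet_of_isGδσ hS⟩
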